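/- Let $n\ge 2$ and $\alpha>0$. Let $S^n\subset\mathbb R^{n+1}$ be the unit sphere with surface measure $dy$, and write its points off the poles as $x=(\theta,\xi')=(\sin\theta\,\xi',-\cos\theta)$ with $0<\theta<\pi$, $\xi'\in S^{n-1}$ (so $\tan(\theta/2)\,\xi'$ is the stereographic projection of $x$ that sends $-e_{n+1}$ to $0$). Put $\sigma_{n-1}=2\pi^{n/2}/\Gamma(n/2)$ and, for measurable $\varphi:S^n\to\mathbb C$, $$(S^\alpha_+\varphi)(x)=\frac{2}{\Gamma(\alpha)\sigma_{n-1}}\int_{-1<y_{n+1}<x_{n+1}}\frac{(x_{n+1}-y_{n+1})^\alpha}{|x-y|^n}\varphi(y)\,dy,$$ $$(S^\alpha_-\varphi)(x)=\frac{2}{\Gamma(\alpha)\sigma_{n-1}}\int_{x_{n+1}<y_{n+1}<1}\frac{(y_{n+1}-x_{n+1})^\alpha}{|x-y|^n}\varphi(y)\,dy .$$ Let $\{Y_{j,k}: j\ge 0,\ 1\le k\le d_n(j)\}$ be an orthonormal basis of $L^2(S^{n-1})$ consisting of real spherical harmonics, where $Y_{j,k}$ has degree $j$ and $d_n(j)$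 is the dimension of the space of spherical harmonics of degree $j$. For a function $g$ on $S^{n-1}$, the relation $g\sim\sum_{j,k}c_{j,k}Y_{j,k}$ means that $g\in L^1(S^{n-1})$ and $c_{j,k}=\int_{S^{n-1}}g\,Y_{j,k}\,d\xi'$ for all $j,k$. **Theorem.** Suppose that $\varphi(\theta,\cdot)\sim\sum_{j,k}\varphi_{j,k}(r)\,Y_{j,k}$, $r=\tan(\theta/2)$, for almost every $\theta\in(0,\pi)$. Let $f^\pm=S^\alpha_\pm\varphi$, and put $$f^+_{j,k}(r)=c_\alpha(r)\int_0^r(r^2-\rho^2)^{\alpha-1}\frac{\varphi_{j,k}(\rho)}{(1+\rho^2)^{\alpha+n/2}}\Big(\frac{\rho}{r}\Big)^{j+n-2}\rho\,d\rho,$$ $$f^-_{j,k}(r)=c_\alpha(r)\int_r^\infty(\rho^2-r^2)^{\alpha-1}\frac{\varphi_{j,k}(\rho)}{(1+\rho^2)^{\alpha+n/2}}\Big(\frac{r}{\rho}\Big)^{j}\rho\,d\rho,\qquad c_\alpha(r)=\frac{2^{\alpha+1}}{\Gamma(\alpha)}(1+r^2)^{n/2-\alpha}.$$ For each choice of the sign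 $\pm$: (i) if the integral $(S^\alpha_\pm\varphi)(x)$ exists in the Lebesgue sense for almost every $x\in S^n$, then for almost every $\theta\in(0,\pi)$ all the integrals $f^\pm_{j,k}(\tan(\theta/2))$ converge absolutely and $$f^\pm(\theta,\cdot)\sim\sum_{j,k}f^\pm_{j,k}(\tan(\theta/2))\,Y_{j,k};$$ (ii) the same conclusion holds at every individual $\theta\in(0,\pi)$ for which $\int_{S^{n-1}}(S^\alpha_\pm|\varphi|)(\theta,\xi')\,d\xi'<\infty$. -/

import Mathlib

open MeasureTheory Set

noncomputable section

/-- The unit sphere of the Euclidean space `ℝ^m` (so `USphere n` is `S^{n-1}` and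
`USphere (n + 1)` is `S^n`). -/
abbrev USphere (m : ℕ) : Type := Metric.sphere (0 : EuclideanSpace ℝ (Fin m)) 1

/-- The (unnormalized) surface area measure on the unit sphere of `ℝ^m`. -/
def surf (m : ℕ) : Measure (USphere m) :=
  (volume : Measure (EuclideanSpace ℝ (Fin m))).toSphere

/-- The last coordinate `x_{n+1}` of a point `x` of `S^n`. -/
def lastCoord {n : ℕ} (x : USphere (n + 1)) : ℝ :=
  (x : EuclideanSpace ℝ (Fin (n + 1))) (Fin.last n)

/-- The area `σ_{n-1} = 2 π^{n/2} / Γ(n/2)` of the unit sphere `S^{n-1}` in `ℝ^n`. -/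
def sphereArea (n : ℕ) : ℝ := 2 * Real.pi ^ ((n : ℝ) / 2) / Real.Gamma ((n : ℝ) / 2)

/-- The vector `(sin θ · ξ', - cos θ)` of `ℝ^{n+1}`. -/
def polarVec {n : ℕ} (θ : ℝ) (ξ : USphere n) : EuclideanSpace ℝ (Fin (n + 1)) :=
  WithLp.toLp 2
    (Fin.snoc (α := fun _ => ℝ)
      (fun i : Fin n => Real.sin θ * (ξ : EuclideanSpace ℝ (Fin n)) i) (-Real.cos θ))

theorem norm_polarVec {n : ℕ} (θ : ℝ) (ξ : USphere n) : ‖polarVec θ ξ‖ = 1 := by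
  have hξ : ∑ i, ((ξ : EuclideanSpace ℝ (Fin n)) i) ^ 2 = 1 := by
    have h := EuclideanSpace.norm_sq_eq (ξ : EuclideanSpace ℝ (Fin n))
    have h1 : ‖(ξ : EuclideanSpace ℝ (Fin n))‖ = 1 := by simp
    rw [h1] at h
    simpa using h.symm
  have h2 : ‖polarVec θ ξ‖ ^ 2 = 1 := by
    rw [EuclideanSpace.norm_sq_eq, Fin.sum_univ_castSucc]
    simp only [polarVec, Fin.snoc_castSucc, Fin.snoc_last, Real.norm_eq_abs, sq_abs, mul_pow]
    rw [← Finset.mul_sum, hξ]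
    linarith [Real.sin_sq_add_cos_sq θ]
  nlinarith [norm_nonneg (polarVec θ ξ)]

/-- The point of `S^n` with polar coordinates `(θ, ξ')`, where `0 < θ < π`, `ξ' ∈ S^{n-1}`. The
angle is measured from the south pole `-e_{n+1}`, so that the stereographic projection that sends
`-e_{n+1}` to `0` and `e_{n+1}` to `∞` sends this point to `tan (θ / 2) · ξ'`. -/
def polarPt {n : ℕ} (θ : ℝ) (ξ : USphere n) : USphere (n + 1) :=
  ⟨polarVec θ ξ, by simpa using norm_polarVec θ ξ⟩

theorem lastCoord_polarPt {n : ℕ} (θ : ℝ) (ξ : USphere n) :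
    lastCoord (polarPt θ ξ) = -Real.cos θ := by
  simp [lastCoord, polarPt, polarVec]

/-- The spherical segment `{y ∈ S^n : a < y_{n+1} < b}`. -/
def segment_S (n : ℕ) (a b : ℝ) : Set (USphere (n + 1)) :=
  {y | a < lastCoord y ∧ lastCoord y < b}

/-- The kernel of the left-sided spherical fractional integral,
`(x_{n+1} - y_{n+1})^α / |x - y|^n`. -/
def kerLeft (n : ℕ) (α : ℝ) (x y : USphere (n + 1)) : ℝ :=
  (lastCoord x - lastCoord y) ^ α /
    ‖(x : EuclideanSpace ℝ (Fin (n + 1))) - (y : EuclideanSpace ℝ (Fin (n + 1)))‖ ^ n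

/-- The kernel of the right-sided spherical fractional integral,
`(y_{n+1} - x_{n+1})^α / |x - y|^n`. -/
def kerRight (n : ℕ) (α : ℝ) (x y : USphere (n + 1)) : ℝ :=
  (lastCoord y - lastCoord x) ^ α /
    ‖(x : EuclideanSpace ℝ (Fin (n + 1))) - (y : EuclideanSpace ℝ (Fin (n + 1)))‖ ^ n

/-- The left-sided spherical fractional integral `S^α_{a+} φ`. -/
def sphFracLeft (n : ℕ) (α a : ℝ) (φ : USphere (n + 1) → ℂ) (x : USphere (n + 1)) : ℂ :=
  ((2 / (Real.Gamma α * sphereArea n) : ℝ) : ℂ) *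
    ∫ y in segment_S n a (lastCoord x), (kerLeft n α x y : ℂ) * φ y ∂(surf (n + 1))

/-- The right-sided spherical fractional integral `S^α_{b-} φ`. -/
def sphFracRight (n : ℕ) (α b : ℝ) (φ : USphere (n + 1) → ℂ) (x : USphere (n + 1)) : ℂ :=
  ((2 / (Real.Gamma α * sphereArea n) : ℝ) : ℂ) *
    ∫ y in segment_S n (lastCoord x) b, (kerRight n α x y : ℂ) * φ y ∂(surf (n + 1))

/-- `S^α_+ = S^α_{(-1)+}`. -/
def SPlus (n : ℕ) (α : ℝ) (φ : USphere (n + 1) → ℂ) (x : USphere (n + 1)) : ℂ :=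
  sphFracLeft n α (-1) φ x

/-- `S^α_- = S^α_{1-}`. -/
def SMinus (n : ℕ) (α : ℝ) (φ : USphere (n + 1) → ℂ) (x : USphere (n + 1)) : ℂ :=
  sphFracRight n α 1 φ x

/-- The integral defining `(S^α_+ φ)(x)` exists in the Lebesgue sense. -/
def SPlusExists (n : ℕ) (α : ℝ) (φ : USphere (n + 1) → ℂ) (x : USphere (n + 1)) : Prop :=
  IntegrableOn (fun y => (kerLeft n α x y : ℂ) * φ y) (segment_S n (-1) (lastCoord x))
    (surf (n + 1))

/-- The integral defining `(S^α_- φ)(x)` exists in the Lebesgue sense. -/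
def SMinusExists (n : ℕ) (α : ℝ) (φ : USphere (n + 1) → ℂ) (x : USphere (n + 1)) : Prop :=
  IntegrableOn (fun y => (kerRight n α x y : ℂ) * φ y) (segment_S n (lastCoord x) 1)
    (surf (n + 1))

/-- At the angle `θ`, the integral over `ξ' ∈ S^{n-1}` of `(S^α_+ |φ|)(θ, ξ')` is finite. -/
def SPlusFiniteAt (n : ℕ) (α : ℝ) (φ : USphere (n + 1) → ℂ) (θ : ℝ) : Prop :=
  ∫⁻ ξ : USphere n, (∫⁻ y in segment_S n (-1) (lastCoord (polarPt θ ξ)),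
    ‖(kerLeft n α (polarPt θ ξ) y : ℂ) * φ y‖ₑ ∂(surf (n + 1))) ∂(surf n) < ⊤

/-- At the angle `θ`, the integral over `ξ' ∈ S^{n-1}` of `(S^α_- |φ|)(θ, ξ')` is finite. -/
def SMinusFiniteAt (n : ℕ) (α : ℝ) (φ : USphere (n + 1) → ℂ) (θ : ℝ) : Prop :=
  ∫⁻ ξ : USphere n, (∫⁻ y in segment_S n (lastCoord (polarPt θ ξ)) 1,
    ‖(kerRight n α (polarPt θ ξ) y : ℂ) * φ y‖ₑ ∂(surf (n + 1))) ∂(surf n) < ⊤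

/-- The Laplacian of a polynomial in `n` variables, as a linear map. -/
def polyLaplacian (n : ℕ) : MvPolynomial (Fin n) ℝ →ₗ[ℝ] MvPolynomial (Fin n) ℝ :=
  ∑ i : Fin n, ((MvPolynomial.pderiv i).toLinearMap ∘ₗ (MvPolynomial.pderiv i).toLinearMap)

/-- Restriction of a polynomial to the unit sphere `S^{n-1}`, as a linear map. -/
def restrictSphere (n : ℕ) : MvPolynomial (Fin n) ℝ →ₗ[ℝ] (USphere n → ℝ) where
  toFun p := fun ξ => MvPolynomial.eval (fun i => (ξ : EuclideanSpace ℝ (Fin n)) i) p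
  map_add' p q := by ext ξ; simp
  map_smul' c p := by ext ξ; simp [MvPolynomial.smul_eval]

/-- The space of (real) spherical harmonics of degree `j` on `S^{n-1}`: the restrictions of the
harmonic homogeneous polynomials of degree `j`. -/
def sphHarm (n j : ℕ) : Submodule ℝ (USphere n → ℝ) :=
  (MvPolynomial.homogeneousSubmodule (Fin n) ℝ j ⊓ LinearMap.ker (polyLaplacian n)).map
    (restrictSphere n)

/-- The dimension `d_n(j)` of the space of spherical harmonics of degree `j` on `S^{n-1}`. -/
def sphHarmDim (n j : ℕ) : ℕ := Module.finrank ℝ (sphHarm n j)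

/-- `{Y_{j,k}}`, `j ≥ 0`, `1 ≤ k ≤ d_n(j)`, is an orthonormal basis of `L²(S^{n-1})` consisting of
spherical harmonics, `Y_{j,k}` being of degree `j`. (For each `j` there are as many functions as the
dimension of the space of spherical harmonics of degree `j`, so that they span it.) -/
structure IsSphHarmBasis (n : ℕ) (Y : (j : ℕ) → Fin (sphHarmDim n j) → USphere n → ℝ) : Prop where
  mem : ∀ j k, Y j k ∈ sphHarm n j
  orthonormal : ∀ (i : ℕ) (l : Fin (sphHarmDim n i)) (j : ℕ) (k : Fin (sphHarmDim n j)),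
    ∫ ξ, Y i l ξ * Y j k ξ ∂(surf n) =
      if (⟨i, l⟩ : Σ j, Fin (sphHarmDim n j)) = ⟨j, k⟩ then 1 else 0

/-- `g ∼ ∑_{j,k} c_{j,k} Y_{j,k}` is the Fourier-Laplace decomposition of `g` on `S^{n-1}`:
`g` is integrable and `c_{j,k} = ∫ g Y_{j,k}` for all `j`, `k`. -/
def IsFourierLaplace (n : ℕ) (Y : (j : ℕ) → Fin (sphHarmDim n j) → USphere n → ℝ)
    (g : USphere n → ℂ) (c : (j : ℕ) → Fin (sphHarmDim n j) → ℂ) : Prop :=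
  Integrable g (surf n) ∧ ∀ j k, c j k = ∫ ξ, g ξ * (Y j k ξ : ℂ) ∂(surf n)

/-- `c_α(r) = 2^{α+1} / Γ(α) · (1 + r²)^{n/2 - α}`. -/
def cAlpha (n : ℕ) (α r : ℝ) : ℝ :=
  2 ^ (α + 1) / Real.Gamma α * (1 + r ^ 2) ^ ((n : ℝ) / 2 - α)

/-- The integrand of `f^+_{j,k}(r)`, with `u = φ_{j,k}`. -/
def abelPlusIntegrand (n : ℕ) (α : ℝ) (j : ℕ) (u : ℝ → ℂ) (r ρ : ℝ) : ℂ :=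
  (((r ^ 2 - ρ ^ 2) ^ (α - 1) : ℝ) : ℂ) * (u ρ / (((1 + ρ ^ 2) ^ (α + (n : ℝ) / 2) : ℝ) : ℂ)) *
    (((ρ / r) ^ (j + n - 2) * ρ : ℝ) : ℂ)

/-- The integrand of `f^-_{j,k}(r)`, with `u = φ_{j,k}`. -/
def abelMinusIntegrand (n : ℕ) (α : ℝ) (j : ℕ) (u : ℝ → ℂ) (r ρ : ℝ) : ℂ :=
  (((ρ ^ 2 - r ^ 2) ^ (α - 1) : ℝ) : ℂ) * (u ρ / (((1 + ρ ^ 2) ^ (α + (n : ℝ) / 2) : ℝ) : ℂ)) *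
    (((r / ρ) ^ j * ρ : ℝ) : ℂ)

/-- `f^+_{j,k}(r)`, with `u = φ_{j,k}`. -/
def abelPlus (n : ℕ) (α : ℝ) (j : ℕ) (u : ℝ → ℂ) (r : ℝ) : ℂ :=
  (cAlpha n α r : ℂ) * ∫ ρ in Ioo 0 r, abelPlusIntegrand n α j u r ρ

/-- `f^-_{j,k}(r)`, with `u = φ_{j,k}`. -/
def abelMinus (n : ℕ) (α : ℝ) (j : ℕ) (u : ℝ → ℂ) (r : ℝ) : ℂ :=
  (cAlpha n α r : ℂ) * ∫ ρ in Ioi r, abelMinusIntegrand n α j u r ρ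

/-- The decomposition of `f^+ = S^α_+ φ` at the angle `θ`: the integrals `f^+_{j,k}(tan (θ/2))`
converge absolutely and are the Fourier-Laplace coefficients of `f^+(θ, ·)`. -/
def PlusExpansionAt (n : ℕ) (α : ℝ) (Y : (j : ℕ) → Fin (sphHarmDim n j) → USphere n → ℝ)
    (φ : USphere (n + 1) → ℂ) (u : (j : ℕ) → Fin (sphHarmDim n j) → ℝ → ℂ) (θ : ℝ) : Prop :=
  (∀ j k, IntegrableOn (abelPlusIntegrand n α j (u j k) (Real.tan (θ / 2)))
    (Ioo 0 (Real.tan (θ / 2)))) ∧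
  IsFourierLaplace n Y (fun ξ => SPlus n α φ (polarPt θ ξ))
    (fun j k => abelPlus n α j (u j k) (Real.tan (θ / 2)))

/-- The decomposition of `f^- = S^α_- φ` at the angle `θ`: the integrals `f^-_{j,k}(tan (θ/2))`
converge absolutely and are the Fourier-Laplace coefficients of `f^-(θ, ·)`. -/
def MinusExpansionAt (n : ℕ) (α : ℝ) (Y : (j : ℕ) → Fin (sphHarmDim n j) → USphere n → ℝ)
    (φ : USphere (n + 1) → ℂ) (u : (j : ℕ) → Fin (sphHarmDim n j) → ℝ → ℂ) (θ : ℝ) : Prop :=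
  (∀ j k, IntegrableOn (abelMinusIntegrand n α j (u j k) (Real.tan (θ / 2)))
    (Ioi (Real.tan (θ / 2)))) ∧
  IsFourierLaplace n Y (fun ξ => SMinus n α φ (polarPt θ ξ))
    (fun j k => abelMinus n α j (u j k) (Real.tan (θ / 2)))

end

noncomputable section

/-! For two points with polar angles θ, η and stereographic radii a = tan(θ/2), b = tan(η/2), the
chord is |x - y|² = 4 (a² + b² - 2ab⟨ξ, ζ⟩) / ((1 + a²)(1 + b²)). With M = max(a, b) and s = min(a,
b)/M the last factor of the numerator is M² (1 + s² - 2s⟨ξ, ζ⟩). Hence |x - y|^(-n) is a constant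
times 1/(1 - s²) times the Poisson kernel of the unit ball of ℝ^n: the exponent n is exactly the one
that makes this happen. The Poisson integral of a spherical harmonic of degree j multiplies it by σ
s^j, where σ is the area of S^{n-1}, so on each pair of parallels the kernel acts on degree j by an
explicit number (`integral_polarKer`). The factor 1/(1 - s²) cancels one power of cos η - cos θ,
which is why the exponent α turns into α - 1. Fubini (`integral_zonal_operator_mul`) and the
substitution ρ = tan(η/2) then give the Abel integrals. This is (ii), for either sign
(`expansion_of_finite`).

The Poisson formula is proved from scratch. Integration by parts against a Gaussian yields a
divergence formula for homogeneous polynomials on the sphere, hence a recursion for the moments ∫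
⟨ξ, ζ⟩^m p(ξ), which expresses the symmetry of the spherical Laplacian tested on a zonal polynomial
and a harmonic p. Weierstrass approximation extends it to zonal C² functions. Applied to the Poisson
kernel, which is harmonic, it shows that the Poisson integral solves s²u'' + (n-1)su' = j(j+n-2)u;
regularity at 0 leaves only the multiples of s^j, and the limit s → 1 fixes the multiple
(`poissonInt_eq`).

For (i) the finiteness required in (ii) has to be deduced at almost every θ. Let M be the measure in
η given by the integrals of |φ| over parallels. Existence at one point of the parallel θ bounds the
M-integral of |cos η - cos θ|^α, since chords have length at most 2. The mean over the parallel, by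
the eigenvalue of degree 0, is bounded by the M-integral of |cos η - cos θ|^(α-1) up to a factor
depending on θ. The first quantity is less singular, but its finiteness forces M to be finite on the
relevant segments, and Tonelli in θ then makes the second one finite almost everywhere
(`ae_lintegral_abel_lt_top`). -/

/-! ### Polar coordinates in ℝ^n. -/

theorem lintegral_polar_sphere {n : ℕ} (hn : 1 ≤ n)
    {f : EuclideanSpace ℝ (Fin n) → ENNReal} (hf : Measurable f) :
    ∫⁻ x, f x = ∫⁻ ξ : USphere n, (∫⁻ r in Ioi (0 : ℝ),
      ENNReal.ofReal (r ^ (n - 1)) * f (r • (ξ : EuclideanSpace ℝ (Fin n)))) ∂(surf n) := by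
  have : Nonempty (Fin n) := ⟨⟨0, hn⟩⟩
  have hmp := (volume : Measure (EuclideanSpace ℝ (Fin n))).measurePreserving_homeomorphUnitSphereProd
  have hdim : Module.finrank ℝ (EuclideanSpace ℝ (Fin n)) = n := by simp
  rw [hdim] at hmp
  have hg : Measurable (fun p : USphere n × Ioi (0 : ℝ) =>
      f ((p.2 : ℝ) • (p.1 : EuclideanSpace ℝ (Fin n)))) := by
    apply hf.comp; fun_prop
  have h1 := hmp.lintegral_comp hg
  rw [lintegral_prod _ hg.aemeasurable] at h1
  calc ∫⁻ x, f x = ∫⁻ x in ({0}ᶜ : Set (EuclideanSpace ℝ (Fin n))), f x := by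
        rw [restrict_compl_singleton]
    _ = ∫⁻ x : ({0}ᶜ : Set (EuclideanSpace ℝ (Fin n))), f x ∂(volume.comap Subtype.val) := by
        rw [lintegral_subtype_comap (measurableSet_singleton _).compl]
    _ = _ := by
        convert! h1 using 1
        · apply lintegral_congr
          intro x
          have hx : ‖(x : EuclideanSpace ℝ (Fin n))‖ ≠ 0 := norm_ne_zero_iff.2 x.2
          simp [smul_smul, hx]
        · apply lintegral_congr
          intro ξ
          rw [Measure.volumeIoiPow, lintegral_withDensity_eq_lintegral_mul₀]
          · simp only [Pi.mul_apply]
            rw [← lintegral_subtype_comap measurableSet_Ioi (fun r : ℝ => ENNReal.ofReal (r ^ (n - 1)) * f (r • (ξ : EuclideanSpace ℝ (Fin n))))]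
          · fun_prop
          · exact (hg.comp (measurable_const.prodMk measurable_id)).aemeasurable

/-- No integrability is needed: for a product integrand `integral_prod_mul` holds unconditionally,
both sides being 0 by convention in the divergent case. -/
theorem integral_polar_sphere_mul {n : ℕ} (hn : 1 ≤ n) (f : EuclideanSpace ℝ (Fin n) → ℝ)
    (g : USphere n → ℝ) (h : ℝ → ℝ)
    (hf : ∀ (ξ : USphere n) (r : ℝ), 0 < r → f (r • (ξ : EuclideanSpace ℝ (Fin n))) = g ξ * h r) :
    ∫ x, f x = (∫ ξ, g ξ ∂(surf n)) * ∫ r in Ioi (0 : ℝ), r ^ (n - 1) * h r := by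
  have : Nonempty (Fin n) := ⟨⟨0, hn⟩⟩
  have hmp := (volume : Measure (EuclideanSpace ℝ (Fin n))).measurePreserving_homeomorphUnitSphereProd
  have hdim : Module.finrank ℝ (EuclideanSpace ℝ (Fin n)) = n := by simp
  rw [hdim] at hmp
  have h1 := hmp.integral_comp (Homeomorph.measurableEmbedding _)
    (fun p : USphere n × Ioi (0 : ℝ) => g p.1 * h p.2)
  rw [integral_prod_mul g (fun r : Ioi (0 : ℝ) => h r)] at h1
  calc ∫ x, f x = ∫ x in ({0}ᶜ : Set (EuclideanSpace ℝ (Fin n))), f x := by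
        rw [restrict_compl_singleton]
    _ = ∫ x : ({0}ᶜ : Set (EuclideanSpace ℝ (Fin n))), f x ∂(volume.comap Subtype.val) := by
        rw [integral_subtype_comap (measurableSet_singleton _).compl]
    _ = _ := by
        convert! h1 using 1
        · apply integral_congr_ae
          refine .of_forall fun x => ?_
          have hx : 0 < ‖(x : EuclideanSpace ℝ (Fin n))‖ := norm_pos_iff.2 x.2
          beta_reduce
          rw [← hf _ _ (homeomorphUnitSphereProd _ x).2.2]
          simp [smul_smul, hx.ne']
        · congr 1
          simp only [Measure.volumeIoiPow, ENNReal.ofReal]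
          rw [integral_withDensity_eq_integral_smul,
            integral_subtype_comap measurableSet_Ioi fun a ↦ Real.toNNReal (a ^ (n - 1)) • h a]
          · refine setIntegral_congr_fun measurableSet_Ioi fun x hx ↦ ?_
            rw [NNReal.smul_def, Real.coe_toNNReal _ (pow_nonneg (le_of_lt hx) _), smul_eq_mul]
          · exact (measurable_subtype_coe.pow_const _).real_toNNReal

/-! ### Gaussian integrals of homogeneous polynomials and integration by parts on the sphere. -/

/-- Evaluation of a real polynomial at a point of Euclidean space. -/
def evalE {n : ℕ} (q : MvPolynomial (Fin n) ℝ) (x : EuclideanSpace ℝ (Fin n)) : ℝ :=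
  MvPolynomial.eval (fun i => x i) q

/-- The radial Gaussian moment `∫_0^∞ r^{n-1+d} e^{-r²/2} dr`. -/
def gaussRadial (n d : ℕ) : ℝ := ∫ r in Ioi (0 : ℝ), r ^ (n - 1) * (r ^ d * Real.exp (-(1/2) * r ^ 2))

theorem gaussRadial_eq {n d : ℕ} (hn : 1 ≤ n) :
    gaussRadial n d = (1/2 : ℝ) ^ (-((n + d : ℕ) : ℝ) / 2) * (1 / 2) *
      Real.Gamma (((n + d : ℕ) : ℝ) / 2) := by
  have h := integral_rpow_mul_exp_neg_mul_rpow (p := 2) (q := ((n - 1 + d : ℕ) : ℝ)) (b := 1/2)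
    (by norm_num) (by have : (0 : ℝ) ≤ ((n - 1 + d : ℕ) : ℝ) := by positivity
                      linarith) (by norm_num)
  have e : ((n - 1 + d : ℕ) : ℝ) + 1 = ((n + d : ℕ) : ℝ) := by
    rw [← Nat.cast_succ]; congr 1; omega
  rw [e] at h
  rw [gaussRadial, ← h]
  refine setIntegral_congr_fun measurableSet_Ioi fun x hx ↦ ?_
  simp only [Real.rpow_natCast, pow_add]
  norm_num [mul_assoc]

theorem gaussRadial_pos {n d : ℕ} (hn : 1 ≤ n) : 0 < gaussRadial n d := by
  rw [gaussRadial_eq hn]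
  have : 0 < Real.Gamma (((n + d : ℕ) : ℝ) / 2) := Real.Gamma_pos_of_pos (by
    have : 0 < n + d := by omega
    positivity)
  positivity

/-- The functional equation of Γ at (n + d)/2; the extra power of 1/2 in the closed form clears the
denominator. -/
theorem gaussRadial_add_two {n d : ℕ} (hn : 1 ≤ n) :
    gaussRadial n (d + 2) = (n + d : ℝ) * gaussRadial n d := by
  rw [gaussRadial_eq hn, gaussRadial_eq hn]
  have hpos : (0 : ℝ) < ((n + d : ℕ) : ℝ) / 2 := by
    have : 0 < n + d := by omega
    positivity
  have e : ((n + (d + 2) : ℕ) : ℝ) / 2 = ((n + d : ℕ) : ℝ) / 2 + 1 := by push_cast; ring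
  have e2 : -((n + (d + 2) : ℕ) : ℝ) / 2 = -((n + d : ℕ) : ℝ) / 2 - 1 := by push_cast; ring
  rw [e, Real.Gamma_add_one hpos.ne', e2, Real.rpow_sub_one (by norm_num)]
  push_cast
  ring

theorem continuous_evalE {n : ℕ} (q : MvPolynomial (Fin n) ℝ) : Continuous (evalE q) := by
  unfold evalE
  exact (MvPolynomial.continuous_eval q).comp (by fun_prop)

theorem evalE_smul {n d : ℕ} {q : MvPolynomial (Fin n) ℝ} (hq : q.IsHomogeneous d)
    (r : ℝ) (x : EuclideanSpace ℝ (Fin n)) : evalE q (r • x) = r ^ d * evalE q x := by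
  unfold evalE
  rw [MvPolynomial.eval_eq, MvPolynomial.eval_eq, Finset.mul_sum]
  refine Finset.sum_congr rfl fun m hm => ?_
  have hdeg : m.degree = d := by
    by_contra hc
    exact (MvPolynomial.mem_support_iff.1 hm) (hq.coeff_eq_zero hc)
  simp only [PiLp.smul_apply, smul_eq_mul, mul_pow, Finset.prod_mul_distrib,
    Finset.prod_pow_eq_pow_sum]
  rw [← hdeg, Finsupp.degree_apply]
  ring

/-- The Gaussian integral of a homogeneous polynomial in polar coordinates. -/
theorem integral_evalE_gauss {n d : ℕ} (hn : 1 ≤ n) {q : MvPolynomial (Fin n) ℝ}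
    (hq : q.IsHomogeneous d) :
    ∫ x, evalE q x * Real.exp (-(1/2) * ‖x‖ ^ 2) =
      (∫ ξ : USphere n, evalE q ξ ∂(surf n)) * gaussRadial n d := by
  refine integral_polar_sphere_mul hn _ _ _ fun ξ r hr => ?_
  have h1 : ‖(ξ : EuclideanSpace ℝ (Fin n))‖ = 1 := by simp
  rw [evalE_smul hq, norm_smul, h1, mul_one, Real.norm_eq_abs, sq_abs]
  ring

theorem integrable_evalE_gauss {n d : ℕ} (hn : 1 ≤ n) {q : MvPolynomial (Fin n) ℝ}
    (hq : q.IsHomogeneous d) :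
    Integrable (fun x : EuclideanSpace ℝ (Fin n) => evalE q x * Real.exp (-(1/2) * ‖x‖ ^ 2)) := by
  have : Nonempty (Fin n) := ⟨⟨0, hn⟩⟩
  obtain ⟨C, hC⟩ := (isCompact_sphere (0 : EuclideanSpace ℝ (Fin n)) 1).exists_bound_of_continuousOn
    (continuous_evalE q).continuousOn
  have hint : Integrable (fun x : EuclideanSpace ℝ (Fin n) =>
      C * (‖x‖ ^ d * Real.exp (-(1/2) * ‖x‖ ^ 2))) := by
    apply Integrable.const_mul
    rw [integrable_fun_norm_addHaar (μ := volume) (f := fun r : ℝ => r ^ d * Real.exp (-(1/2) * r ^ 2))]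
    have h : Module.finrank ℝ (EuclideanSpace ℝ (Fin n)) = n := by simp
    rw [h]
    -- A divergent radial integral would have the default value 0, against the positivity of
    -- `gaussRadial`.
    by_contra hc
    have := gaussRadial_pos (n := n) (d := d) hn
    rw [gaussRadial, integral_undef] at this
    · exact lt_irrefl _ this
    · simpa [IntegrableOn] using hc
  refine hint.mono' ((continuous_evalE q).mul (by fun_prop)).aestronglyMeasurable
    (.of_forall fun x => ?_)
  rw [norm_mul, Real.norm_of_nonneg (Real.exp_pos _).le, ← mul_assoc]
  refine mul_le_mul_of_nonneg_right ?_ (Real.exp_pos _).le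
  -- The origin cannot be normalised, and for d = 0 the bound there is C, not 0. Writing it as 0 • e
  -- with e on the sphere covers every d.
  rcases eq_or_ne x 0 with rfl | hx
  · obtain ⟨e, he⟩ := (NormedSpace.sphere_nonempty (E := EuclideanSpace ℝ (Fin n)) (x := 0) (r := 1)).2 zero_le_one
    have h0 := evalE_smul hq 0 e
    rw [zero_smul] at h0
    rw [h0, norm_mul, norm_pow]
    simp only [norm_zero]
    rw [mul_comm]
    exact mul_le_mul_of_nonneg_right (hC e he) (by positivity)
  · have h0 : x = ‖x‖ • (‖x‖⁻¹ • x) := by rw [smul_smul, mul_inv_cancel₀ (norm_ne_zero_iff.2 hx), one_smul]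
    have h1 : ‖x‖⁻¹ • x ∈ Metric.sphere (0 : EuclideanSpace ℝ (Fin n)) 1 := by
      simp [norm_smul, hx]
    conv_lhs => rw [h0, evalE_smul hq, norm_mul, norm_pow, norm_norm, mul_comm]
    exact mul_le_mul_of_nonneg_right (hC _ h1) (by positivity)

theorem hasLineDerivAt_evalE {n : ℕ} (q : MvPolynomial (Fin n) ℝ) (i : Fin n)
    (x : EuclideanSpace ℝ (Fin n)) :
    HasLineDerivAt ℝ (evalE q) (evalE (MvPolynomial.pderiv i q) x) x (EuclideanSpace.single i 1) := by
  unfold HasLineDerivAt evalE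
  induction q using MvPolynomial.induction_on with
  | C a => simpa using hasDerivAt_const _ _
  | add p q hp hq => simpa [Pi.add_def] using hp.add hq
  | mul_X p k hp =>
    have h2 : HasDerivAt (fun t : ℝ => (x + t • EuclideanSpace.single i (1 : ℝ)) k)
        (Pi.single (M := fun _ => ℝ) i 1 k) 0 := by
      have := ((hasDerivAt_id (0:ℝ)).mul_const (Pi.single (M := fun _ => ℝ) i (1:ℝ) k)).const_add (x k)
      simpa [Pi.single_apply] using this
    have := hp.mul h2
    simp only [Pi.mul_def] at this
    convert! this using 1
    · ext t; simp
    · simp [MvPolynomial.pderiv_X, Pi.single_apply]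
      split_ifs
      · ring
      · rw [map_zero]; ring

/-- Integration by parts: the i-th derivative of e^(-|x|²/2) is -x_i e^(-|x|²/2). -/
theorem integral_pderiv_gauss {n d : ℕ} (hn : 1 ≤ n) {q : MvPolynomial (Fin n) ℝ}
    (hq : q.IsHomogeneous d) (i : Fin n) :
    ∫ x, evalE (MvPolynomial.pderiv i q) x * Real.exp (-(1/2) * ‖x‖ ^ 2) =
      ∫ x, evalE (MvPolynomial.X i * q) x * Real.exp (-(1/2) * ‖x‖ ^ 2) := by
  have hX : (MvPolynomial.X i * q).IsHomogeneous (1 + d) :=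
    (MvPolynomial.isHomogeneous_X ℝ i).mul hq
  have hg : ∀ x : EuclideanSpace ℝ (Fin n), HasLineDerivAt ℝ
      (fun x : EuclideanSpace ℝ (Fin n) => Real.exp (-(1/2) * ‖x‖ ^ 2))
      (-(x i) * Real.exp (-(1/2) * ‖x‖ ^ 2)) x (EuclideanSpace.single i 1) := by
    intro x
    have h1 : HasFDerivAt (fun x : EuclideanSpace ℝ (Fin n) => ‖x‖ ^ 2) _ x :=
      (hasStrictFDerivAt_norm_sq x).hasFDerivAt
    have := ((h1.const_mul (-(1/2) : ℝ)).exp).hasLineDerivAt (EuclideanSpace.single i 1)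
    convert! this using 1
    simp [EuclideanSpace.inner_single_right]
    ring
  have := integral_bilinear_hasLineDerivAt_right_eq_neg_left_of_integrable
    (μ := (volume : Measure (EuclideanSpace ℝ (Fin n)))) (B := ContinuousLinearMap.mul ℝ ℝ)
    (f := evalE q) (f' := evalE (MvPolynomial.pderiv i q))
    (g := fun x => Real.exp (-(1/2) * ‖x‖ ^ 2)) (g' := fun x => -(x i) * Real.exp (-(1/2) * ‖x‖ ^ 2))
    (v := EuclideanSpace.single i 1)
    (integrable_evalE_gauss hn hq.pderiv)
    (by
      refine (integrable_evalE_gauss hn hX).neg.congr (.of_forall fun x => ?_)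
      simp [evalE]; ring)
    (integrable_evalE_gauss hn hq) (fun x _ => hasLineDerivAt_evalE q i x) (fun x _ => hg x)
  simp only [ContinuousLinearMap.mul_apply'] at this
  rw [eq_neg_iff_add_eq_zero, add_comm, ← eq_neg_iff_add_eq_zero, ← integral_neg] at this
  rw [this]
  congr 1; ext x
  simp [evalE]; ring

/-- Integration by parts on the sphere for homogeneous polynomials. -/
theorem integral_sphere_pderiv {n d : ℕ} (hn : 1 ≤ n) {q : MvPolynomial (Fin n) ℝ}
    (hq : q.IsHomogeneous d) (i : Fin n) :
    ∫ ξ : USphere n, evalE (MvPolynomial.pderiv i q) ξ ∂(surf n) =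
      ((n : ℝ) + d - 1) * ∫ ξ : USphere n, evalE (MvPolynomial.X i * q) ξ ∂(surf n) := by
  have hX : (MvPolynomial.X i * q).IsHomogeneous (d + 1) := by
    rw [add_comm]; exact (MvPolynomial.isHomogeneous_X ℝ i).mul hq
  have h := integral_pderiv_gauss hn hq i
  rw [integral_evalE_gauss hn hX, integral_evalE_gauss hn hq.pderiv] at h
  -- The derivative has degree d - 1, a truncated subtraction, so constants are treated apart: their
  -- derivative is 0, and the identity forces the integral of x_i q to vanish. In positive degree
  -- the factor n + d - 1 is the ratio of the radial moments of orders d + 1 and d - 1.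
  rcases d with _ | d
  · have h0 : MvPolynomial.pderiv i q = 0 := by
      rw [MvPolynomial.totalDegree_eq_zero_iff_eq_C.1
        ((MvPolynomial.totalDegree_zero_iff_isHomogeneous _).2 hq)]
      simp
    rw [h0] at h ⊢
    simp only [evalE, map_zero, integral_zero, zero_mul] at h ⊢
    have := gaussRadial_pos (n := n) (d := 1) hn
    rcases mul_eq_zero.1 h.symm with h | h
    · rw [h, mul_zero]
    · simp at h; linarith
  · rw [gaussRadial_add_two hn, Nat.add_sub_cancel] at h
    have := gaussRadial_pos (n := n) (d := d) hn
    apply mul_right_cancel₀ this.ne'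
    rw [h]; push_cast; ring

/-! ### Moments of a harmonic polynomial along a direction. -/

instance isFiniteMeasure_surf (n : ℕ) : IsFiniteMeasure (surf n) := by
  unfold surf; infer_instance

theorem integrable_surf_of_continuous {n : ℕ} {f : USphere n → ℝ} (hf : Continuous f) :
    Integrable f (surf n) :=
  hf.integrable_of_hasCompactSupport (HasCompactSupport.of_compactSpace f)

/-- The linear form `x ↦ ⟨x, ζ⟩` as a polynomial. -/
def linForm {n : ℕ} (ζ : USphere n) : MvPolynomial (Fin n) ℝ :=
  ∑ i, MvPolynomial.C ((ζ : EuclideanSpace ℝ (Fin n)) i) * MvPolynomial.X i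

/-- The inner product of two points of the sphere. -/
def dotS {n : ℕ} (ξ ζ : USphere n) : ℝ :=
  ∑ i, (ζ : EuclideanSpace ℝ (Fin n)) i * (ξ : EuclideanSpace ℝ (Fin n)) i

theorem continuous_dotS {n : ℕ} (ζ : USphere n) : Continuous (fun ξ : USphere n => dotS ξ ζ) := by
  unfold dotS; fun_prop

theorem sum_sq_sphere {n : ℕ} (ζ : USphere n) :
    ∑ i, (ζ : EuclideanSpace ℝ (Fin n)) i ^ 2 = 1 := by
  have h := EuclideanSpace.norm_sq_eq (ζ : EuclideanSpace ℝ (Fin n))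
  have h1 : ‖(ζ : EuclideanSpace ℝ (Fin n))‖ = 1 := by simp
  rw [h1] at h
  simpa using h.symm

theorem norm_sub_sq_sphere {n : ℕ} (ξ ζ : USphere n) :
    ‖(ξ : EuclideanSpace ℝ (Fin n)) - (ζ : EuclideanSpace ℝ (Fin n))‖ ^ 2 = 2 - 2 * dotS ξ ζ := by
  have h := EuclideanSpace.norm_sq_eq ((ξ : EuclideanSpace ℝ (Fin n)) - (ζ : EuclideanSpace ℝ (Fin n)))
  have h3 : ∑ i, ‖((ξ : EuclideanSpace ℝ (Fin n)) - (ζ : EuclideanSpace ℝ (Fin n))) i‖ ^ 2 =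
      ∑ i, (ζ : EuclideanSpace ℝ (Fin n)) i ^ 2 + ∑ i, (ξ : EuclideanSpace ℝ (Fin n)) i ^ 2
        - 2 * dotS ξ ζ := by
    rw [dotS, Finset.mul_sum, ← Finset.sum_add_distrib, ← Finset.sum_sub_distrib]
    refine Finset.sum_congr rfl fun i _ => ?_
    simp
    ring
  rw [h, h3, sum_sq_sphere, sum_sq_sphere]
  ring

theorem abs_dotS_le {n : ℕ} (ξ ζ : USphere n) : |dotS ξ ζ| ≤ 1 := by
  have h1 : dotS ξ ζ = inner ℝ (ξ : EuclideanSpace ℝ (Fin n)) (ζ : EuclideanSpace ℝ (Fin n)) := by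
    rw [PiLp.inner_apply]; simp [dotS]
  rw [h1]
  simpa using abs_real_inner_le_norm (ξ : EuclideanSpace ℝ (Fin n)) (ζ : EuclideanSpace ℝ (Fin n))

theorem evalE_linForm {n : ℕ} (ζ ξ : USphere n) : evalE (linForm ζ) ξ = dotS ξ ζ := by
  simp [evalE, linForm, dotS]

theorem isHomogeneous_linForm {n : ℕ} (ζ : USphere n) : (linForm ζ).IsHomogeneous 1 := by
  refine MvPolynomial.IsHomogeneous.sum _ _ _ fun i _ => ?_
  simpa using (MvPolynomial.isHomogeneous_C (Fin n) _).mul (MvPolynomial.isHomogeneous_X ℝ i)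

theorem pderiv_linForm {n : ℕ} (ζ : USphere n) (i : Fin n) :
    MvPolynomial.pderiv i (linForm ζ) = MvPolynomial.C ((ζ : EuclideanSpace ℝ (Fin n)) i) := by
  simp [linForm, MvPolynomial.pderiv_X, Pi.single_apply]

/-- The derivative of `p` in the direction `ζ`. -/
def dirDeriv {n : ℕ} (ζ : USphere n) (p : MvPolynomial (Fin n) ℝ) : MvPolynomial (Fin n) ℝ :=
  ∑ i, MvPolynomial.C ((ζ : EuclideanSpace ℝ (Fin n)) i) * MvPolynomial.pderiv i p

theorem evalE_mul {n : ℕ} (p q : MvPolynomial (Fin n) ℝ) (x : EuclideanSpace ℝ (Fin n)) :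
    evalE (p * q) x = evalE p x * evalE q x := by simp [evalE]

theorem evalE_sum {n : ℕ} {ι : Type*} (s : Finset ι) (p : ι → MvPolynomial (Fin n) ℝ)
    (x : EuclideanSpace ℝ (Fin n)) : evalE (∑ i ∈ s, p i) x = ∑ i ∈ s, evalE (p i) x := by
  simp [evalE]

theorem evalE_C {n : ℕ} (c : ℝ) (x : EuclideanSpace ℝ (Fin n)) :
    evalE (MvPolynomial.C c : MvPolynomial (Fin n) ℝ) x = c := by simp [evalE]

theorem evalE_pow {n : ℕ} (p : MvPolynomial (Fin n) ℝ) (m : ℕ) (x : EuclideanSpace ℝ (Fin n)) :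
    evalE (p ^ m) x = evalE p x ^ m := by simp [evalE]

theorem evalE_X {n : ℕ} (i : Fin n) (x : EuclideanSpace ℝ (Fin n)) :
    evalE (MvPolynomial.X i : MvPolynomial (Fin n) ℝ) x = x i := by simp [evalE]

theorem continuous_evalE_sphere {n : ℕ} (p : MvPolynomial (Fin n) ℝ) :
    Continuous (fun ξ : USphere n => evalE p ξ) :=
  (continuous_evalE p).comp continuous_subtype_val

theorem integrable_evalE {n : ℕ} (p : MvPolynomial (Fin n) ℝ) :
    Integrable (fun ξ : USphere n => evalE p ξ) (surf n) :=
  integrable_surf_of_continuous (continuous_evalE_sphere p)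

theorem pderiv_linForm_pow_mul {n : ℕ} (ζ : USphere n) (m : ℕ) (q : MvPolynomial (Fin n) ℝ)
    (i : Fin n) (x : EuclideanSpace ℝ (Fin n)) :
    evalE (MvPolynomial.pderiv i (linForm ζ ^ m * q)) x =
      m * evalE (linForm ζ) x ^ (m - 1) * (ζ : EuclideanSpace ℝ (Fin n)) i * evalE q x
        + evalE (linForm ζ) x ^ m * evalE (MvPolynomial.pderiv i q) x := by
  rw [Derivation.leibniz, Derivation.leibniz_pow, pderiv_linForm]
  simp [evalE]
  ring

/-- Integration by parts on the sphere for t^m p in the direction ζ, where t = ⟨x, ζ⟩: since |ζ| =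
1, the derivative is m t^(m-1) p + t^m ∂_ζ p. -/
theorem integral_linForm_pow_dirDeriv_add {n j : ℕ} (hn : 1 ≤ n) {p : MvPolynomial (Fin n) ℝ}
    (hp : p.IsHomogeneous j) (ζ : USphere n) (m : ℕ) :
    m * ∫ ξ : USphere n, dotS ξ ζ ^ (m - 1) * evalE p ξ ∂(surf n) +
      ∫ ξ : USphere n, dotS ξ ζ ^ m * evalE (dirDeriv ζ p) ξ ∂(surf n) =
    ((n : ℝ) + m + j - 1) * ∫ ξ : USphere n, dotS ξ ζ ^ (m + 1) * evalE p ξ ∂(surf n) := by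
  have hq : (linForm ζ ^ m * p).IsHomogeneous (m + j) := by
    simpa using ((isHomogeneous_linForm ζ).pow m).mul hp
  have h : ∑ i, (ζ : EuclideanSpace ℝ (Fin n)) i * ∫ ξ : USphere n, evalE (MvPolynomial.pderiv i (linForm ζ ^ m * p)) ξ ∂(surf n) =
      ∑ i, (ζ : EuclideanSpace ℝ (Fin n)) i * (((n : ℝ) + (m + j : ℕ) - 1) * ∫ ξ : USphere n, evalE (MvPolynomial.X i * (linForm ζ ^ m * p)) ξ ∂(surf n)) :=
    Finset.sum_congr rfl fun i _ => by rw [integral_sphere_pderiv hn hq i]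
  simp_rw [← integral_const_mul] at h
  rw [← integral_finsetSum _ (fun i _ => (integrable_evalE _).const_mul _),
    ← integral_finsetSum _ (fun i _ => ((integrable_evalE _).const_mul _).const_mul _)] at h
  rw [← integral_const_mul, ← integral_const_mul, ← integral_add]
  · convert! h using 2
    · ext ξ
      simp_rw [pderiv_linForm_pow_mul, dirDeriv, evalE_sum, evalE_mul, evalE_C, evalE_linForm]
      have := sum_sq_sphere ζ
      simp_rw [mul_add, Finset.sum_add_distrib]
      congr 1
      · calc _ = (∑ i, (ζ : EuclideanSpace ℝ (Fin n)) i ^ 2) * (m * (dotS ξ ζ ^ (m - 1) * evalE p ξ)) := by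
              rw [this, one_mul]
          _ = _ := by
              rw [Finset.sum_mul]
              exact Finset.sum_congr rfl fun i _ => by ring
      · rw [Finset.mul_sum]
        exact Finset.sum_congr rfl fun i _ => by ring
    · ext ξ
      simp_rw [evalE_mul, evalE_X, evalE_pow, evalE_linForm]
      rw [pow_succ]
      nth_rewrite 2 [dotS]
      rw [Finset.mul_sum, Finset.sum_mul, Finset.mul_sum]
      push_cast
      exact Finset.sum_congr rfl fun i _ => by ring
  · exact (integrable_surf_of_continuous (((continuous_dotS ζ).pow _).mul
      (continuous_evalE_sphere _))).const_mul _
  · exact integrable_surf_of_continuous (((continuous_dotS ζ).pow _).mul (continuous_evalE_sphere _))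

/-- Integration by parts for the vector field t^m ∇p, where t = ⟨x, ζ⟩. Its divergence is m t^(m-1)
∂_ζ p because p is harmonic, and its radial component is j t^m p by Euler's identity. -/
theorem integral_linForm_pow_dirDeriv {n j : ℕ} (hn : 1 ≤ n) {p : MvPolynomial (Fin n) ℝ}
    (hp : p.IsHomogeneous j) (hl : polyLaplacian n p = 0) (ζ : USphere n) (m : ℕ) :
    m * ∫ ξ : USphere n, dotS ξ ζ ^ (m - 1) * evalE (dirDeriv ζ p) ξ ∂(surf n) =
    j * ((n : ℝ) + m + j - 2) * ∫ ξ : USphere n, dotS ξ ζ ^ m * evalE p ξ ∂(surf n) := by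
  rcases j with _ | j
  · have h0 : dirDeriv ζ p = 0 := by
      rw [MvPolynomial.totalDegree_eq_zero_iff_eq_C.1
        ((MvPolynomial.totalDegree_zero_iff_isHomogeneous _).2 hp)]
      simp [dirDeriv]
    rw [h0]
    simp [evalE]
  have hq : ∀ i, (linForm ζ ^ m * MvPolynomial.pderiv i p).IsHomogeneous (m + j) := fun i => by
    simpa using ((isHomogeneous_linForm ζ).pow m).mul (hp.pderiv (i := i))
  have h : ∑ i, ∫ ξ : USphere n, evalE (MvPolynomial.pderiv i (linForm ζ ^ m * MvPolynomial.pderiv i p)) ξ ∂(surf n) =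
      ∑ i, (((n : ℝ) + (m + j : ℕ) - 1) * ∫ ξ : USphere n, evalE (MvPolynomial.X i * (linForm ζ ^ m * MvPolynomial.pderiv i p)) ξ ∂(surf n)) :=
    Finset.sum_congr rfl fun i _ => by rw [integral_sphere_pderiv hn (hq i) i]
  simp_rw [← integral_const_mul] at h
  rw [← integral_finsetSum _ (fun i _ => (integrable_evalE _)),
    ← integral_finsetSum _ (fun i _ => (integrable_evalE _).const_mul _)] at h
  rw [← integral_const_mul, ← integral_const_mul]
  convert! h using 2
  · ext ξ
    simp_rw [pderiv_linForm_pow_mul, dirDeriv, evalE_sum, evalE_mul, evalE_C, evalE_linForm]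
    have hl' : ∑ i, evalE (MvPolynomial.pderiv i (MvPolynomial.pderiv i p)) ξ = 0 := by
      rw [← evalE_sum]
      have : ∑ i, MvPolynomial.pderiv i (MvPolynomial.pderiv i p) = 0 := by
        rw [← hl]; simp [polyLaplacian]
      rw [this]; simp [evalE]
    rw [Finset.sum_add_distrib, ← Finset.mul_sum, hl', mul_zero, add_zero, Finset.mul_sum,
      Finset.mul_sum]
    exact Finset.sum_congr rfl fun i _ => by ring
  · ext ξ
    have hE : ∑ i, (ξ : EuclideanSpace ℝ (Fin n)) i * evalE (MvPolynomial.pderiv i p) ξ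
        = (j + 1 : ℕ) * evalE p ξ := by
      have := congrArg (fun q => evalE q (ξ : EuclideanSpace ℝ (Fin n))) hp.sum_X_mul_pderiv
      simpa [evalE] using this
    simp_rw [evalE_mul, evalE_X, evalE_pow, evalE_linForm]
    calc _ = ((n : ℝ) + (m + j : ℕ) - 1) * dotS ξ ζ ^ m * ((j + 1 : ℕ) * evalE p ξ) := by
          push_cast; ring
      _ = _ := by
          rw [← hE, Finset.mul_sum]
          exact Finset.sum_congr rfl fun i _ => by ring

/-- The recursion for the moments of a harmonic polynomial along a direction. -/
theorem moment_recursion {n j : ℕ} (hn : 1 ≤ n) {p : MvPolynomial (Fin n) ℝ}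
    (hp : p.IsHomogeneous j) (hl : polyLaplacian n p = 0) (ζ : USphere n) (m : ℕ) :
    m * ((m : ℝ) - 1) * ∫ ξ : USphere n, dotS ξ ζ ^ (m - 2) * evalE p ξ ∂(surf n) =
    ((m : ℝ) - j) * (m + j + n - 2) * ∫ ξ : USphere n, dotS ξ ζ ^ m * evalE p ξ ∂(surf n) := by
  have h1 := integral_linForm_pow_dirDeriv hn hp hl ζ m
  rcases m with _ | m
  · push_cast at h1 ⊢
    linarith
  · have h2 := integral_linForm_pow_dirDeriv_add hn hp ζ m
    have e : m + 1 - 2 = m - 1 := by omega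
    rw [e]
    rw [Nat.add_sub_cancel] at h1
    push_cast at h1 ⊢
    -- Both relations contain the mixed moment ∫ t^m ∂_ζ p, which is eliminated.
    linear_combination (m + 1 : ℝ) * h2 - h1

/-- The operator (1 - t²) g'' - (n - 1) t g' is the spherical Laplacian of the zonal function g(⟨ξ,
ζ⟩), and p restricts to an eigenfunction with eigenvalue -j(j + n - 2), so this is the symmetry of
that Laplacian. For g = t^m the operator with its zeroth-order term gives m(m-1) t^(m-2) -
(m-j)(m+j+n-2) t^m, and the claim is `moment_recursion`. -/
theorem integral_sphere_gegenbauer_poly {n j : ℕ} (hn : 1 ≤ n) {p : MvPolynomial (Fin n) ℝ}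
    (hp : p.IsHomogeneous j) (hl : polyLaplacian n p = 0) (ζ : USphere n) (g : Polynomial ℝ) :
    ∫ ξ : USphere n, ((1 - dotS ξ ζ ^ 2) * g.derivative.derivative.eval (dotS ξ ζ)
      - (n - 1) * dotS ξ ζ * g.derivative.eval (dotS ξ ζ)
      + j * (j + n - 2) * g.eval (dotS ξ ζ)) * evalE p ξ ∂(surf n) = 0 := by
  have hc := continuous_dotS ζ
  have hpc := continuous_evalE_sphere p
  induction g using Polynomial.induction_on' with
  | add g h hg hh =>
    rw [← add_zero (0 : ℝ)]
    nth_rewrite 2 [← hg]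
    rw [← hh, ← integral_add]
    · congr 1; ext ξ; simp; ring
    · exact integrable_surf_of_continuous (by fun_prop)
    · exact integrable_surf_of_continuous (by fun_prop)
  | monomial m a =>
    have h := moment_recursion hn hp hl ζ m
    have hi : ∀ k, Integrable (fun ξ : USphere n => dotS ξ ζ ^ k * evalE p ξ) (surf n) := fun k =>
      integrable_surf_of_continuous (by fun_prop)
    have e : ∀ ξ : USphere n, ((1 - dotS ξ ζ ^ 2) * (Polynomial.monomial m a).derivative.derivative.eval (dotS ξ ζ)
      - (n - 1) * dotS ξ ζ * (Polynomial.monomial m a).derivative.eval (dotS ξ ζ)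
      + j * (j + n - 2) * (Polynomial.monomial m a).eval (dotS ξ ζ)) * evalE p ξ =
      a * (m * ((m : ℝ) - 1)) * (dotS ξ ζ ^ (m - 2) * evalE p ξ)
      - a * (((m : ℝ) - j) * (m + j + n - 2)) * (dotS ξ ζ ^ m * evalE p ξ) := by
      intro ξ
      -- For m = 0, 1 the exponent m - 2 is truncated, but its coefficient m(m - 1) vanishes.
      rcases m with _ | _ | m
      · simp; left; ring
      · simp; ring
      · simp; ring
    simp_rw [e]
    rw [integral_sub ((hi _).const_mul _) ((hi _).const_mul _), integral_const_mul, integral_const_mul]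
    linear_combination a * h

/-! ### From zonal polynomials to zonal C² functions. -/

theorem exists_polynomial_derivative_eq (q : Polynomial ℝ) (c : ℝ) :
    ∃ r : Polynomial ℝ, r.derivative = q ∧ r.eval 0 = c := by
  obtain ⟨r, hr⟩ : ∃ r : Polynomial ℝ, r.derivative = q := by
    induction q using Polynomial.induction_on' with
    | add p q hp hq =>
      obtain ⟨r, hr⟩ := hp
      obtain ⟨t, ht⟩ := hq
      exact ⟨r + t, by simp [hr, ht]⟩
    | monomial m a =>
      refine ⟨Polynomial.monomial (m + 1) (a / (m + 1)), ?_⟩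
      rw [Polynomial.derivative_monomial]
      have : (m : ℝ) + 1 ≠ 0 := by positivity
      simp [this]
  exact ⟨r - Polynomial.C (r.eval 0) + Polynomial.C c, by simp [hr], by simp⟩

/-- The mean value inequality from the base point 0, which is within distance 1 of all of [-1, 1],
so integration does not enlarge the error. -/
theorem abs_sub_le_of_hasDerivAt {f g f' g' : ℝ → ℝ} {ε : ℝ}
    (hf : ∀ t ∈ Icc (-1 : ℝ) 1, HasDerivAt f (f' t) t)
    (hg : ∀ t ∈ Icc (-1 : ℝ) 1, HasDerivAt g (g' t) t) (h0 : f 0 = g 0)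
    (hε : ∀ t ∈ Icc (-1 : ℝ) 1, |f' t - g' t| ≤ ε) {t : ℝ} (ht : t ∈ Icc (-1 : ℝ) 1) :
    |f t - g t| ≤ ε := by
  have h := (convex_Icc (-1 : ℝ) 1).norm_image_sub_le_of_norm_hasDerivWithin_le
    (f := fun t => f t - g t) (f' := fun t => f' t - g' t) (C := ε) (x := 0) (y := t)
    (fun x hx => ((hf x hx).sub (hg x hx)).hasDerivWithinAt) hε (by simp) ht
  simp only [h0, sub_self, sub_zero, Real.norm_eq_abs] at h
  have hε0 : 0 ≤ ε := (abs_nonneg _).trans (hε t ht)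
  exact h.trans (mul_le_of_le_one_right hε0 (abs_le.2 ht))

theorem continuous_comp_dotS {n : ℕ} (ζ : USphere n) {g : ℝ → ℝ}
    (hg : ContinuousOn g (Icc (-1) 1)) : Continuous (fun ξ : USphere n => g (dotS ξ ζ)) :=
  hg.comp_continuous (continuous_dotS ζ) fun ξ => abs_le.1 (abs_dotS_le ξ ζ)

/-- The spherical Laplacian is symmetric: tested on a zonal function and a spherical harmonic. -/
theorem integral_sphere_gegenbauer {n j : ℕ} (hn : 1 ≤ n) {p : MvPolynomial (Fin n) ℝ}
    (hp : p.IsHomogeneous j) (hl : polyLaplacian n p = 0) (ζ : USphere n) {g g1 g2 : ℝ → ℝ}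
    (hg : ∀ t ∈ Icc (-1 : ℝ) 1, HasDerivAt g (g1 t) t)
    (hg1 : ∀ t ∈ Icc (-1 : ℝ) 1, HasDerivAt g1 (g2 t) t)
    (hg2 : ContinuousOn g2 (Icc (-1) 1)) :
    ∫ ξ : USphere n, ((1 - dotS ξ ζ ^ 2) * g2 (dotS ξ ζ)
      - (n - 1) * dotS ξ ζ * g1 (dotS ξ ζ)
      + j * (j + n - 2) * g (dotS ξ ζ)) * evalE p ξ ∂(surf n) = 0 := by
  have hc := continuous_dotS ζ
  have hpc := continuous_evalE_sphere p
  have c0 := continuous_comp_dotS ζ (fun t ht => (hg t ht).continuousAt.continuousWithinAt)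
  have c1 := continuous_comp_dotS ζ (fun t ht => (hg1 t ht).continuousAt.continuousWithinAt)
  have c2 := continuous_comp_dotS ζ hg2
  have cF := ((((continuous_const (y := (1 : ℝ))).sub (hc.pow 2)).mul c2).sub
    (((continuous_const (y := (n : ℝ) - 1)).mul hc).mul c1)).add
    ((continuous_const (y := (j : ℝ) * (j + n - 2))).mul c0) |>.mul hpc
  have cQ : ∀ q q1 q2 : Polynomial ℝ, Continuous fun ξ : USphere n =>
      ((1 - dotS ξ ζ ^ 2) * q2.eval (dotS ξ ζ) - (n - 1) * dotS ξ ζ * q1.eval (dotS ξ ζ)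
        + j * (j + n - 2) * q.eval (dotS ξ ζ)) * evalE p ξ := fun q q1 q2 => by fun_prop
  set I := ∫ ξ : USphere n, ((1 - dotS ξ ζ ^ 2) * g2 (dotS ξ ζ)
      - (n - 1) * dotS ξ ζ * g1 (dotS ξ ζ)
      + j * (j + n - 2) * g (dotS ξ ζ)) * evalE p ξ ∂(surf n) with hI
  set M : ℝ := (1 + |(n : ℝ) - 1| + |(j : ℝ) * (j + n - 2)|) with hM
  have hbound : ∀ ε > 0, |I| ≤ ε * (M * ∫ ξ : USphere n, |evalE p ξ| ∂(surf n)) := by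
    intro ε hε
    -- The second derivative is the one to approximate. Integrating its approximant twice, with
    -- values at 0 matched to those of g1 and g, gives a polynomial that is ε-close together with
    -- its first two derivatives.
    obtain ⟨q2, hq2⟩ := exists_polynomial_near_of_continuousOn (-1) 1 g2 hg2 ε hε
    obtain ⟨q1, hq1, hq10⟩ := exists_polynomial_derivative_eq q2 (g1 0)
    obtain ⟨q, hq, hq0⟩ := exists_polynomial_derivative_eq q1 (g 0)
    have hz := integral_sphere_gegenbauer_poly hn hp hl ζ q
    rw [hq, hq1] at hz
    have e2 : ∀ t ∈ Icc (-1 : ℝ) 1, |g2 t - q2.eval t| ≤ ε := fun t ht => by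
      rw [abs_sub_comm]; exact (hq2 t ht).le
    have e1 : ∀ t ∈ Icc (-1 : ℝ) 1, |g1 t - q1.eval t| ≤ ε := fun t ht =>
      abs_sub_le_of_hasDerivAt (g' := fun t => q2.eval t) hg1
        (fun t _ => hq1 ▸ q1.hasDerivAt t) hq10.symm e2 ht
    have e0 : ∀ t ∈ Icc (-1 : ℝ) 1, |g t - q.eval t| ≤ ε := fun t ht =>
      abs_sub_le_of_hasDerivAt (g' := fun t => q1.eval t) hg
        (fun t _ => hq ▸ q.hasDerivAt t) hq0.symm e1 ht
    rw [← sub_zero I, ← hz, hI, ← integral_sub, ← integral_const_mul, ← integral_const_mul]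
    · refine (abs_integral_le_integral_abs).trans (integral_mono ?_ ?_ fun ξ => ?_)
      · exact integrable_surf_of_continuous (cF.sub (cQ q q1 q2)).abs
      · exact integrable_surf_of_continuous (by fun_prop)
      · beta_reduce
        have ht := abs_le.1 (abs_dotS_le ξ ζ)
        have ht' := abs_dotS_le ξ ζ
        generalize dotS ξ ζ = t at *
        rw [← sub_mul, abs_mul, ← mul_assoc]
        refine mul_le_mul_of_nonneg_right ?_ (abs_nonneg _)
        have hs : |1 - t ^ 2| ≤ 1 := by
          rw [abs_le]; constructor <;> nlinarith
        calc _ = |(1 - t ^ 2) * (g2 t - q2.eval t) - ((n : ℝ) - 1) * t * (g1 t - q1.eval t)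
              + (j : ℝ) * (j + n - 2) * (g t - q.eval t)| := by congr 1; ring
          _ ≤ |1 - t ^ 2| * |g2 t - q2.eval t| + |(n : ℝ) - 1| * |t| * |g1 t - q1.eval t|
              + |(j : ℝ) * (j + n - 2)| * |g t - q.eval t| := by
            rw [← abs_mul, ← abs_mul, ← abs_mul, ← abs_mul]
            exact (abs_add_le _ _).trans (add_le_add_left (abs_sub _ _) _)
          _ ≤ 1 * ε + |(n : ℝ) - 1| * 1 * ε + |(j : ℝ) * (j + n - 2)| * ε := by
            gcongr
            · exact e2 t ht
            · exact e1 t ht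
            · exact e0 t ht
          _ = _ := by rw [hM]; ring
    · exact integrable_surf_of_continuous cF
    · exact integrable_surf_of_continuous (cQ q q1 q2)
  by_contra hne
  have hpos : 0 < |I| := abs_pos.2 hne
  set B := M * ∫ ξ : USphere n, |evalE p ξ| ∂(surf n) with hB
  have hB0 : 0 ≤ B := mul_nonneg (by positivity) (integral_nonneg fun _ => abs_nonneg _)
  -- The bound is ε B for every ε; the added 1 keeps the denominator positive when B = 0.
  have := hbound (|I| / (2 * (B + 1))) (by positivity)
  have h2 : |I| / (2 * (B + 1)) * B < |I| := by
    rw [div_mul_eq_mul_div, div_lt_iff₀ (by positivity)]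
    nlinarith
  linarith

/-! ### The Poisson integral of a spherical harmonic. -/

/-- Differentiation under the integral sign. The domination comes from compactness of [a, b] × [-1,
1] for some -1 < a < s < b < 1. -/
theorem hasDerivAt_integral_zonal {n : ℕ} (ζ : USphere n) {p : USphere n → ℝ} (hp : Continuous p)
    {h h' : ℝ → ℝ → ℝ}
    (hh : ∀ s ∈ Ioo (-1 : ℝ) 1, ∀ t ∈ Icc (-1 : ℝ) 1, HasDerivAt (fun s => h s t) (h' s t) s)
    (hc : ∀ s ∈ Ioo (-1 : ℝ) 1, ContinuousOn (h s) (Icc (-1) 1))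
    (hc' : ContinuousOn (fun x : ℝ × ℝ => h' x.1 x.2) (Ioo (-1) 1 ×ˢ Icc (-1) 1))
    {s : ℝ} (hs : s ∈ Ioo (-1 : ℝ) 1) :
    HasDerivAt (fun s => ∫ ξ, h s (dotS ξ ζ) * p ξ ∂(surf n))
      (∫ ξ, h' s (dotS ξ ζ) * p ξ ∂(surf n)) s := by
  obtain ⟨a, ha1, has⟩ := exists_between hs.1
  obtain ⟨b, hsb, hb1⟩ := exists_between hs.2
  have hsub : Icc a b ×ˢ Icc (-1 : ℝ) 1 ⊆ Ioo (-1) 1 ×ˢ Icc (-1) 1 :=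
    prod_mono (fun x hx => ⟨ha1.trans_le hx.1, hx.2.trans_lt hb1⟩) le_rfl
  obtain ⟨C, hC⟩ := (isCompact_Icc.prod isCompact_Icc).exists_bound_of_continuousOn
    (hc'.mono hsub)
  have hmem : ∀ ξ, dotS ξ ζ ∈ Icc (-1 : ℝ) 1 := fun ξ => abs_le.1 (abs_dotS_le ξ ζ)
  have hcs' : ContinuousOn (h' s) (Icc (-1) 1) :=
    hc'.comp (f := fun t => (s, t)) (by fun_prop) (fun t ht => ⟨hs, ht⟩)
  refine (hasDerivAt_integral_of_dominated_loc_of_deriv_le (s := Ioo a b)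
    (F := fun s ξ => h s (dotS ξ ζ) * p ξ) (F' := fun s ξ => h' s (dotS ξ ζ) * p ξ)
    (bound := fun ξ => C * |p ξ|) (Ioo_mem_nhds has hsb) ?_ ?_ ?_ ?_ ?_ ?_).2
  · filter_upwards [Ioo_mem_nhds hs.1 hs.2] with x hx
    exact ((continuous_comp_dotS ζ (hc x hx)).mul hp).aestronglyMeasurable
  · exact integrable_surf_of_continuous ((continuous_comp_dotS ζ (hc s hs)).mul hp)
  · exact ((continuous_comp_dotS ζ hcs').mul hp).aestronglyMeasurable
  · refine .of_forall fun ξ x hx => ?_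
    rw [norm_mul, Real.norm_eq_abs (p ξ)]
    exact mul_le_mul_of_nonneg_right (hC (x, dotS ξ ζ) ⟨Ioo_subset_Icc_self hx, hmem ξ⟩)
      (abs_nonneg _)
  · exact integrable_surf_of_continuous (by fun_prop)
  · refine .of_forall fun ξ x hx => ?_
    exact (hh x ⟨ha1.trans hx.1, hx.2.trans hb1⟩ _ (hmem ξ)).mul_const _

/-- `1 + s² - 2 s t`, the squared distance between `ξ` and `s ζ` when `⟨ξ, ζ⟩ = t`. -/
def chordSq (s t : ℝ) : ℝ := 1 + s ^ 2 - 2 * s * t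

/-- The quantity is at least (1 - |s|)². -/
theorem chordSq_pos {s t : ℝ} (hs : s ∈ Ioo (-1 : ℝ) 1) (ht : t ∈ Icc (-1 : ℝ) 1) :
    0 < chordSq s t := by
  unfold chordSq
  rcases le_total 0 s with h | h
  · nlinarith [mul_nonneg h (sub_nonneg.2 ht.2), pow_pos (sub_pos.2 hs.2) 2]
  · nlinarith [mul_nonneg (neg_nonneg.2 h) (sub_nonneg.2 ht.1),
      pow_pos (sub_pos.2 hs.1) 2]

/-- The Poisson kernel, with exponent `l = n / 2`. -/
def poissonK (l s t : ℝ) : ℝ := (1 - s ^ 2) * chordSq s t ^ (-l)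

/-- The derivative of the Poisson kernel in `s`. -/
def poissonKs (l s t : ℝ) : ℝ :=
  -2 * s * chordSq s t ^ (-l) + (1 - s ^ 2) * (-l * (2 * s - 2 * t)) * chordSq s t ^ (-l - 1)

/-- The second derivative of the Poisson kernel in `s`. -/
def poissonKss (l s t : ℝ) : ℝ :=
  -2 * chordSq s t ^ (-l) + (4 * s * l * (2 * s - 2 * t) - 2 * l * (1 - s ^ 2)) *
    chordSq s t ^ (-l - 1)
    + (1 - s ^ 2) * (l * (l + 1) * (2 * s - 2 * t) ^ 2) * chordSq s t ^ (-l - 2)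

theorem hasDerivAt_chordSq_rpow {l s t : ℝ} (h : 0 < chordSq s t) :
    HasDerivAt (fun s => chordSq s t ^ l) (l * (2 * s - 2 * t) * chordSq s t ^ (l - 1)) s := by
  have h1 : HasDerivAt (fun s => chordSq s t) (2 * s - 2 * t) s := by
    unfold chordSq
    have := (((hasDerivAt_id s).pow 2).const_add 1).sub
      (((hasDerivAt_id s).const_mul 2).mul_const t)
    convert! this using 1
    simp
  convert! h1.rpow_const (p := l) (Or.inl h.ne') using 1
  ring

theorem hasDerivAt_chordSq_rpow_right {l s t : ℝ} (h : 0 < chordSq s t) :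
    HasDerivAt (fun t => chordSq s t ^ l) (l * (-2 * s) * chordSq s t ^ (l - 1)) t := by
  have h1 : HasDerivAt (fun t => chordSq s t) (-2 * s) t := by
    unfold chordSq
    have := ((hasDerivAt_id t).const_mul (2 * s)).const_sub (1 + s ^ 2)
    convert! this using 1
    simp
  convert! h1.rpow_const (p := l) (Or.inl h.ne') using 1
  ring

theorem hasDerivAt_poissonK {l s t : ℝ} (h : 0 < chordSq s t) :
    HasDerivAt (fun s => poissonK l s t) (poissonKs l s t) s := by
  have h1 : HasDerivAt (fun s : ℝ => 1 - s ^ 2) (-2 * s) s := by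
    simpa using ((hasDerivAt_id s).pow 2).const_sub 1
  convert! h1.mul (hasDerivAt_chordSq_rpow (l := -l) h) using 1
  unfold poissonKs; ring

theorem hasDerivAt_poissonKs {l s t : ℝ} (h : 0 < chordSq s t) :
    HasDerivAt (fun s => poissonKs l s t) (poissonKss l s t) s := by
  have h1 : HasDerivAt (fun s : ℝ => 1 - s ^ 2) (-2 * s) s := by
    simpa using ((hasDerivAt_id s).pow 2).const_sub 1
  have h2 : HasDerivAt (fun s : ℝ => -2 * s) (-2) s := by
    simpa using (hasDerivAt_id s).const_mul (-2)
  have h3 : HasDerivAt (fun s : ℝ => -l * (2 * s - 2 * t)) (-l * 2) s := by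
    simpa using (((hasDerivAt_id s).const_mul 2).sub_const (2 * t)).const_mul (-l)
  convert! (h2.mul (hasDerivAt_chordSq_rpow (l := -l) h)).add
    ((h1.mul h3).mul (hasDerivAt_chordSq_rpow (l := -l - 1) h)) using 1
  have e : -l - 1 - 1 = -l - 2 := by ring
  simp only [poissonKss, e, Pi.mul_apply]; ring

/-- The Poisson kernel is harmonic, in polar coordinates around the pole `ζ`. -/
theorem poissonK_pde {n : ℝ} {l s t : ℝ} (hl : n = 2 * l) (h : 0 < chordSq s t) :
    s ^ 2 * poissonKss l s t + (n - 1) * s * poissonKs l s t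
      + ((1 - t ^ 2) * ((1 - s ^ 2) * (2 * l * s * ((l + 1) * (2 * s))) * chordSq s t ^ (-l - 2))
        - (n - 1) * t * ((1 - s ^ 2) * (2 * l * s) * chordSq s t ^ (-l - 1))) = 0 := by
  -- Once the lowest power of `chordSq` is factored out, the claim is a polynomial identity in s, t
  -- and l, with n = 2l.
  have e1 : chordSq s t ^ (-l - 1) = chordSq s t * chordSq s t ^ (-l - 2) := by
    rw [mul_comm, ← Real.rpow_add_one h.ne']; congr 1; ring
  have e0 : chordSq s t ^ (-l) = chordSq s t ^ 2 * chordSq s t ^ (-l - 2) := by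
    rw [mul_comm, ← Real.rpow_add_natCast h.ne']; congr 1; push_cast; ring
  unfold poissonKss poissonKs
  rw [e0, e1]
  generalize chordSq s t ^ (-l - 2) = E
  rw [hl]
  unfold chordSq
  ring

theorem continuousOn_chordSq_rpow (l : ℝ) :
    ContinuousOn (fun x : ℝ × ℝ => chordSq x.1 x.2 ^ l) (Ioo (-1) 1 ×ˢ Icc (-1) 1) := by
  refine ContinuousOn.rpow_const ?_ fun x hx => Or.inl (chordSq_pos hx.1 hx.2).ne'
  unfold chordSq; fun_prop

theorem continuousOn_poissonKs (l : ℝ) :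
    ContinuousOn (fun x : ℝ × ℝ => poissonKs l x.1 x.2) (Ioo (-1) 1 ×ˢ Icc (-1) 1) := by
  have h0 := continuousOn_chordSq_rpow (-l)
  have h1 := continuousOn_chordSq_rpow (-l - 1)
  unfold poissonKs
  exact ((by fun_prop : Continuous fun x : ℝ × ℝ => -2 * x.1).continuousOn.mul h0).add
    ((by fun_prop : Continuous fun x : ℝ × ℝ =>
      (1 - x.1 ^ 2) * (-l * (2 * x.1 - 2 * x.2))).continuousOn.mul h1)

theorem continuousOn_poissonKss (l : ℝ) :
    ContinuousOn (fun x : ℝ × ℝ => poissonKss l x.1 x.2) (Ioo (-1) 1 ×ˢ Icc (-1) 1) := by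
  have h0 := continuousOn_chordSq_rpow (-l)
  have h1 := continuousOn_chordSq_rpow (-l - 1)
  have h2 := continuousOn_chordSq_rpow (-l - 2)
  unfold poissonKss
  exact (((by fun_prop : Continuous fun x : ℝ × ℝ => (-2 : ℝ)).continuousOn.mul h0).add
    ((by fun_prop : Continuous fun x : ℝ × ℝ =>
      4 * x.1 * l * (2 * x.1 - 2 * x.2) - 2 * l * (1 - x.1 ^ 2)).continuousOn.mul h1)).add
    ((by fun_prop : Continuous fun x : ℝ × ℝ =>
      (1 - x.1 ^ 2) * (l * (l + 1) * (2 * x.1 - 2 * x.2) ^ 2)).continuousOn.mul h2)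

theorem continuousOn_poissonK (l : ℝ) :
    ContinuousOn (fun x : ℝ × ℝ => poissonK l x.1 x.2) (Ioo (-1) 1 ×ˢ Icc (-1) 1) := by
  have h0 := continuousOn_chordSq_rpow (-l)
  unfold poissonK
  exact (by fun_prop : Continuous fun x : ℝ × ℝ => 1 - x.1 ^ 2).continuousOn.mul h0

theorem ContinuousOn.section_Ioo_Icc {h : ℝ → ℝ → ℝ}
    (hc : ContinuousOn (fun x : ℝ × ℝ => h x.1 x.2) (Ioo (-1) 1 ×ˢ Icc (-1) 1))
    {s : ℝ} (hs : s ∈ Ioo (-1 : ℝ) 1) : ContinuousOn (h s) (Icc (-1) 1) :=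
  hc.comp (f := fun t => (s, t)) (by fun_prop) (fun t ht => ⟨hs, ht⟩)

/-- The Poisson integral of `p`, as a function of the radius. -/
def poissonInt {n : ℕ} (p : MvPolynomial (Fin n) ℝ) (ζ : USphere n) (s : ℝ) : ℝ :=
  ∫ ξ : USphere n, poissonK ((n : ℝ) / 2) s (dotS ξ ζ) * evalE p ξ ∂(surf n)

/-- The radial derivative of the Poisson integral of `p`. -/
def poissonInt' {n : ℕ} (p : MvPolynomial (Fin n) ℝ) (ζ : USphere n) (s : ℝ) : ℝ :=
  ∫ ξ : USphere n, poissonKs ((n : ℝ) / 2) s (dotS ξ ζ) * evalE p ξ ∂(surf n)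

/-- The second radial derivative of the Poisson integral of `p`. -/
def poissonInt'' {n : ℕ} (p : MvPolynomial (Fin n) ℝ) (ζ : USphere n) (s : ℝ) : ℝ :=
  ∫ ξ : USphere n, poissonKss ((n : ℝ) / 2) s (dotS ξ ζ) * evalE p ξ ∂(surf n)

theorem hasDerivAt_poissonInt {n : ℕ} (p : MvPolynomial (Fin n) ℝ) (ζ : USphere n) {s : ℝ}
    (hs : s ∈ Ioo (-1 : ℝ) 1) : HasDerivAt (poissonInt p ζ) (poissonInt' p ζ s) s :=
  hasDerivAt_integral_zonal ζ (continuous_evalE_sphere p)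
    (fun _ hs _ ht => hasDerivAt_poissonK (chordSq_pos hs ht))
    (fun _ hs => (continuousOn_poissonK _).section_Ioo_Icc hs) (continuousOn_poissonKs _) hs

theorem hasDerivAt_poissonInt' {n : ℕ} (p : MvPolynomial (Fin n) ℝ) (ζ : USphere n) {s : ℝ}
    (hs : s ∈ Ioo (-1 : ℝ) 1) : HasDerivAt (poissonInt' p ζ) (poissonInt'' p ζ s) s :=
  hasDerivAt_integral_zonal ζ (continuous_evalE_sphere p)
    (fun _ hs _ ht => hasDerivAt_poissonKs (chordSq_pos hs ht))
    (fun _ hs => (continuousOn_poissonKs _).section_Ioo_Icc hs) (continuousOn_poissonKss _) hs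

theorem integrable_zonal_mul {n : ℕ} (p : MvPolynomial (Fin n) ℝ) (ζ : USphere n) {h : ℝ → ℝ}
    (hc : ContinuousOn h (Icc (-1) 1)) :
    Integrable (fun ξ : USphere n => h (dotS ξ ζ) * evalE p ξ) (surf n) :=
  integrable_surf_of_continuous ((continuous_comp_dotS ζ hc).mul (continuous_evalE_sphere p))

/-- Harmonicity of the kernel turns the radial operator into minus the spherical Laplacian in ξ; by
symmetry that Laplacian passes to p, where it is the eigenvalue. -/
theorem poissonInt_ode {n j : ℕ} (hn : 1 ≤ n) {p : MvPolynomial (Fin n) ℝ}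
    (hp : p.IsHomogeneous j) (hl : polyLaplacian n p = 0) (ζ : USphere n) {s : ℝ}
    (hs : s ∈ Ioo (-1 : ℝ) 1) :
    s ^ 2 * poissonInt'' p ζ s + (n - 1) * s * poissonInt' p ζ s =
      j * (j + n - 2) * poissonInt p ζ s := by
  set l := (n : ℝ) / 2 with hln
  have hg := integral_sphere_gegenbauer hn hp hl ζ (g := poissonK l s)
    (g1 := fun t => (1 - s ^ 2) * (2 * l * s) * chordSq s t ^ (-l - 1))
    (g2 := fun t => (1 - s ^ 2) * (2 * l * s * ((l + 1) * (2 * s))) * chordSq s t ^ (-l - 2))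
    (fun t ht => by
      convert! (hasDerivAt_chordSq_rpow_right (l := -l) (chordSq_pos hs ht)).const_mul (1 - s ^ 2)
        using 1
      ring)
    (fun t ht => by
      convert! (hasDerivAt_chordSq_rpow_right (l := -l - 1) (chordSq_pos hs ht)).const_mul
        ((1 - s ^ 2) * (2 * l * s)) using 1
      have e : -l - 1 - 1 = -l - 2 := by ring
      rw [e]; ring)
    (continuousOn_const.mul ((continuousOn_chordSq_rpow _).section_Ioo_Icc
      (h := fun s t => chordSq s t ^ (-l - 2)) hs))
  have i0 := integrable_zonal_mul p ζ ((continuousOn_poissonK l).section_Ioo_Icc hs)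
  have i1 := integrable_zonal_mul p ζ ((continuousOn_poissonKs l).section_Ioo_Icc hs)
  have i2 := integrable_zonal_mul p ζ ((continuousOn_poissonKss l).section_Ioo_Icc hs)
  unfold poissonInt poissonInt' poissonInt''
  rw [← hln, ← sub_eq_zero, ← integral_const_mul, ← integral_const_mul, ← integral_const_mul,
    ← integral_add (i2.const_mul _) (i1.const_mul _),
    ← integral_sub, ← neg_eq_zero, ← hg, ← integral_neg]
  rotate_left
  · exact (i2.const_mul _).add (i1.const_mul _)
  · exact i0.const_mul _
  congr 1
  ext ξ
  have h := poissonK_pde (n := n) (l := l) (by rw [hln]; ring)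
    (chordSq_pos hs (abs_le.1 (abs_dotS_le ξ ζ)))
  linear_combination (-evalE p ξ) * h

theorem eq_of_hasDerivAt_zero {f : ℝ → ℝ} {a b : ℝ} (hab : a < b)
    (hc : ContinuousOn f (Icc a b)) (hf : ∀ x ∈ Ioo a b, HasDerivAt f 0 x) : f a = f b := by
  obtain ⟨c, hc, h⟩ := exists_hasDerivAt_eq_slope f (fun _ => 0) hab hc hf
  rw [eq_comm, div_eq_zero_iff] at h
  rcases h with h | h <;> linarith

/-- The Euler equation satisfied by the Poisson integral of a spherical harmonic. -/
theorem poissonInt_euler {n j : ℕ} (hn : 2 ≤ n) {p : MvPolynomial (Fin n) ℝ}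
    (hp : p.IsHomogeneous j) (hl : polyLaplacian n p = 0) (ζ : USphere n) {s : ℝ}
    (hs : s ∈ Ioo (0 : ℝ) 1) : s * poissonInt' p ζ s = j * poissonInt p ζ s := by
  obtain ⟨e, he⟩ : ∃ e, j + n = e + 2 := ⟨j + n - 2, by omega⟩
  have he' : (n : ℝ) = e + 2 - j := by
    have : ((j + n : ℕ) : ℝ) = ((e + 2 : ℕ) : ℝ) := by rw [he]
    push_cast at this; linarith
  -- With u the Poisson integral, W = s^e (s u' - j u) with e = j + n - 2 has zero derivative by the
  -- differential equation. It vanishes at 0 because u is regular there, and this excludes the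
  -- second solution s^(-e) (or log s when n = 2 and j = 0).
  set W : ℝ → ℝ := fun s => s ^ e * (s * poissonInt' p ζ s - j * poissonInt p ζ s) with hW
  have hder : ∀ x ∈ Ioo (-1 : ℝ) 1, HasDerivAt W (e * x ^ (e - 1) * (x * poissonInt' p ζ x - j * poissonInt p ζ x) + x ^ e * (1 * poissonInt' p ζ x + x * poissonInt'' p ζ x - j * poissonInt' p ζ x)) x :=
    fun x hx => (hasDerivAt_pow e x).mul
      (((hasDerivAt_id x).mul (hasDerivAt_poissonInt' p ζ hx)).sub
        ((hasDerivAt_poissonInt p ζ hx).const_mul (j : ℝ)))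
  have hconst : W 0 = W s := by
    refine eq_of_hasDerivAt_zero hs.1 (fun x hx => ?_) fun x hx => ?_
    · exact (hder x ⟨by linarith [hx.1], hx.2.trans_lt hs.2⟩).continuousAt.continuousWithinAt
    · have hx' : x ∈ Ioo (-1 : ℝ) 1 := ⟨by linarith [hx.1], hx.2.trans hs.2⟩
      convert! hder x hx' using 1
      have h := poissonInt_ode (by omega) hp hl ζ hx'
      rw [he'] at h
      have hx0 : x ≠ 0 := hx.1.ne'
      apply mul_left_cancel₀ hx0
      rcases e with _ | e
      · simp only [Nat.cast_zero, zero_mul, pow_zero, zero_add, one_mul] at h ⊢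
        linear_combination -h
      · rw [Nat.add_sub_cancel, pow_succ]
        linear_combination -(x ^ e * x) * h
  have hW0 : W 0 = 0 := by
    simp only [hW]
    -- When j = 0 the exponent e may be 0, but then s u' - j u already vanishes at s = 0; when j > 0
    -- the exponent is positive.
    rcases j with _ | j
    · simp
    · have : e ≠ 0 := by omega
      simp [this]
  rw [hW0] at hconst
  have := (mul_eq_zero.1 hconst.symm).resolve_left (pow_pos hs.1 e).ne'
  linarith

theorem poissonInt_div_pow {n j : ℕ} (hn : 2 ≤ n) {p : MvPolynomial (Fin n) ℝ}
    (hp : p.IsHomogeneous j) (hl : polyLaplacian n p = 0) (ζ : USphere n) {s r : ℝ}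
    (hs : 0 < s) (hsr : s < r) (hr : r < 1) :
    poissonInt p ζ s / s ^ j = poissonInt p ζ r / r ^ j := by
  have hder : ∀ x ∈ Ioo (0 : ℝ) 1, HasDerivAt (fun x => poissonInt p ζ x / x ^ j) 0 x := by
    intro x hx
    have hx' : x ∈ Ioo (-1 : ℝ) 1 := ⟨by linarith [hx.1], hx.2⟩
    have hx0 : x ≠ 0 := hx.1.ne'
    convert! (hasDerivAt_poissonInt p ζ hx').div (hasDerivAt_pow j x) (pow_ne_zero j hx0) using 1
    rw [eq_comm, div_eq_zero_iff]
    left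
    have h := poissonInt_euler hn hp hl ζ hx
    apply mul_left_cancel₀ hx0
    rcases j with _ | j
    · simp at h ⊢
      tauto
    · rw [Nat.add_sub_cancel, pow_succ]
      linear_combination (x ^ j * x) * h
  exact eq_of_hasDerivAt_zero hsr
    (fun x hx => (hder x ⟨hs.trans_le hx.1, hx.2.trans_lt hr⟩).continuousAt.continuousWithinAt)
    fun x hx => hder x ⟨hs.trans hx.1, hx.2.trans hr⟩

/-- The case of the harmonic polynomial 1: the Euler equation makes the integral independent of the
radius, and at radius 0 the kernel is 1. -/
theorem integral_poissonK {n : ℕ} (hn : 2 ≤ n) (ζ : USphere n) {s : ℝ} (hs : s ∈ Ioo (0 : ℝ) 1) :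
    ∫ ξ : USphere n, poissonK ((n : ℝ) / 2) s (dotS ξ ζ) ∂(surf n) = (surf n).real univ := by
  have h1 : (1 : MvPolynomial (Fin n) ℝ).IsHomogeneous 0 := MvPolynomial.isHomogeneous_one _ _
  have hl : polyLaplacian n 1 = 0 := by simp [polyLaplacian]
  have he : ∀ x : EuclideanSpace ℝ (Fin n), evalE (1 : MvPolynomial (Fin n) ℝ) x = 1 := by
    simp [evalE]
  have key : poissonInt 1 ζ 0 = poissonInt 1 ζ s := by
    refine eq_of_hasDerivAt_zero hs.1 (fun x hx => ?_) fun x hx => ?_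
    · exact (hasDerivAt_poissonInt 1 ζ ⟨by linarith [hx.1], hx.2.trans_lt hs.2⟩).continuousAt.continuousWithinAt
    · have h := poissonInt_euler hn h1 hl ζ (s := x) ⟨hx.1, hx.2.trans hs.2⟩
      have h' := hasDerivAt_poissonInt (1 : MvPolynomial (Fin n) ℝ) ζ (s := x) ⟨by linarith [hx.1], hx.2.trans hs.2⟩
      have h0 : poissonInt' 1 ζ x = 0 := by
        simp at h
        exact h.resolve_left hx.1.ne'
      rwa [h0] at h'
  simp only [poissonInt, he, mul_one] at key
  rw [← key]
  simp [poissonK, chordSq, Measure.real]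

theorem exists_dotS_of_continuous {n : ℕ} (ζ : USphere n) {f : USphere n → ℝ} (hf : Continuous f)
    {ε : ℝ} (hε : 0 < ε) : ∃ δ > 0, ∀ ξ, 1 - δ < dotS ξ ζ → |f ξ - f ζ| < ε := by
  obtain ⟨δ, hδ, h⟩ := Metric.continuous_iff.1 hf ζ ε hε
  refine ⟨δ ^ 2 / 2, by positivity, fun ξ hξ => h ξ ?_⟩
  rw [Subtype.dist_eq, dist_eq_norm]
  have := norm_sub_sq_sphere ξ ζ
  exact lt_of_pow_lt_pow_left₀ 2 hδ.le (by linarith)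

/-- The Poisson integral of a solid harmonic. -/
theorem poissonInt_eq {n j : ℕ} (hn : 2 ≤ n) {p : MvPolynomial (Fin n) ℝ}
    (hp : p.IsHomogeneous j) (hl : polyLaplacian n p = 0) (ζ : USphere n) {s : ℝ}
    (hs : s ∈ Ioo (0 : ℝ) 1) :
    poissonInt p ζ s = (surf n).real univ * s ^ j * evalE p ζ := by
  set σ := (surf n).real univ with hσ
  set c := poissonInt p ζ s / s ^ j with hc
  obtain ⟨B, hB⟩ : ∃ B, ∀ ξ : USphere n, |evalE p ξ - evalE p ζ| ≤ B := by
    obtain ⟨B, hB⟩ := isCompact_univ.exists_bound_of_continuousOn (f := fun ξ : USphere n => evalE p ξ - evalE p ζ)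
      ((continuous_evalE_sphere p).sub continuous_const).continuousOn
    exact ⟨B, fun ξ => hB ξ (mem_univ _)⟩
  have hB0 : 0 ≤ B := (abs_nonneg _).trans (hB ζ)
  set l := (n : ℝ) / 2 with hln
  have hl0 : 0 ≤ l := by positivity
  have main : ∀ ε > 0, |c - σ * evalE p ζ| ≤ σ * ε := by
    intro ε hε
    obtain ⟨δ, hδ, h⟩ := exists_dotS_of_continuous ζ (continuous_evalE_sphere p) hε
    -- The kernel as an approximate identity at ζ. Where ⟨ξ, ζ⟩ > 1 - δ the oscillation of p is
    -- below ε and the kernel has total mass σ. Elsewhere `chordSq` is at least 2rδ ≥ δ, which is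
    -- the reason for r > 1/2, and the factor 1 - r² makes the contribution small.
    have hbd : ∀ r ∈ Ioo (max s (1 / 2)) 1, |c * r ^ j - σ * evalE p ζ| ≤
        σ * ε + (1 - r ^ 2) * (δ ^ (-l) * B * σ) := by
      intro r hr
      have hr1 : s < r := (le_max_left _ _).trans_lt hr.1
      have hr2 : 1 / 2 < r := (le_max_right _ _).trans_lt hr.1
      have hr0 : r ∈ Ioo (0 : ℝ) 1 := ⟨by linarith, hr.2⟩
      have hr' : r ∈ Ioo (-1 : ℝ) 1 := ⟨by linarith, hr.2⟩
      have hr2 : 0 ≤ 1 - r ^ 2 := by nlinarith [hr.2]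
      have e : c * r ^ j = poissonInt p ζ r := by
        rw [hc, poissonInt_div_pow hn hp hl ζ hs.1 hr1 hr.2,
          div_mul_cancel₀ _ (pow_ne_zero j hr0.1.ne')]
      have cK : Continuous fun ξ : USphere n => poissonK l r (dotS ξ ζ) :=
        continuous_comp_dotS ζ ((continuousOn_poissonK l).section_Ioo_Icc hr')
      have hpc := continuous_evalE_sphere p
      have e2 : poissonInt p ζ r - σ * evalE p ζ =
          ∫ ξ : USphere n, poissonK l r (dotS ξ ζ) * (evalE p ξ - evalE p ζ) ∂(surf n) := by
        simp_rw [mul_sub]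
        rw [integral_sub (integrable_surf_of_continuous (by fun_prop))
          (integrable_surf_of_continuous (by fun_prop)), integral_mul_const,
          integral_poissonK hn ζ hr0]
        rfl
      rw [e, e2]
      calc _ ≤ ∫ ξ : USphere n, |poissonK l r (dotS ξ ζ) * (evalE p ξ - evalE p ζ)| ∂(surf n) :=
            abs_integral_le_integral_abs
        _ ≤ ∫ ξ : USphere n, (poissonK l r (dotS ξ ζ) * ε + (1 - r ^ 2) * (δ ^ (-l) * B)) ∂(surf n) := by
            refine integral_mono (integrable_surf_of_continuous (by fun_prop))
              (integrable_surf_of_continuous (by fun_prop)) fun ξ => ?_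
            beta_reduce
            have hD := chordSq_pos hr' (abs_le.1 (abs_dotS_le ξ ζ))
            have hK : 0 ≤ poissonK l r (dotS ξ ζ) := mul_nonneg hr2 (Real.rpow_nonneg hD.le _)
            rw [abs_mul, abs_of_nonneg hK]
            by_cases ht : 1 - δ < dotS ξ ζ
            · have := mul_le_mul_of_nonneg_left (h ξ ht).le hK
              have h3 : 0 ≤ (1 - r ^ 2) * (δ ^ (-l) * B) := by positivity
              linarith
            · have h4 : δ ≤ chordSq r (dotS ξ ζ) := by
                unfold chordSq
                nlinarith [sq_nonneg (1 - r)]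
              have h5 : poissonK l r (dotS ξ ζ) ≤ (1 - r ^ 2) * δ ^ (-l) :=
                mul_le_mul_of_nonneg_left (Real.rpow_le_rpow_of_nonpos hδ h4 (by linarith)) hr2
              have h6 := mul_le_mul h5 (hB ξ) (abs_nonneg _) (by positivity)
              have h7 : 0 ≤ poissonK l r (dotS ξ ζ) * ε := by positivity
              linarith
        _ = _ := by
            rw [integral_add (integrable_surf_of_continuous (by fun_prop)) (integrable_const _),
              integral_mul_const, integral_poissonK hn ζ hr0, integral_const, smul_eq_mul]
            ring
    -- Now r tends to 1 from below while c, which does not depend on r, stays fixed.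
    have hmem : Ioo (max s (1 / 2)) 1 ∈ nhdsWithin (1 : ℝ) (Iio 1) :=
      Ioo_mem_nhdsLT (max_lt hs.2 (by norm_num))
    have t1 : Filter.Tendsto (fun r : ℝ => |c * r ^ j - σ * evalE p ζ|) (nhdsWithin (1 : ℝ) (Iio 1))
        (nhds |c * 1 ^ j - σ * evalE p ζ|) :=
      Filter.Tendsto.mono_left (Continuous.tendsto (by fun_prop) 1) nhdsWithin_le_nhds
    have t2 : Filter.Tendsto (fun r : ℝ => σ * ε + (1 - r ^ 2) * (δ ^ (-l) * B * σ))
        (nhdsWithin (1 : ℝ) (Iio 1)) (nhds (σ * ε + (1 - 1 ^ 2) * (δ ^ (-l) * B * σ))) :=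
      Filter.Tendsto.mono_left (Continuous.tendsto (by fun_prop) 1) nhdsWithin_le_nhds
    have := le_of_tendsto_of_tendsto t1 t2 (by filter_upwards [hmem] with r hr using hbd r hr)
    simpa using this
  have hce : c = σ * evalE p ζ := by
    by_contra hne
    have hpos : 0 < |c - σ * evalE p ζ| := abs_pos.2 (sub_ne_zero.2 hne)
    have hσ0 : 0 ≤ σ := measureReal_nonneg
    have := main (|c - σ * evalE p ζ| / (2 * (σ + 1))) (by positivity)
    have h2 : σ * (|c - σ * evalE p ζ| / (2 * (σ + 1))) < |c - σ * evalE p ζ| := by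
      rw [← mul_div_assoc, div_lt_iff₀ (by positivity)]
      nlinarith
    linarith
  rw [hc, div_eq_iff (pow_ne_zero j hs.1.ne')] at hce
  rw [hce]; ring

/-! ### The surface measure of S^n in the coordinates (θ, ξ'). -/

/-- Standard polar coordinates with the angle shifted by π/2, so that it is measured from the
negative t-axis; the half-plane r > 0 becomes 0 < η < π because sin η ≤ 0 on the rest of the shifted
range. -/
theorem lintegral_halfPlane_polar {F : ℝ × ℝ → ENNReal} (hF : Measurable F) :
    ∫⁻ t : ℝ, ∫⁻ r in Ioi (0 : ℝ), F (r, t) =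
      ∫⁻ R in Ioi (0 : ℝ), ∫⁻ η in Ioo 0 Real.pi,
        ENNReal.ofReal R * F (R * Real.sin η, -(R * Real.cos η)) := by
  set G : ℝ × ℝ → ENNReal := (Ioi (0 : ℝ) ×ˢ univ).indicator F with hG
  have hGm : Measurable G := hF.indicator (measurableSet_Ioi.prod MeasurableSet.univ)
  have h1 : ∫⁻ p, G p = ∫⁻ t : ℝ, ∫⁻ r in Ioi (0 : ℝ), F (r, t) := by
    rw [Measure.volume_eq_prod, lintegral_prod_symm _ hGm.aemeasurable]
    refine lintegral_congr fun t => ?_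
    rw [← lintegral_indicator measurableSet_Ioi]
    refine lintegral_congr fun r => ?_
    simp [hG, indicator]
  rw [← h1, ← lintegral_comp_polarCoord_symm, polarCoord_target, Measure.volume_eq_prod,
    ← Measure.prod_restrict, lintegral_prod]
  swap
  · apply Measurable.aemeasurable
    exact (by fun_prop : Measurable fun p : ℝ × ℝ => ENNReal.ofReal p.1).smul
      (hGm.comp continuous_polarCoord_symm.measurable)
  refine setLIntegral_congr_fun measurableSet_Ioi fun R hR => ?_
  rw [← lintegral_indicator measurableSet_Ioo, ← lintegral_indicator measurableSet_Ioo,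
    ← lintegral_sub_right_eq_self _ (Real.pi / 2)]
  refine lintegral_congr fun η => ?_
  have hs : Real.cos (η - Real.pi / 2) = Real.sin η := Real.cos_sub_pi_div_two η
  have hc : Real.sin (η - Real.pi / 2) = -Real.cos η := Real.sin_sub_pi_div_two η
  have hpi := Real.pi_pos
  by_cases hη : η ∈ Ioo 0 Real.pi
  · have h2 : η - Real.pi / 2 ∈ Ioo (-Real.pi) Real.pi := ⟨by linarith [hη.1], by linarith [hη.2]⟩
    have h3 : 0 < R * Real.sin η := mul_pos hR (Real.sin_pos_of_mem_Ioo hη)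
    rw [indicator_of_mem hη, indicator_of_mem h2, polarCoord_symm_apply, hs, hc]
    simp [hG, h3]
  · rw [indicator_of_notMem hη]
    by_cases h2 : η - Real.pi / 2 ∈ Ioo (-Real.pi) Real.pi
    · rw [indicator_of_mem h2, polarCoord_symm_apply, hs]
      have h3 : Real.sin η ≤ 0 := by
        rcases le_or_gt η 0 with h | h
        · exact Real.sin_nonpos_of_nonpos_of_neg_pi_le h (by linarith [h2.1])
        · have h4 : Real.pi ≤ η := by
            by_contra hc
            exact hη ⟨h, not_le.1 hc⟩
          have := Real.sin_nonneg_of_nonneg_of_le_pi (x := η - Real.pi) (by linarith)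
            (by linarith [h2.2])
          rw [Real.sin_sub_pi] at this
          linarith
      have h4 : ¬ 0 < R * Real.sin η := not_lt.2 (mul_nonpos_of_nonneg_of_nonpos (le_of_lt hR) h3)
      simp [hG, h4]
    · rw [indicator_of_notMem h2]

/-- The point of `ℝ^{n+1}` with horizontal part `v` and height `t`. -/
def cylVec {n : ℕ} (v : EuclideanSpace ℝ (Fin n)) (t : ℝ) : EuclideanSpace ℝ (Fin (n + 1)) :=
  WithLp.toLp 2 (Fin.snoc (α := fun _ => ℝ) (fun i : Fin n => v i) t)

theorem continuous_cylVec {n : ℕ} :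
    Continuous (fun p : EuclideanSpace ℝ (Fin n) × ℝ => cylVec p.1 p.2) := by
  unfold cylVec
  refine (PiLp.continuous_toLp 2 _).comp (continuous_pi fun i => ?_)
  refine Fin.lastCases ?_ (fun i => ?_) i
  · simp only [Fin.snoc_last]; fun_prop
  · simp only [Fin.snoc_castSucc]; fun_prop

theorem lintegral_cylVec {n : ℕ} {g : EuclideanSpace ℝ (Fin (n + 1)) → ENNReal}
    (hg : Measurable g) : ∫⁻ x, g x = ∫⁻ t : ℝ, ∫⁻ v : EuclideanSpace ℝ (Fin n), g (cylVec v t) := by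
  have e1 := (PiLp.volume_preserving_toLp (Fin (n + 1))).lintegral_comp hg
  have hg1 : Measurable fun y : Fin (n + 1) → ℝ => g (WithLp.toLp 2 y) :=
    hg.comp (PiLp.continuous_toLp 2 _).measurable
  have e2 := ((volume_preserving_piFinSuccAbove (fun _ : Fin (n + 1) => ℝ)
    (Fin.last n)).symm).lintegral_comp hg1
  rw [← e1, ← e2, Measure.volume_eq_prod, lintegral_prod]
  swap
  · exact (hg1.comp (MeasurableEquiv.measurable _)).aemeasurable
  refine lintegral_congr fun t => ?_
  have hg2 : Measurable fun v : EuclideanSpace ℝ (Fin n) => g (cylVec v t) :=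
    hg.comp (continuous_cylVec.comp (by fun_prop : Continuous fun v => (v, t))).measurable
  rw [← (PiLp.volume_preserving_toLp (Fin n)).lintegral_comp hg2]
  refine lintegral_congr fun v => ?_
  simp [cylVec, MeasurableEquiv.piFinSuccAbove_symm_apply, Fin.insertNthEquiv, Fin.insertNth_last']

theorem smul_polarPt_eq_cylVec {n : ℕ} (R η : ℝ) (ζ : USphere n) :
    R • (polarPt η ζ : EuclideanSpace ℝ (Fin (n + 1))) =
      cylVec ((R * Real.sin η) • (ζ : EuclideanSpace ℝ (Fin n))) (-(R * Real.cos η)) := by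
  ext i
  refine Fin.lastCases ?_ (fun i => ?_) i
  · simp [polarPt, polarVec, cylVec]
  · simp [polarPt, polarVec, cylVec, mul_assoc]

theorem continuous_polarPt {n : ℕ} :
    Continuous (fun p : ℝ × USphere n => polarPt p.1 p.2) := by
  refine Continuous.subtype_mk ?_ _
  have : (fun p : ℝ × USphere n => polarVec p.1 p.2) = fun p : ℝ × USphere n =>
      cylVec ((1 * Real.sin p.1) • (p.2 : EuclideanSpace ℝ (Fin n))) (-(1 * Real.cos p.1)) := by
    ext1 p
    rw [← smul_polarPt_eq_cylVec, one_smul]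
    rfl
  rw [this]
  exact continuous_cylVec.comp (f := fun p : ℝ × USphere n =>
    ((1 * Real.sin p.1) • (p.2 : EuclideanSpace ℝ (Fin n)), -(1 * Real.cos p.1))) (by fun_prop)

/-- The height is split off, polar coordinates are used in the horizontal ℝ^n, and then in the
half-plane of (horizontal radius, height). The densities combine as R (R sin η)^(n-1) = R^n
sin^(n-1) η. -/
theorem lintegral_polar_polarPt {n : ℕ} (hn : 1 ≤ n) {g : EuclideanSpace ℝ (Fin (n + 1)) → ENNReal}
    (hg : Measurable g) :
    ∫⁻ x, g x = ∫⁻ ζ : USphere n, (∫⁻ R in Ioi (0 : ℝ), ∫⁻ η in Ioo 0 Real.pi,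
      ENNReal.ofReal (R ^ n) * (ENNReal.ofReal (Real.sin η ^ (n - 1)) *
        g (R • (polarPt η ζ : EuclideanSpace ℝ (Fin (n + 1)))))) ∂(surf n) := by
  rw [lintegral_cylVec hg]
  have hm : Measurable fun p : (ℝ × USphere n) × ℝ =>
      ENNReal.ofReal (p.2 ^ (n - 1)) * g (cylVec (p.2 • (p.1.2 : EuclideanSpace ℝ (Fin n))) p.1.1) :=
    (by fun_prop : Measurable fun p : (ℝ × USphere n) × ℝ => ENNReal.ofReal (p.2 ^ (n - 1))).mul
      (hg.comp (continuous_cylVec.comp (f := fun p : (ℝ × USphere n) × ℝ =>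
        (p.2 • (p.1.2 : EuclideanSpace ℝ (Fin n)), p.1.1)) (by fun_prop)).measurable)
  have h1 : ∀ t : ℝ, ∫⁻ v : EuclideanSpace ℝ (Fin n), g (cylVec v t) =
      ∫⁻ ζ : USphere n, (∫⁻ r in Ioi (0 : ℝ), ENNReal.ofReal (r ^ (n - 1)) *
        g (cylVec (r • (ζ : EuclideanSpace ℝ (Fin n))) t)) ∂(surf n) := fun t =>
    lintegral_polar_sphere hn
      (hg.comp (continuous_cylVec.comp (by fun_prop : Continuous fun v => (v, t))).measurable)
  simp_rw [h1]
  rw [lintegral_lintegral_swap]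
  swap
  · exact (hm.lintegral_prod_right').aemeasurable
  refine lintegral_congr fun ζ => ?_
  have hF : Measurable fun p : ℝ × ℝ => ENNReal.ofReal (p.1 ^ (n - 1)) *
      g (cylVec (p.1 • (ζ : EuclideanSpace ℝ (Fin n))) p.2) :=
    hm.comp (g := _) (f := fun p : ℝ × ℝ => ((p.2, ζ), p.1)) (by fun_prop)
  rw [lintegral_halfPlane_polar hF]
  refine setLIntegral_congr_fun measurableSet_Ioi fun R hR => ?_
  refine setLIntegral_congr_fun measurableSet_Ioo fun η hη => ?_
  have hR0 : (0 : ℝ) ≤ R := le_of_lt hR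
  have hs : 0 ≤ Real.sin η := (Real.sin_pos_of_mem_Ioo hη).le
  beta_reduce
  rw [← smul_polarPt_eq_cylVec, mul_pow, ENNReal.ofReal_mul (by positivity), ← mul_assoc, ← mul_assoc,
    ← mul_assoc, ← ENNReal.ofReal_mul hR0, ← pow_succ', Nat.sub_add_cancel hn]

/-- The measure `sin^{n-1} η dη` on `(0, π)`. -/
def polarMeas (n : ℕ) : Measure ℝ :=
  (volume.restrict (Ioo 0 Real.pi)).withDensity fun η => ENNReal.ofReal (Real.sin η ^ (n - 1))

instance sFinite_polarMeas (n : ℕ) : SFinite (polarMeas n) := by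
  unfold polarMeas; infer_instance

/-- The surface measure of `S^n` in polar coordinates. -/
theorem surf_eq_map_polarPt {n : ℕ} (hn : 1 ≤ n) :
    surf (n + 1) = ((polarMeas n).prod (surf n)).map (fun p => polarPt p.1 p.2) := by
  ext E hE
  set e := homeomorphUnitSphereProd (EuclideanSpace ℝ (Fin (n + 1)))
  -- S is the truncated cone over E. Its volume, computed in the two polar systems, is the same
  -- constant c = ∫₀¹ R^n dR times each of the two measures of E; since 0 < c < ∞, it cancels.
  set S : Set (EuclideanSpace ℝ (Fin (n + 1))) :=
    Subtype.val '' (e ⁻¹' (E ×ˢ {r : Ioi (0 : ℝ) | (r : ℝ) < 1})) with hS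
  have hSm : MeasurableSet S := by
    refine MeasurableSet.subtype_image (measurableSet_singleton _).compl (e.measurable ?_)
    exact hE.prod (measurableSet_lt measurable_subtype_coe measurable_const)
  have hmem : ∀ (x : USphere (n + 1)) (R : ℝ), 0 < R →
      (R • (x : EuclideanSpace ℝ (Fin (n + 1))) ∈ S ↔ x ∈ E ∧ R < 1) := by
    intro x R hR
    have hx : ‖(x : EuclideanSpace ℝ (Fin (n + 1)))‖ = 1 := by simp
    have hne : R • (x : EuclideanSpace ℝ (Fin (n + 1))) ≠ 0 := by
      rw [← norm_ne_zero_iff, norm_smul, hx]; simp [hR.ne']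
    have he : e ⟨R • (x : EuclideanSpace ℝ (Fin (n + 1))), hne⟩ = (x, ⟨R, hR⟩) := by
      rw [← e.apply_symm_apply (x, ⟨R, hR⟩)]
      congr 1
    rw [hS, mem_image]
    constructor
    · rintro ⟨y, hy, hyx⟩
      have : y = ⟨R • (x : EuclideanSpace ℝ (Fin (n + 1))), hne⟩ := Subtype.ext hyx
      rw [this, mem_preimage, he] at hy
      exact hy
    · intro h
      exact ⟨_, by rw [mem_preimage, he]; exact h, rfl⟩
  set c : ENNReal := ∫⁻ R in Ioi (0 : ℝ), ENNReal.ofReal (R ^ n) * (Iio (1 : ℝ)).indicator 1 R with hc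
  have hg : Measurable (S.indicator (1 : EuclideanSpace ℝ (Fin (n + 1)) → ENNReal)) :=
    measurable_one.indicator hSm
  have hcm : Measurable fun R : ℝ => ENNReal.ofReal (R ^ n) * (Iio (1 : ℝ)).indicator (1 : ℝ → ENNReal) R :=
    (by fun_prop : Measurable fun R : ℝ => ENNReal.ofReal (R ^ n)).mul
      (measurable_one.indicator measurableSet_Iio)
  have hind : ∀ (x : USphere (n + 1)) (R : ℝ), 0 < R →
      S.indicator (1 : EuclideanSpace ℝ (Fin (n + 1)) → ENNReal) (R • (x : EuclideanSpace ℝ (Fin (n + 1))))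
        = (Iio (1 : ℝ)).indicator 1 R * E.indicator 1 x := by
    intro x R hR
    have := hmem x R hR
    by_cases h1 : x ∈ E <;> by_cases h2 : R < 1 <;> simp [h1, h2, this]
  have hEm : Measurable (E.indicator (1 : USphere (n + 1) → ENNReal)) := measurable_one.indicator hE
  have hA : volume S = c * surf (n + 1) E := by
    rw [← lintegral_indicator_one hSm, lintegral_polar_sphere (by omega) hg,
      ← lintegral_indicator_one hE, ← lintegral_const_mul _ hEm]
    refine lintegral_congr fun x => ?_
    rw [hc, ← lintegral_mul_const _ hcm]
    refine setLIntegral_congr_fun measurableSet_Ioi fun R hR => ?_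
    beta_reduce
    rw [hind x R hR, Nat.add_sub_cancel, mul_assoc]
  have hpm : Measurable fun p : ℝ × USphere n => E.indicator (1 : USphere (n + 1) → ENNReal) (polarPt p.1 p.2) :=
    hEm.comp continuous_polarPt.measurable
  have hB : volume S = c * ((polarMeas n).prod (surf n)).map (fun p => polarPt p.1 p.2) E := by
    rw [← lintegral_indicator_one hSm, lintegral_polar_polarPt hn hg,
      ← lintegral_indicator_one hE, lintegral_map hEm continuous_polarPt.measurable,
      lintegral_prod_symm _ hpm.aemeasurable, ← lintegral_const_mul _ hpm.lintegral_prod_left']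
    refine lintegral_congr fun ζ => ?_
    have hpm' : Measurable fun η : ℝ => E.indicator (1 : USphere (n + 1) → ENNReal) (polarPt η ζ) :=
      hpm.comp (f := fun η : ℝ => (η, ζ)) (by fun_prop)
    rw [polarMeas, lintegral_withDensity_eq_lintegral_mul _ (by fun_prop) hpm', hc,
      ← lintegral_mul_const _ hcm]
    refine setLIntegral_congr_fun measurableSet_Ioi fun R hR => ?_
    beta_reduce
    rw [← lintegral_const_mul _ ((by fun_prop : Measurable fun η : ℝ => ENNReal.ofReal (Real.sin η ^ (n - 1))).mul hpm')]
    refine lintegral_congr fun η => ?_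
    rw [hind _ R hR]
    simp only [Pi.mul_apply]
    ring
  have hc0 : c ≠ 0 := by
    intro h0
    have h : surf (n + 1) univ * c = 0 := by rw [h0, mul_zero]
    rw [hc, lintegral_eq_zero_iff hcm, Filter.EventuallyEq, ae_restrict_iff' measurableSet_Ioi] at h0
    have h1 : volume (Ioo (0 : ℝ) 1) = 0 := by
      refine measure_mono_null (fun R hR => ?_) h0
      simp only [mem_compl_iff, mem_ofPred_eq, not_forall]
      refine ⟨hR.1, ?_⟩
      have : (0 : ℝ) < R ^ n := pow_pos hR.1 n
      simp [hR.2, this]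
    simp at h1
  have hc1 : c ≠ ⊤ := by
    have : c ≤ 1 := by
      calc c ≤ ∫⁻ R in Ioi (0 : ℝ), (Iio (1 : ℝ)).indicator 1 R := by
            refine setLIntegral_mono (measurable_one.indicator measurableSet_Iio) fun R hR => ?_
            by_cases h : R < 1
            · have : R ^ n ≤ 1 := pow_le_one₀ (le_of_lt hR) h.le
              simp [h, this]
            · simp [h]
        _ = 1 := by
            rw [lintegral_indicator_one measurableSet_Iio,
              Measure.restrict_apply measurableSet_Iio, inter_comm, Ioi_inter_Iio]
            simp
    exact ne_top_of_le_ne_top ENNReal.one_ne_top this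
  exact (ENNReal.mul_right_inj hc0 hc1).1 (hA.symm.trans hB)

/-! ### The kernel in stereographic coordinates and its eigenvalues. -/

theorem cos_eq_tan_half {θ : ℝ} (hθ : θ ∈ Ioo 0 Real.pi) :
    Real.cos θ = (1 - Real.tan (θ / 2) ^ 2) / (1 + Real.tan (θ / 2) ^ 2) := by
  have hc : 0 < Real.cos (θ / 2) :=
    Real.cos_pos_of_mem_Ioo ⟨by linarith [hθ.1, Real.pi_pos], by linarith [hθ.2]⟩
  have h := Real.sin_sq_add_cos_sq (θ / 2)
  have e : θ = 2 * (θ / 2) := by ring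
  conv_lhs => rw [e, Real.cos_two_mul']
  rw [Real.tan_eq_sin_div_cos]
  have : (0 : ℝ) < Real.cos (θ / 2) ^ 2 + Real.sin (θ / 2) ^ 2 := by linarith
  field_simp
  rw [add_comm, h]; ring

theorem tan_half_pos {θ : ℝ} (hθ : θ ∈ Ioo 0 Real.pi) : 0 < Real.tan (θ / 2) :=
  Real.tan_pos_of_pos_of_lt_pi_div_two (by linarith [hθ.1]) (by linarith [hθ.2])

theorem tan_half_lt {θ η : ℝ} (hη : η ∈ Ioo 0 Real.pi) (hθ : θ ∈ Ioo 0 Real.pi) (h : η < θ) :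
    Real.tan (η / 2) < Real.tan (θ / 2) :=
  Real.tan_lt_tan_of_lt_of_lt_pi_div_two (by linarith [hη.1, Real.pi_pos]) (by linarith [hθ.2])
    (by linarith)

theorem norm_polarPt_sub_sq {n : ℕ} {θ η : ℝ} (hθ : θ ∈ Ioo 0 Real.pi) (hη : η ∈ Ioo 0 Real.pi)
    (ξ ζ : USphere n) :
    ‖(polarPt θ ξ : EuclideanSpace ℝ (Fin (n + 1))) - (polarPt η ζ : EuclideanSpace ℝ (Fin (n + 1)))‖ ^ 2 =
      4 / ((1 + Real.tan (θ / 2) ^ 2) * (1 + Real.tan (η / 2) ^ 2)) *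
        (Real.tan (θ / 2) ^ 2 + Real.tan (η / 2) ^ 2
          - 2 * Real.tan (θ / 2) * Real.tan (η / 2) * dotS ξ ζ) := by
  have h : dotS (polarPt θ ξ) (polarPt η ζ) =
      Real.sin θ * Real.sin η * dotS ξ ζ + Real.cos θ * Real.cos η := by
    unfold dotS
    rw [Fin.sum_univ_castSucc, Finset.mul_sum]
    congr 1
    · refine Finset.sum_congr rfl fun i _ => ?_
      simp [polarPt, polarVec]; ring
    · simp [polarPt, polarVec]; ring
  rw [norm_sub_sq_sphere, h, Real.sin_eq_two_mul_tan_half_div_one_add_tan_half_sq θ, Real.sin_eq_two_mul_tan_half_div_one_add_tan_half_sq η, cos_eq_tan_half hθ,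
    cos_eq_tan_half hη]
  field_simp
  ring

theorem cos_sub_cos_tan_half {θ η : ℝ} (hθ : θ ∈ Ioo 0 Real.pi) (hη : η ∈ Ioo 0 Real.pi) :
    Real.cos η - Real.cos θ = 2 * (Real.tan (θ / 2) ^ 2 - Real.tan (η / 2) ^ 2) /
      ((1 + Real.tan (θ / 2) ^ 2) * (1 + Real.tan (η / 2) ^ 2)) := by
  rw [cos_eq_tan_half hθ, cos_eq_tan_half hη]
  field_simp
  ring

/-- M stands for the larger stereographic radius and s for the ratio of the smaller to the larger.
The hypotheses `h1` and `h2` are symmetric in the two radii, so both orders of the latitudes are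
covered at once. -/
theorem inv_norm_polarPt_sub_pow {n : ℕ} {θ η : ℝ} (hθ : θ ∈ Ioo 0 Real.pi)
    (hη : η ∈ Ioo 0 Real.pi) (ξ ζ : USphere n) {s M : ℝ} (hs : s ∈ Ioo (0 : ℝ) 1) (hM : 0 < M)
    (h1 : Real.tan (θ / 2) ^ 2 + Real.tan (η / 2) ^ 2 = M ^ 2 * (1 + s ^ 2))
    (h2 : Real.tan (θ / 2) * Real.tan (η / 2) = M ^ 2 * s) :
    (‖(polarPt θ ξ : EuclideanSpace ℝ (Fin (n + 1))) - (polarPt η ζ : EuclideanSpace ℝ (Fin (n + 1)))‖ ^ n)⁻¹ =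
      ((1 + Real.tan (θ / 2) ^ 2) * (1 + Real.tan (η / 2) ^ 2)) ^ ((n : ℝ) / 2) / (2 * M) ^ n
        / (1 - s ^ 2) * poissonK ((n : ℝ) / 2) s (dotS ξ ζ) := by
  have h := norm_polarPt_sub_sq hθ hη ξ ζ
  set N := ‖(polarPt θ ξ : EuclideanSpace ℝ (Fin (n + 1))) - (polarPt η ζ : EuclideanSpace ℝ (Fin (n + 1)))‖
  set T := (1 + Real.tan (θ / 2) ^ 2) * (1 + Real.tan (η / 2) ^ 2) with hT
  have hT0 : 0 < T := by positivity
  have hD : 0 < chordSq s (dotS ξ ζ) :=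
    chordSq_pos ⟨by linarith [hs.1], hs.2⟩ (abs_le.1 (abs_dotS_le ξ ζ))
  have hN2 : N ^ 2 = (2 * M) ^ 2 * chordSq s (dotS ξ ζ) / T := by
    rw [h]; unfold chordSq
    field_simp
    linear_combination 4 * h1 - 8 * dotS ξ ζ * h2
  have hN : N ^ n = (2 * M) ^ n * chordSq s (dotS ξ ζ) ^ ((n : ℝ) / 2) / T ^ ((n : ℝ) / 2) := by
    have hN0 : 0 ≤ N := norm_nonneg _
    have e : ∀ x : ℝ, 0 ≤ x → x ^ n = (x ^ 2) ^ ((n : ℝ) / 2) := fun x hx => by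
      rw [← Real.rpow_natCast_mul hx]; push_cast
      rw [mul_div_cancel₀ _ (two_ne_zero), Real.rpow_natCast]
    rw [e N hN0, hN2, Real.div_rpow (by positivity) hT0.le, Real.mul_rpow (by positivity) hD.le,
      ← e (2 * M) (by positivity)]
  have hs2 : 1 - s ^ 2 ≠ 0 := by nlinarith [hs.1, hs.2]
  rw [hN, poissonK, Real.rpow_neg hD.le]
  have := Real.rpow_pos_of_pos hD ((n : ℝ) / 2)
  have := Real.rpow_pos_of_pos hT0 ((n : ℝ) / 2)
  field_simp

theorem surf_real_univ {n : ℕ} (hn : 1 ≤ n) : (surf n).real univ = sphereArea n := by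
  have : Nonempty (Fin n) := ⟨⟨0, hn⟩⟩
  have hn0 : (0 : ℝ) < n := by exact_mod_cast hn
  rw [surf, Measure.toSphere_real_apply_univ, Measure.real, EuclideanSpace.volume_ball, sphereArea]
  have hG : 0 < Real.Gamma ((n : ℝ) / 2) := Real.Gamma_pos_of_pos (by positivity)
  simp only [ENNReal.ofReal_one, one_pow, one_mul, Fintype.card_fin, finrank_euclideanSpace]
  rw [ENNReal.toReal_ofReal, Real.Gamma_add_one (by positivity), Real.sqrt_eq_rpow,
    ← Real.rpow_mul_natCast Real.pi_pos.le]
  · field_simp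
  · have := Real.Gamma_pos_of_pos (s := (n : ℝ) / 2 + 1) (by positivity)
    positivity

theorem sphereArea_pos {n : ℕ} (hn : 1 ≤ n) : 0 < sphereArea n := by
  have : (0 : ℝ) < n := by exact_mod_cast hn
  have := Real.Gamma_pos_of_pos (s := (n : ℝ) / 2) (by positivity)
  have := Real.pi_pos
  unfold sphereArea; positivity

/-- The eigenvalue of `|x - y|^{-n}` on spherical harmonics of degree `j`, for latitudes with
stereographic radii `M` and `s M`, where `T = (1 + M²)(1 + s² M²)`. -/
def chordCoef (n j : ℕ) (T s M : ℝ) : ℝ :=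
  T ^ ((n : ℝ) / 2) / (2 * M) ^ n / (1 - s ^ 2) * (sphereArea n * s ^ j)

theorem integral_inv_norm_polarPt_sub_pow {n j : ℕ} (hn : 2 ≤ n) {p : MvPolynomial (Fin n) ℝ}
    (hp : p.IsHomogeneous j) (hl : polyLaplacian n p = 0) {θ η : ℝ} (hθ : θ ∈ Ioo 0 Real.pi)
    (hη : η ∈ Ioo 0 Real.pi) (ζ : USphere n) {s M : ℝ} (hs : s ∈ Ioo (0 : ℝ) 1) (hM : 0 < M)
    (h1 : Real.tan (θ / 2) ^ 2 + Real.tan (η / 2) ^ 2 = M ^ 2 * (1 + s ^ 2))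
    (h2 : Real.tan (θ / 2) * Real.tan (η / 2) = M ^ 2 * s) :
    ∫ ξ : USphere n, (‖(polarPt θ ξ : EuclideanSpace ℝ (Fin (n + 1))) - (polarPt η ζ : EuclideanSpace ℝ (Fin (n + 1)))‖ ^ n)⁻¹ * evalE p ξ ∂(surf n) =
      chordCoef n j ((1 + Real.tan (θ / 2) ^ 2) * (1 + Real.tan (η / 2) ^ 2)) s M * evalE p ζ := by
  have h := poissonInt_eq hn hp hl ζ hs
  rw [surf_real_univ (by omega), poissonInt] at h
  simp_rw [inv_norm_polarPt_sub_pow hθ hη _ ζ hs hM h1 h2, mul_assoc]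
  rw [integral_const_mul]
  rw [h, chordCoef]
  ring

/-- The kernel of `S^α_±` in polar coordinates. -/
def polarKer (n : ℕ) (α θ η : ℝ) (ξ ζ : USphere n) : ℝ :=
  |Real.cos η - Real.cos θ| ^ α *
    (‖(polarPt θ ξ : EuclideanSpace ℝ (Fin (n + 1))) - (polarPt η ζ : EuclideanSpace ℝ (Fin (n + 1)))‖ ^ n)⁻¹

/-- The eigenvalue of `polarKer` on spherical harmonics of degree `j`. -/
def polarCoef (n j : ℕ) (α θ η : ℝ) : ℝ :=
  |Real.cos η - Real.cos θ| ^ α *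
    chordCoef n j ((1 + Real.tan (θ / 2) ^ 2) * (1 + Real.tan (η / 2) ^ 2))
      (min (Real.tan (θ / 2)) (Real.tan (η / 2)) / max (Real.tan (θ / 2)) (Real.tan (η / 2)))
      (max (Real.tan (θ / 2)) (Real.tan (η / 2)))

theorem min_div_max_mem {a b : ℝ} (ha : 0 < a) (hb : 0 < b) (hab : a ≠ b) :
    min a b / max a b ∈ Ioo (0 : ℝ) 1 := by
  have hM : 0 < max a b := lt_max_of_lt_left ha
  exact ⟨div_pos (lt_min ha hb) hM, (div_lt_one hM).2 (min_lt_max.2 hab)⟩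

theorem tan_half_ne {θ η : ℝ} (hθ : θ ∈ Ioo 0 Real.pi) (hη : η ∈ Ioo 0 Real.pi) (hne : η ≠ θ) :
    Real.tan (θ / 2) ≠ Real.tan (η / 2) := by
  rcases lt_or_gt_of_ne hne with h | h
  · exact (tan_half_lt hη hθ h).ne'
  · exact (tan_half_lt hθ hη h).ne

theorem integral_polarKer {n j : ℕ} (hn : 2 ≤ n) (α : ℝ) {p : MvPolynomial (Fin n) ℝ}
    (hp : p.IsHomogeneous j) (hl : polyLaplacian n p = 0) {θ η : ℝ} (hθ : θ ∈ Ioo 0 Real.pi)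
    (hη : η ∈ Ioo 0 Real.pi) (hne : η ≠ θ) (ζ : USphere n) :
    ∫ ξ : USphere n, polarKer n α θ η ξ ζ * evalE p ξ ∂(surf n) =
      polarCoef n j α θ η * evalE p ζ := by
  have ha := tan_half_pos hθ
  have hb := tan_half_pos hη
  have hM : 0 < max (Real.tan (θ / 2)) (Real.tan (η / 2)) := lt_max_of_lt_left ha
  have h := integral_inv_norm_polarPt_sub_pow hn hp hl hθ hη ζ
    (min_div_max_mem ha hb (tan_half_ne hθ hη hne)) hM
    (by
      rcases le_total (Real.tan (θ / 2)) (Real.tan (η / 2)) with h | h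
      · rw [max_eq_right h, min_eq_left h]; field_simp; ring
      · rw [max_eq_left h, min_eq_right h]; field_simp)
    (by
      rcases le_total (Real.tan (θ / 2)) (Real.tan (η / 2)) with h | h
      · rw [max_eq_right h, min_eq_left h]; field_simp
      · rw [max_eq_left h, min_eq_right h]; field_simp)
  simp only [polarKer, polarCoef, mul_assoc]
  rw [integral_const_mul, h]

/-- `polarCoef` below the latitude `θ`, in the stereographic coordinate. -/
theorem polarCoef_eq_abelPlus {n j : ℕ} (hn : 2 ≤ n) {α : ℝ} (hα : 0 < α) {θ η : ℝ}
    (hθ : θ ∈ Ioo 0 Real.pi) (hη : η ∈ Ioo 0 Real.pi) (hlt : η < θ) :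
    2 / (Real.Gamma α * sphereArea n) * (Real.sin η ^ (n - 1) * polarCoef n j α θ η) =
      cAlpha n α (Real.tan (θ / 2)) * ((1 + Real.tan (η / 2) ^ 2) / 2 *
        ((Real.tan (θ / 2) ^ 2 - Real.tan (η / 2) ^ 2) ^ (α - 1) /
          (1 + Real.tan (η / 2) ^ 2) ^ (α + (n : ℝ) / 2) *
          ((Real.tan (η / 2) / Real.tan (θ / 2)) ^ (j + n - 2) * Real.tan (η / 2)))) := by
  obtain ⟨m, rfl⟩ : ∃ m, n = m + 2 := ⟨n - 2, by omega⟩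
  have hab := tan_half_lt hη hθ hlt
  have ha := tan_half_pos hθ
  have hb := tan_half_pos hη
  have hσ := sphereArea_pos (n := m + 2) (by omega)
  have hΓ := Real.Gamma_pos_of_pos hα
  rw [polarCoef, cos_sub_cos_tan_half hθ hη, Real.sin_eq_two_mul_tan_half_div_one_add_tan_half_sq η, max_eq_left hab.le,
    min_eq_right hab.le, chordCoef, cAlpha]
  generalize Real.tan (θ / 2) = a at *
  generalize Real.tan (η / 2) = b at *
  generalize sphereArea (m + 2) = σ at *
  generalize Real.Gamma α = Γ at *
  have hd : 0 < a ^ 2 - b ^ 2 := by nlinarith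
  have hA : 0 < 1 + a ^ 2 := by positivity
  have hB : 0 < 1 + b ^ 2 := by positivity
  -- This factor, in the denominator of the eigenvalue, lowers the power of a² - b² from α to α - 1.
  have hq : 1 - (b / a) ^ 2 = (a ^ 2 - b ^ 2) / a ^ 2 := by field_simp
  rw [hq, abs_of_pos (by positivity), Real.div_rpow (by positivity) (by positivity),
    Real.mul_rpow zero_le_two hd.le, Real.mul_rpow hA.le hB.le, Real.mul_rpow hA.le hB.le,
    Real.rpow_sub_one hd.ne', Real.rpow_sub hA, Real.rpow_add hB, Real.rpow_add_one two_ne_zero]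
  -- After denominators are cleared, (1 + b²)^(n/2) occurs twice: once from the chord and once from
  -- the weight of the Abel integrand. Their product is an integer power, which matches the
  -- denominators of sin^(n-1) η and of the Jacobian.
  have hBn : (1 + b ^ 2) ^ (((m + 2 : ℕ) : ℝ) / 2) * (1 + b ^ 2) ^ (((m + 2 : ℕ) : ℝ) / 2)
      = (1 + b ^ 2) ^ (m + 2) := by
    rw [← Real.rpow_add hB, add_halves, Real.rpow_natCast]
  have e1 : j + (m + 2) - 2 = j + m := by omega
  have e2 : m + 2 - 1 = m + 1 := by omega
  rw [e1, e2]
  have p1 := Real.rpow_pos_of_pos hd α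
  have p2 := Real.rpow_pos_of_pos hA α
  have p3 := Real.rpow_pos_of_pos hB α
  have p4 := Real.rpow_pos_of_pos hA (((m + 2 : ℕ) : ℝ) / 2)
  have p5 := Real.rpow_pos_of_pos hB (((m + 2 : ℕ) : ℝ) / 2)
  generalize (1 + b ^ 2) ^ (((m + 2 : ℕ) : ℝ) / 2) = X at *
  generalize (1 + a ^ 2) ^ (((m + 2 : ℕ) : ℝ) / 2) = Z at *
  generalize (1 + a ^ 2) ^ α = U at *
  generalize (1 + b ^ 2) ^ α = V at *
  generalize (a ^ 2 - b ^ 2) ^ α = W at *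
  rw [div_pow, div_pow, div_pow, mul_pow, mul_pow]
  field_simp
  rw [pow_two X, hBn]
  ring

/-- `polarCoef` above the latitude `θ`, in the stereographic coordinate. -/
theorem polarCoef_eq_abelMinus {n j : ℕ} (hn : 2 ≤ n) {α : ℝ} (hα : 0 < α) {θ η : ℝ}
    (hθ : θ ∈ Ioo 0 Real.pi) (hη : η ∈ Ioo 0 Real.pi) (hlt : θ < η) :
    2 / (Real.Gamma α * sphereArea n) * (Real.sin η ^ (n - 1) * polarCoef n j α θ η) =
      cAlpha n α (Real.tan (θ / 2)) * ((1 + Real.tan (η / 2) ^ 2) / 2 *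
        ((Real.tan (η / 2) ^ 2 - Real.tan (θ / 2) ^ 2) ^ (α - 1) /
          (1 + Real.tan (η / 2) ^ 2) ^ (α + (n : ℝ) / 2) *
          ((Real.tan (θ / 2) / Real.tan (η / 2)) ^ j * Real.tan (η / 2)))) := by
  obtain ⟨m, rfl⟩ : ∃ m, n = m + 2 := ⟨n - 2, by omega⟩
  have hab := tan_half_lt hθ hη hlt
  have ha := tan_half_pos hθ
  have hb := tan_half_pos hη
  have hσ := sphereArea_pos (n := m + 2) (by omega)
  have hΓ := Real.Gamma_pos_of_pos hα
  rw [polarCoef, abs_sub_comm, cos_sub_cos_tan_half hη hθ,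
    Real.sin_eq_two_mul_tan_half_div_one_add_tan_half_sq η, max_eq_right hab.le,
    min_eq_left hab.le, chordCoef, cAlpha]
  generalize Real.tan (θ / 2) = a at *
  generalize Real.tan (η / 2) = b at *
  generalize sphereArea (m + 2) = σ at *
  generalize Real.Gamma α = Γ at *
  have hd : 0 < b ^ 2 - a ^ 2 := by nlinarith
  have hA : 0 < 1 + a ^ 2 := by positivity
  have hB : 0 < 1 + b ^ 2 := by positivity
  -- Here the larger radius is b. The powers b^(n-1) from the sine, b^(-n) from the chord and b²
  -- from this factor leave a single b, so only (a/b)^j survives of the ratio, without the n - 2 of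
  -- the other case.
  have hq : 1 - (a / b) ^ 2 = (b ^ 2 - a ^ 2) / b ^ 2 := by field_simp
  rw [hq, abs_of_pos (by positivity), Real.div_rpow (by positivity) (by positivity),
    Real.mul_rpow zero_le_two hd.le, Real.mul_rpow hB.le hA.le, Real.mul_rpow hA.le hB.le,
    Real.rpow_sub_one hd.ne', Real.rpow_sub hA, Real.rpow_add hB, Real.rpow_add_one two_ne_zero]
  have hBn : (1 + b ^ 2) ^ (((m + 2 : ℕ) : ℝ) / 2) * (1 + b ^ 2) ^ (((m + 2 : ℕ) : ℝ) / 2)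
      = (1 + b ^ 2) ^ (m + 2) := by
    rw [← Real.rpow_add hB, add_halves, Real.rpow_natCast]
  have e2 : m + 2 - 1 = m + 1 := by omega
  rw [e2]
  have p1 := Real.rpow_pos_of_pos hd α
  have p2 := Real.rpow_pos_of_pos hA α
  have p3 := Real.rpow_pos_of_pos hB α
  have p4 := Real.rpow_pos_of_pos hA (((m + 2 : ℕ) : ℝ) / 2)
  have p5 := Real.rpow_pos_of_pos hB (((m + 2 : ℕ) : ℝ) / 2)
  generalize (1 + b ^ 2) ^ (((m + 2 : ℕ) : ℝ) / 2) = X at *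
  generalize (1 + a ^ 2) ^ (((m + 2 : ℕ) : ℝ) / 2) = Z at *
  generalize (1 + a ^ 2) ^ α = U at *
  generalize (1 + b ^ 2) ^ α = V at *
  generalize (b ^ 2 - a ^ 2) ^ α = W at *
  rw [div_pow, div_pow, mul_pow, mul_pow]
  field_simp
  rw [pow_two X, hBn]
  ring

/-! ### Spherical segments as products, and Fubini for zonal operators. -/

theorem ae_polarMeas_mem (n : ℕ) : ∀ᵐ η ∂(polarMeas n), η ∈ Ioo 0 Real.pi :=
  (withDensity_absolutelyContinuous _ _).ae_le (ae_restrict_mem measurableSet_Ioo)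

theorem surf_restrict_eq_map {n : ℕ} (hn : 1 ≤ n) {A : Set ℝ} {B : Set (USphere (n + 1))} (hB : MeasurableSet B)
    (h : ∀ η ∈ Ioo 0 Real.pi, ∀ ζ : USphere n, polarPt η ζ ∈ B ↔ η ∈ A) :
    (surf (n + 1)).restrict B =
      (((polarMeas n).restrict A).prod (surf n)).map (fun p => polarPt p.1 p.2) := by
  rw [surf_eq_map_polarPt hn, Measure.restrict_map continuous_polarPt.measurable hB]
  congr 1
  have h1 : ((polarMeas n).restrict A).prod (surf n) =
      ((polarMeas n).prod (surf n)).restrict (A ×ˢ univ) := by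
    rw [← Measure.prod_restrict, Measure.restrict_univ]
  rw [h1]
  apply Measure.restrict_congr_set
  have := Measure.quasiMeasurePreserving_fst (μ := polarMeas n) (ν := surf n) |>.ae
    (ae_polarMeas_mem n)
  filter_upwards [this] with p hp
  apply propext
  change polarPt p.1 p.2 ∈ B ↔ p ∈ A ×ˢ univ
  rw [h p.1 hp p.2]
  simp

theorem continuous_lastCoord {n : ℕ} : Continuous (lastCoord : USphere (n + 1) → ℝ) := by
  unfold lastCoord; fun_prop

theorem measurableSet_segment_S (n : ℕ) (a b : ℝ) : MeasurableSet (segment_S n a b) :=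
  (measurableSet_lt measurable_const continuous_lastCoord.measurable).inter
    (measurableSet_lt continuous_lastCoord.measurable measurable_const)

theorem cos_lt_cos_iff_of_mem {η θ : ℝ} (hη : η ∈ Ioo 0 Real.pi) (hθ : θ ∈ Ioo 0 Real.pi) :
    Real.cos θ < Real.cos η ↔ η < θ :=
  Real.strictAntiOn_cos.lt_iff_gt (Ioo_subset_Icc_self hθ) (Ioo_subset_Icc_self hη)

theorem surf_restrict_below {n : ℕ} (hn : 1 ≤ n) {θ : ℝ} (hθ : θ ∈ Ioo 0 Real.pi) :
    (surf (n + 1)).restrict (segment_S n (-1) (-Real.cos θ)) =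
      (((polarMeas n).restrict (Ioo 0 θ)).prod (surf n)).map (fun p => polarPt p.1 p.2) := by
  refine surf_restrict_eq_map hn (measurableSet_segment_S _ _ _) fun η hη ζ => ?_
  have h1 : Real.cos η < 1 := by
    have := Real.strictAntiOn_cos (left_mem_Icc.2 Real.pi_pos.le) (Ioo_subset_Icc_self hη) hη.1
    simpa using this
  simp only [segment_S, mem_ofPred_eq, lastCoord_polarPt, mem_Ioo, neg_lt_neg_iff, h1, hη.1,
    cos_lt_cos_iff_of_mem hη hθ]

theorem surf_restrict_above {n : ℕ} (hn : 1 ≤ n) {θ : ℝ} (hθ : θ ∈ Ioo 0 Real.pi) :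
    (surf (n + 1)).restrict (segment_S n (-Real.cos θ) 1) =
      (((polarMeas n).restrict (Ioo θ Real.pi)).prod (surf n)).map (fun p => polarPt p.1 p.2) := by
  refine surf_restrict_eq_map hn (measurableSet_segment_S _ _ _) fun η hη ζ => ?_
  have h1 : -Real.cos η < 1 := by
    have := Real.strictAntiOn_cos (Ioo_subset_Icc_self hη) (right_mem_Icc.2 Real.pi_pos.le) hη.2
    rw [Real.cos_pi] at this
    linarith
  simp only [segment_S, mem_ofPred_eq, lastCoord_polarPt, mem_Ioo, neg_lt_neg_iff, h1, hη.2,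
    cos_lt_cos_iff_of_mem hθ hη]

section Fubini

variable {n : ℕ} {A : Set ℝ} {B : Set (USphere (n + 1))} {K : USphere n → USphere (n + 1) → ℝ}
  {ψ : USphere (n + 1) → ℂ}

/-- By Tonelli, the finiteness hypothesis of (ii) is absolute integrability over S^{n-1} × (η-range
× S^{n-1}), which justifies the interchange of integrals in the diagonalisation. -/
theorem integrable_polar_prod
    (hres : (surf (n + 1)).restrict B =
      (((polarMeas n).restrict A).prod (surf n)).map (fun p => polarPt p.1 p.2))
    (hK : Measurable fun q : USphere n × USphere (n + 1) => K q.1 q.2) (hψ : Measurable ψ)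
    (hfin : ∫⁻ ξ : USphere n, (∫⁻ y in B, ‖(K ξ y : ℂ) * ψ y‖ₑ ∂(surf (n + 1))) ∂(surf n) < ⊤) :
    Integrable (fun q : USphere n × (ℝ × USphere n) =>
      (K q.1 (polarPt q.2.1 q.2.2) : ℂ) * ψ (polarPt q.2.1 q.2.2))
      ((surf n).prod (((polarMeas n).restrict A).prod (surf n))) := by
  have hpm : Measurable fun p : ℝ × USphere n => polarPt p.1 p.2 := continuous_polarPt.measurable
  have hKψ : Measurable fun q : USphere n × USphere (n + 1) => (K q.1 q.2 : ℂ) * ψ q.2 :=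
    (Complex.measurable_ofReal.comp hK).mul (hψ.comp measurable_snd)
  have hm : Measurable fun q : USphere n × (ℝ × USphere n) =>
      (K q.1 (polarPt q.2.1 q.2.2) : ℂ) * ψ (polarPt q.2.1 q.2.2) :=
    hKψ.comp (measurable_fst.prodMk (hpm.comp measurable_snd))
  refine ⟨hm.aestronglyMeasurable, ?_⟩
  rw [HasFiniteIntegral, lintegral_prod _ hm.enorm.aemeasurable]
  convert! hfin using 1
  refine lintegral_congr fun ξ => ?_
  have hξ : Measurable fun y => ‖(K ξ y : ℂ) * ψ y‖ₑ :=
    (hKψ.comp (measurable_const.prodMk measurable_id)).enorm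
  rw [hres, lintegral_map hξ hpm]

theorem setIntegral_eq_integral_polar
    (hres : (surf (n + 1)).restrict B =
      (((polarMeas n).restrict A).prod (surf n)).map (fun p => polarPt p.1 p.2))
    {f : USphere (n + 1) → ℂ} (hf : Measurable f) :
    ∫ y in B, f y ∂(surf (n + 1)) =
      ∫ p, f (polarPt p.1 p.2) ∂(((polarMeas n).restrict A).prod (surf n)) := by
  rw [hres, integral_map continuous_polarPt.measurable.aemeasurable hf.aestronglyMeasurable]

theorem integrable_zonal_operator
    (hres : (surf (n + 1)).restrict B =
      (((polarMeas n).restrict A).prod (surf n)).map (fun p => polarPt p.1 p.2))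
    (hK : Measurable fun q : USphere n × USphere (n + 1) => K q.1 q.2) (hψ : Measurable ψ)
    (hfin : ∫⁻ ξ : USphere n, (∫⁻ y in B, ‖(K ξ y : ℂ) * ψ y‖ₑ ∂(surf (n + 1))) ∂(surf n) < ⊤) :
    Integrable (fun ξ : USphere n => ∫ y in B, (K ξ y : ℂ) * ψ y ∂(surf (n + 1))) (surf n) := by
  refine (integrable_polar_prod hres hK hψ hfin).integral_prod_left.congr (.of_forall fun ξ => ?_)
  beta_reduce
  rw [setIntegral_eq_integral_polar hres]
  exact (Complex.measurable_ofReal.comp (hK.comp (measurable_const.prodMk measurable_id))).mul hψ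

/-- A zonal operator acts diagonally on the Fourier-Laplace coefficients. -/
theorem integral_zonal_operator_mul
    (hres : (surf (n + 1)).restrict B =
      (((polarMeas n).restrict A).prod (surf n)).map (fun p => polarPt p.1 p.2))
    (hK : Measurable fun q : USphere n × USphere (n + 1) => K q.1 q.2) (hψ : Measurable ψ)
    (hfin : ∫⁻ ξ : USphere n, (∫⁻ y in B, ‖(K ξ y : ℂ) * ψ y‖ₑ ∂(surf (n + 1))) ∂(surf n) < ⊤)
    {Y : USphere n → ℝ} (hY : Continuous Y) {κ : ℝ → ℝ}
    (hκ : ∀ᵐ η ∂((polarMeas n).restrict A), ∀ ζ,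
      ∫ ξ, K ξ (polarPt η ζ) * Y ξ ∂(surf n) = κ η * Y ζ) :
    Integrable (fun η => (κ η : ℂ) * ∫ ζ, ψ (polarPt η ζ) * (Y ζ : ℂ) ∂(surf n))
      ((polarMeas n).restrict A) ∧
    ∫ ξ, (∫ y in B, (K ξ y : ℂ) * ψ y ∂(surf (n + 1))) * (Y ξ : ℂ) ∂(surf n) =
      ∫ η, (κ η : ℂ) * ∫ ζ, ψ (polarPt η ζ) * (Y ζ : ℂ) ∂(surf n) ∂((polarMeas n).restrict A) := by
  set m := (polarMeas n).restrict A with hm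
  have hF := integrable_polar_prod hres hK hψ hfin
  obtain ⟨C, hC⟩ := isCompact_univ.exists_bound_of_continuousOn hY.continuousOn
  have hYm : Measurable fun ξ : USphere n => (Y ξ : ℂ) := Complex.measurable_ofReal.comp hY.measurable
  have hG : Integrable (fun q : USphere n × (ℝ × USphere n) =>
      (K q.1 (polarPt q.2.1 q.2.2) : ℂ) * ψ (polarPt q.2.1 q.2.2) * (Y q.1 : ℂ))
      ((surf n).prod (m.prod (surf n))) := by
    refine (hF.norm.mul_const C).mono'
      (hF.aestronglyMeasurable.mul (hYm.comp measurable_fst).aestronglyMeasurable)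
      (.of_forall fun q => ?_)
    rw [norm_mul, Complex.norm_real]
    exact mul_le_mul_of_nonneg_left (hC _ (mem_univ _)) (norm_nonneg _)
  have hae : (fun p : ℝ × USphere n => ∫ ξ, (K ξ (polarPt p.1 p.2) : ℂ) * ψ (polarPt p.1 p.2) *
      (Y ξ : ℂ) ∂(surf n)) =ᵐ[m.prod (surf n)]
      fun p => (κ p.1 : ℂ) * (ψ (polarPt p.1 p.2) * (Y p.2 : ℂ)) := by
    have := (Measure.quasiMeasurePreserving_fst (μ := m) (ν := surf n)).ae hκ
    filter_upwards [this] with p hp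
    have h1 := congrArg (fun x : ℝ => ψ (polarPt p.1 p.2) * (x : ℂ)) (hp p.2)
    beta_reduce at h1
    rw [← integral_complex_ofReal, ← integral_const_mul] at h1
    push_cast at h1
    convert! h1 using 1
    · congr 1; ext ξ; ring
    · ring
  -- Integrating out ξ preserves integrability, so the absolute convergence of the η-integral needs
  -- no estimate of its own.
  have hH : Integrable (fun p : ℝ × USphere n =>
      (κ p.1 : ℂ) * (ψ (polarPt p.1 p.2) * (Y p.2 : ℂ))) (m.prod (surf n)) :=
    hG.integral_prod_right.congr hae
  constructor
  · refine hH.integral_prod_left.congr (.of_forall fun η => ?_)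
    beta_reduce
    rw [← integral_const_mul]
  · calc _ = ∫ ξ, ∫ p : ℝ × USphere n, (K ξ (polarPt p.1 p.2) : ℂ) * ψ (polarPt p.1 p.2) * (Y ξ : ℂ)
          ∂(m.prod (surf n)) ∂(surf n) := by
          congr 1; ext ξ
          rw [setIntegral_eq_integral_polar hres, integral_mul_const]
          exact (Complex.measurable_ofReal.comp
            (hK.comp (measurable_const.prodMk measurable_id))).mul hψ
      _ = ∫ p : ℝ × USphere n, ∫ ξ, (K ξ (polarPt p.1 p.2) : ℂ) * ψ (polarPt p.1 p.2) * (Y ξ : ℂ)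
          ∂(surf n) ∂(m.prod (surf n)) := integral_integral_swap hG
      _ = ∫ p : ℝ × USphere n, (κ p.1 : ℂ) * (ψ (polarPt p.1 p.2) * (Y p.2 : ℂ)) ∂(m.prod (surf n)) :=
          integral_congr_ae hae
      _ = _ := by
          rw [integral_prod _ hH]
          simp_rw [integral_const_mul]

end Fubini

/-! ### The substitution ρ = tan(η/2) and the expansion at a single angle. -/

theorem polarMeas_restrict {n : ℕ} {A : Set ℝ} (hA : MeasurableSet A) (hsub : A ⊆ Ioo 0 Real.pi) :
    (polarMeas n).restrict A =
      (volume.restrict A).withDensity fun η => ENNReal.ofReal (Real.sin η ^ (n - 1)) := by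
  rw [polarMeas, restrict_withDensity hA, Measure.restrict_restrict hA, inter_eq_left.2 hsub]

theorem integrable_polarMeas_restrict_iff {n : ℕ} {A : Set ℝ} (hA : MeasurableSet A)
    (hsub : A ⊆ Ioo 0 Real.pi) {f : ℝ → ℂ} :
    Integrable f ((polarMeas n).restrict A) ↔
      IntegrableOn (fun η => ((Real.sin η ^ (n - 1) : ℝ) : ℂ) * f η) A := by
  rw [polarMeas_restrict hA hsub, integrable_withDensity_iff_integrable_smul' (by fun_prop)
    (.of_forall fun _ => ENNReal.ofReal_lt_top), IntegrableOn]
  refine integrable_congr ?_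
  filter_upwards [ae_restrict_mem hA] with η hη
  rw [ENNReal.toReal_ofReal (pow_nonneg (Real.sin_pos_of_mem_Ioo (hsub hη)).le _),
    Complex.real_smul]

theorem integral_polarMeas_restrict {n : ℕ} {A : Set ℝ} (hA : MeasurableSet A)
    (hsub : A ⊆ Ioo 0 Real.pi) (f : ℝ → ℂ) :
    ∫ η, f η ∂((polarMeas n).restrict A) = ∫ η in A, ((Real.sin η ^ (n - 1) : ℝ) : ℂ) * f η := by
  rw [polarMeas_restrict hA hsub, integral_withDensity_eq_integral_toReal_smul (by fun_prop)
    (.of_forall fun _ => ENNReal.ofReal_lt_top)]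
  refine integral_congr_ae ?_
  filter_upwards [ae_restrict_mem hA] with η hη
  rw [ENNReal.toReal_ofReal (pow_nonneg (Real.sin_pos_of_mem_Ioo (hsub hη)).le _),
    Complex.real_smul]

theorem hasDerivAt_tan_half {η : ℝ} (hη : η ∈ Ioo 0 Real.pi) :
    HasDerivAt (fun η : ℝ => Real.tan (η / 2)) ((1 + Real.tan (η / 2) ^ 2) / 2) η := by
  have hc : Real.cos (η / 2) ≠ 0 :=
    (Real.cos_pos_of_mem_Ioo ⟨by linarith [hη.1, Real.pi_pos], by linarith [hη.2]⟩).ne'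
  have := (Real.hasDerivAt_tan hc).comp η ((hasDerivAt_id η).div_const 2)
  convert! this using 1
  rw [← Real.inv_one_add_tan_sq hc]
  simp
  ring

theorem tan_half_injOn : InjOn (fun η : ℝ => Real.tan (η / 2)) (Ioo 0 Real.pi) :=
  StrictMonoOn.injOn fun _ hη _ hθ h => tan_half_lt hη hθ h

theorem two_arctan_mem {b : ℝ} (hb : 0 < b) : 2 * Real.arctan b ∈ Ioo 0 Real.pi :=
  ⟨by have := Real.arctan_pos.2 hb; positivity, by linarith [Real.arctan_lt_pi_div_two b]⟩

theorem tan_half_two_arctan (b : ℝ) : Real.tan (2 * Real.arctan b / 2) = b := by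
  rw [mul_div_cancel_left₀ _ two_ne_zero, Real.tan_arctan]

theorem tan_half_lt_iff {θ η : ℝ} (hη : η ∈ Ioo 0 Real.pi) (hθ : θ ∈ Ioo 0 Real.pi) :
    Real.tan (η / 2) < Real.tan (θ / 2) ↔ η < θ :=
  StrictMonoOn.lt_iff_lt (f := fun η : ℝ => Real.tan (η / 2)) (s := Ioo 0 Real.pi)
    (fun _ hη _ hθ h => tan_half_lt hη hθ h) hη hθ

theorem image_tan_half_below {θ : ℝ} (hθ : θ ∈ Ioo 0 Real.pi) :
    (fun η : ℝ => Real.tan (η / 2)) '' Ioo 0 θ = Ioo 0 (Real.tan (θ / 2)) := by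
  ext b
  constructor
  · rintro ⟨η, hη, rfl⟩
    have hη' : η ∈ Ioo 0 Real.pi := ⟨hη.1, hη.2.trans hθ.2⟩
    exact ⟨tan_half_pos hη', (tan_half_lt_iff hη' hθ).2 hη.2⟩
  · intro hb
    have h := two_arctan_mem hb.1
    refine ⟨2 * Real.arctan b, ⟨h.1, (tan_half_lt_iff h hθ).1 ?_⟩, tan_half_two_arctan b⟩
    rw [tan_half_two_arctan]; exact hb.2

theorem image_tan_half_above {θ : ℝ} (hθ : θ ∈ Ioo 0 Real.pi) :
    (fun η : ℝ => Real.tan (η / 2)) '' Ioo θ Real.pi = Ioi (Real.tan (θ / 2)) := by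
  ext b
  constructor
  · rintro ⟨η, hη, rfl⟩
    exact (tan_half_lt_iff hθ ⟨hθ.1.trans hη.1, hη.2⟩).2 hη.1
  · intro hb
    have h := two_arctan_mem ((tan_half_pos hθ).trans hb)
    refine ⟨2 * Real.arctan b, ⟨(tan_half_lt_iff hθ h).1 ?_, h.2⟩, tan_half_two_arctan b⟩
    rw [tan_half_two_arctan]; exact hb

theorem integrableOn_image_tan_half {A : Set ℝ} (hA : MeasurableSet A) (hsub : A ⊆ Ioo 0 Real.pi)
    {g : ℝ → ℂ} : IntegrableOn g ((fun η : ℝ => Real.tan (η / 2)) '' A) ↔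
      IntegrableOn (fun η => (((1 + Real.tan (η / 2) ^ 2) / 2 : ℝ) : ℂ) * g (Real.tan (η / 2))) A := by
  rw [integrableOn_image_iff_integrableOn_abs_deriv_smul hA
    (fun η hη => (hasDerivAt_tan_half (hsub hη)).hasDerivWithinAt) (tan_half_injOn.mono hsub)]
  refine integrableOn_congr_fun (fun η _ => ?_) hA
  rw [abs_of_pos (by positivity), Complex.real_smul]

theorem integral_image_tan_half {A : Set ℝ} (hA : MeasurableSet A) (hsub : A ⊆ Ioo 0 Real.pi)
    (g : ℝ → ℂ) : ∫ b in (fun η : ℝ => Real.tan (η / 2)) '' A, g b =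
      ∫ η in A, (((1 + Real.tan (η / 2) ^ 2) / 2 : ℝ) : ℂ) * g (Real.tan (η / 2)) := by
  rw [integral_image_eq_integral_abs_deriv_smul hA
    (fun η hη => (hasDerivAt_tan_half (hsub hη)).hasDerivWithinAt) (tan_half_injOn.mono hsub)]
  refine setIntegral_congr_fun hA (fun η _ => ?_)
  rw [abs_of_pos (by positivity), Complex.real_smul]

theorem kerLeft_polarPt {n : ℕ} {α θ η : ℝ} (hθ : θ ∈ Ioo 0 Real.pi) (hη : η ∈ Ioo 0 θ)
    (ξ ζ : USphere n) : kerLeft n α (polarPt θ ξ) (polarPt η ζ) = polarKer n α θ η ξ ζ := by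
  have h := (cos_lt_cos_iff_of_mem ⟨hη.1, hη.2.trans hθ.2⟩ hθ).2 hη.2
  rw [kerLeft, polarKer, lastCoord_polarPt, lastCoord_polarPt, abs_of_pos (by linarith),
    div_eq_mul_inv]
  congr 2; ring

theorem kerRight_polarPt {n : ℕ} {α θ η : ℝ} (hθ : θ ∈ Ioo 0 Real.pi) (hη : η ∈ Ioo θ Real.pi)
    (ξ ζ : USphere n) : kerRight n α (polarPt θ ξ) (polarPt η ζ) = polarKer n α θ η ξ ζ := by
  have h := (cos_lt_cos_iff_of_mem hθ ⟨hθ.1.trans hη.1, hη.2⟩).2 hη.1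
  rw [kerRight, polarKer, lastCoord_polarPt, lastCoord_polarPt, abs_of_neg (by linarith),
    div_eq_mul_inv]
  congr 2; ring

theorem measurable_kerLeft {n : ℕ} (α θ : ℝ) :
    Measurable fun q : USphere n × USphere (n + 1) => kerLeft n α (polarPt θ q.1) q.2 := by
  have h1 : Measurable fun q : USphere n × USphere (n + 1) => polarPt θ q.1 :=
    (continuous_polarPt.comp (f := fun q : USphere n × USphere (n + 1) => (θ, q.1))
      (by fun_prop)).measurable
  have h2 := (continuous_lastCoord (n := n)).measurable
  unfold kerLeft
  exact (((h2.comp h1).sub (h2.comp measurable_snd)).pow_const α).div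
    (((measurable_subtype_coe.comp h1).sub (measurable_subtype_coe.comp measurable_snd)).norm.pow_const n)

theorem measurable_kerRight {n : ℕ} (α θ : ℝ) :
    Measurable fun q : USphere n × USphere (n + 1) => kerRight n α (polarPt θ q.1) q.2 := by
  have h1 : Measurable fun q : USphere n × USphere (n + 1) => polarPt θ q.1 :=
    (continuous_polarPt.comp (f := fun q : USphere n × USphere (n + 1) => (θ, q.1))
      (by fun_prop)).measurable
  have h2 := (continuous_lastCoord (n := n)).measurable
  unfold kerRight
  exact (((h2.comp measurable_snd).sub (h2.comp h1)).pow_const α).div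
    (((measurable_subtype_coe.comp h1).sub (measurable_subtype_coe.comp measurable_snd)).norm.pow_const n)

theorem exists_harmonic_of_mem_sphHarm {n j : ℕ} {Y : USphere n → ℝ} (hY : Y ∈ sphHarm n j) :
    ∃ p : MvPolynomial (Fin n) ℝ, p.IsHomogeneous j ∧ polyLaplacian n p = 0 ∧
      ∀ ξ : USphere n, Y ξ = evalE p ξ := by
  obtain ⟨p, hp, rfl⟩ := hY
  exact ⟨p, (MvPolynomial.mem_homogeneousSubmodule _ _).1 hp.1, hp.2, fun _ => rfl⟩

/-- The diagonal form of a zonal operator with kernel `polarKer`, in stereographic coordinates. -/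
theorem expansion_of_finite {n : ℕ} (hn : 2 ≤ n) {α θ : ℝ} (hθ : θ ∈ Ioo 0 Real.pi)
    {A : Set ℝ} (hA : MeasurableSet A) (hsub : A ⊆ Ioo 0 Real.pi) (hθA : θ ∉ A)
    {B : Set (USphere (n + 1))} {K : USphere n → USphere (n + 1) → ℝ} {ψ : USphere (n + 1) → ℂ}
    (hres : (surf (n + 1)).restrict B =
      (((polarMeas n).restrict A).prod (surf n)).map (fun p => polarPt p.1 p.2))
    (hK : Measurable fun q : USphere n × USphere (n + 1) => K q.1 q.2) (hψ : Measurable ψ)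
    (hfin : ∫⁻ ξ : USphere n, (∫⁻ y in B, ‖(K ξ y : ℂ) * ψ y‖ₑ ∂(surf (n + 1))) ∂(surf n) < ⊤)
    (hKer : ∀ η ∈ A, ∀ ξ ζ, K ξ (polarPt η ζ) = polarKer n α θ η ξ ζ)
    {C c : ℝ} (hc : c ≠ 0) {w : ℕ → ℝ → ℝ}
    (hw : ∀ j, ∀ η ∈ A, C * (Real.sin η ^ (n - 1) * polarCoef n j α θ η) =
      c * ((1 + Real.tan (η / 2) ^ 2) / 2 * w j (Real.tan (η / 2))))
    {Y : (j : ℕ) → Fin (sphHarmDim n j) → USphere n → ℝ} (hY : IsSphHarmBasis n Y)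
    {u : (j : ℕ) → Fin (sphHarmDim n j) → ℝ → ℂ}
    (hu : ∀ᵐ θ ∂(volume.restrict (Ioo 0 Real.pi)),
      IsFourierLaplace n Y (fun ξ => ψ (polarPt θ ξ)) (fun j k => u j k (Real.tan (θ / 2)))) :
    (∀ j k, IntegrableOn (fun b => (w j b : ℂ) * u j k b) ((fun η : ℝ => Real.tan (η / 2)) '' A)) ∧
    IsFourierLaplace n Y (fun ξ => (C : ℂ) * ∫ y in B, (K ξ y : ℂ) * ψ y ∂(surf (n + 1)))
      (fun j k => (c : ℂ) * ∫ b in (fun η : ℝ => Real.tan (η / 2)) '' A, (w j b : ℂ) * u j k b) := by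
  have huA := ae_restrict_of_ae_restrict_of_subset hsub hu
  have hc' : (c : ℂ) ≠ 0 := Complex.ofReal_ne_zero.2 hc
  have key : ∀ j k,
      IntegrableOn (fun b => (w j b : ℂ) * u j k b) ((fun η : ℝ => Real.tan (η / 2)) '' A) ∧
      (c : ℂ) * ∫ b in (fun η : ℝ => Real.tan (η / 2)) '' A, (w j b : ℂ) * u j k b =
        ∫ ξ, ((C : ℂ) * ∫ y in B, (K ξ y : ℂ) * ψ y ∂(surf (n + 1))) * (Y j k ξ : ℂ) ∂(surf n) := by
    intro j k
    obtain ⟨p, hp, hl, hYp⟩ := exists_harmonic_of_mem_sphHarm (hY.mem j k)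
    have hYc : Continuous (Y j k) := by
      rw [funext hYp]; exact continuous_evalE_sphere p
    obtain ⟨h1, h2⟩ := integral_zonal_operator_mul hres hK hψ hfin hYc
      (κ := fun η => polarCoef n j α θ η) (by
        filter_upwards [ae_restrict_mem hA] with η hη ζ
        simp_rw [hKer η hη, hYp]
        exact integral_polarKer hn α hp hl hθ (hsub hη) (fun h => hθA (h ▸ hη)) ζ)
    rw [integrable_polarMeas_restrict_iff hA hsub] at h1
    rw [integral_polarMeas_restrict hA hsub] at h2
    -- For almost every η the integral over the parallel is the given coefficient at tan(η/2), and
    -- `hw` converts the eigenvalue and the density sin^(n-1) η into the Abel weight times the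
    -- Jacobian.
    have hae : (fun η => (C : ℂ) * (((Real.sin η ^ (n - 1) : ℝ) : ℂ) *
        ((polarCoef n j α θ η : ℂ) * ∫ ζ, ψ (polarPt η ζ) * (Y j k ζ : ℂ) ∂(surf n))))
        =ᵐ[volume.restrict A] fun η => (c : ℂ) * ((((1 + Real.tan (η / 2) ^ 2) / 2 : ℝ) : ℂ) *
          ((w j (Real.tan (η / 2)) : ℂ) * u j k (Real.tan (η / 2)))) := by
      filter_upwards [ae_restrict_mem hA, huA] with η hη hη'
      rw [← hη'.2 j k]
      have := congrArg (fun x : ℝ => (x : ℂ)) (hw j η hη)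
      simp only [Complex.ofReal_mul] at this
      linear_combination u j k (Real.tan (η / 2)) * this
    constructor
    · rw [integrableOn_image_tan_half hA hsub]
      -- Convergence is wanted for the integral without its prefactor, so the nonzero c is divided
      -- out.
      have h3 := ((h1.const_mul (C : ℂ)).congr hae).const_mul (c : ℂ)⁻¹
      refine h3.congr (.of_forall fun η => ?_)
      beta_reduce
      rw [← mul_assoc, inv_mul_cancel₀ hc', one_mul]
    · rw [integral_image_tan_half hA hsub, ← integral_const_mul, ← integral_congr_ae hae,
        integral_const_mul, ← h2, ← integral_const_mul]
      simp_rw [mul_assoc]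
  exact ⟨fun j k => (key j k).1, (integrable_zonal_operator hres hK hψ hfin).const_mul _,
    fun j k => (key j k).2⟩

theorem cAlpha_ne_zero {n : ℕ} {α : ℝ} (hα : 0 < α) (r : ℝ) : cAlpha n α r ≠ 0 := by
  have := Real.Gamma_pos_of_pos hα
  unfold cAlpha
  positivity

theorem plusExpansionAt_of_finite {n : ℕ} (hn : 2 ≤ n) {α : ℝ} (hα : 0 < α)
    {Y : (j : ℕ) → Fin (sphHarmDim n j) → USphere n → ℝ} (hY : IsSphHarmBasis n Y)
    {ψ : USphere (n + 1) → ℂ} (hψ : Measurable ψ)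
    {u : (j : ℕ) → Fin (sphHarmDim n j) → ℝ → ℂ}
    (hu : ∀ᵐ θ ∂(volume.restrict (Ioo 0 Real.pi)),
      IsFourierLaplace n Y (fun ξ => ψ (polarPt θ ξ)) (fun j k => u j k (Real.tan (θ / 2))))
    {θ : ℝ} (hθ : θ ∈ Ioo 0 Real.pi) (hfin : SPlusFiniteAt n α ψ θ) :
    PlusExpansionAt n α Y ψ u θ := by
  simp only [SPlusFiniteAt, lastCoord_polarPt] at hfin
  have h := expansion_of_finite hn hθ measurableSet_Ioo
    (fun η hη => ⟨hη.1, hη.2.trans hθ.2⟩) (fun h => lt_irrefl _ h.2)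
    (surf_restrict_below (by omega) hθ) (measurable_kerLeft α θ) hψ hfin
    (fun η hη => kerLeft_polarPt hθ hη) (cAlpha_ne_zero (n := n) hα (Real.tan (θ / 2)))
    (fun j η hη => polarCoef_eq_abelPlus hn hα hθ ⟨hη.1, hη.2.trans hθ.2⟩ hη.2) hY hu
    (w := fun j b => (Real.tan (θ / 2) ^ 2 - b ^ 2) ^ (α - 1) / (1 + b ^ 2) ^ (α + (n : ℝ) / 2) *
      ((b / Real.tan (θ / 2)) ^ (j + n - 2) * b))
  rw [image_tan_half_below hθ] at h
  have e : ∀ j (v : ℝ → ℂ), abelPlusIntegrand n α j v (Real.tan (θ / 2)) = fun b =>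
      (((Real.tan (θ / 2) ^ 2 - b ^ 2) ^ (α - 1) / (1 + b ^ 2) ^ (α + (n : ℝ) / 2) *
        ((b / Real.tan (θ / 2)) ^ (j + n - 2) * b) : ℝ) : ℂ) * v b := by
    intro j v; ext b
    simp only [abelPlusIntegrand, Complex.ofReal_mul, Complex.ofReal_div]
    ring
  simp only [PlusExpansionAt, abelPlus, SPlus, sphFracLeft, lastCoord_polarPt, e]
  exact h

theorem minusExpansionAt_of_finite {n : ℕ} (hn : 2 ≤ n) {α : ℝ} (hα : 0 < α)
    {Y : (j : ℕ) → Fin (sphHarmDim n j) → USphere n → ℝ} (hY : IsSphHarmBasis n Y)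
    {ψ : USphere (n + 1) → ℂ} (hψ : Measurable ψ)
    {u : (j : ℕ) → Fin (sphHarmDim n j) → ℝ → ℂ}
    (hu : ∀ᵐ θ ∂(volume.restrict (Ioo 0 Real.pi)),
      IsFourierLaplace n Y (fun ξ => ψ (polarPt θ ξ)) (fun j k => u j k (Real.tan (θ / 2))))
    {θ : ℝ} (hθ : θ ∈ Ioo 0 Real.pi) (hfin : SMinusFiniteAt n α ψ θ) :
    MinusExpansionAt n α Y ψ u θ := by
  simp only [SMinusFiniteAt, lastCoord_polarPt] at hfin
  have h := expansion_of_finite hn hθ measurableSet_Ioo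
    (fun η hη => ⟨hθ.1.trans hη.1, hη.2⟩) (fun h => lt_irrefl _ h.1)
    (surf_restrict_above (by omega) hθ) (measurable_kerRight α θ) hψ hfin
    (fun η hη => kerRight_polarPt hθ hη) (cAlpha_ne_zero (n := n) hα (Real.tan (θ / 2)))
    (fun j η hη => polarCoef_eq_abelMinus hn hα hθ ⟨hθ.1.trans hη.1, hη.2⟩ hη.1) hY hu
    (w := fun j b => (b ^ 2 - Real.tan (θ / 2) ^ 2) ^ (α - 1) / (1 + b ^ 2) ^ (α + (n : ℝ) / 2) *
      ((Real.tan (θ / 2) / b) ^ j * b))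
  rw [image_tan_half_above hθ] at h
  have e : ∀ j (v : ℝ → ℂ), abelMinusIntegrand n α j v (Real.tan (θ / 2)) = fun b =>
      (((b ^ 2 - Real.tan (θ / 2) ^ 2) ^ (α - 1) / (1 + b ^ 2) ^ (α + (n : ℝ) / 2) *
        ((Real.tan (θ / 2) / b) ^ j * b) : ℝ) : ℂ) * v b := by
    intro j v; ext b
    simp only [abelMinusIntegrand, Complex.ofReal_mul, Complex.ofReal_div]
    ring
  simp only [MinusExpansionAt, abelMinus, SMinus, sphFracRight, lastCoord_polarPt, e]
  exact h

/-! ### Abel integrals of a measure: finiteness for the exponent α implies it for α - 1 almost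
everywhere. -/

/-- The substitution v = cos η - cos θ, with dv = sin θ dθ and 0 < v ≤ 2; the bound is uniform in η.
-/
theorem lintegral_abel_kernel_le {α η Θ : ℝ} (hη : 0 ≤ η) (hΘ : Θ ≤ Real.pi) :
    ∫⁻ θ in Ioo η Θ, ENNReal.ofReal (Real.sin θ) *
      ENNReal.ofReal (|Real.cos η - Real.cos θ| ^ (α - 1)) ≤
      ∫⁻ v in Ioc (0 : ℝ) 2, ENNReal.ofReal (v ^ (α - 1)) := by
  have hsub : Ioo η Θ ⊆ Icc 0 Real.pi := fun x hx => ⟨hη.trans hx.1.le, hx.2.le.trans hΘ⟩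
  have hcos : ∀ θ ∈ Ioo η Θ, 0 < Real.cos η - Real.cos θ := fun θ hθ =>
    sub_pos.2 (Real.strictAntiOn_cos ⟨hη, (hθ.1.trans (hθ.2.trans_le hΘ)).le⟩ (hsub hθ) hθ.1)
  have himg := lintegral_image_eq_lintegral_abs_deriv_mul (s := Ioo η Θ) measurableSet_Ioo
    (f := fun θ => Real.cos η - Real.cos θ) (f' := fun θ => Real.sin θ)
    (fun θ _ => by simpa using ((Real.hasDerivAt_cos θ).const_sub (Real.cos η)).hasDerivWithinAt)
    (fun x hx y hy h => Real.injOn_cos (hsub hx) (hsub hy) (by simpa using h))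
    (fun v => ENNReal.ofReal (v ^ (α - 1)))
  calc _ = ∫⁻ θ in Ioo η Θ, ENNReal.ofReal |Real.sin θ| *
        ENNReal.ofReal ((Real.cos η - Real.cos θ) ^ (α - 1)) := by
        refine setLIntegral_congr_fun measurableSet_Ioo fun θ hθ => ?_
        rw [abs_of_pos (hcos θ hθ), abs_of_nonneg (Real.sin_nonneg_of_mem_Icc (hsub hθ))]
    _ = _ := himg.symm
    _ ≤ _ := by
        refine lintegral_mono_set ?_
        rintro v ⟨θ, hθ, rfl⟩
        exact ⟨hcos θ hθ, by linarith [Real.cos_le_one η, Real.neg_one_le_cos θ]⟩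

theorem lintegral_rpow_sub_one_lt_top {α : ℝ} (hα : 0 < α) :
    ∫⁻ v in Ioc (0 : ℝ) 2, ENNReal.ofReal (v ^ (α - 1)) < ⊤ := by
  have h := (intervalIntegrable_iff_integrableOn_Ioc_of_le (zero_le_two)).1
    (intervalIntegral.intervalIntegrable_rpow' (a := 0) (b := 2) (r := α - 1) (by linarith))
  have h2 := h.2
  rw [hasFiniteIntegral_iff_ofReal] at h2
  · exact h2
  · filter_upwards [ae_restrict_mem measurableSet_Ioc] with v hv
    exact Real.rpow_nonneg hv.1.le _

/-- If the fractional integrals of order `α + 1` of a measure are finite almost everywhere, so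
are those of order `α`. -/
theorem ae_lintegral_abel_lt_top {α : ℝ} (hα : 0 < α) (M : Measure ℝ)
    (h : ∀ᵐ θ ∂(volume.restrict (Ioo 0 Real.pi)),
      ∫⁻ η in Ioo 0 θ, ENNReal.ofReal (|Real.cos η - Real.cos θ| ^ α) ∂M < ⊤) :
    ∀ᵐ θ ∂(volume.restrict (Ioo 0 Real.pi)),
      ∫⁻ η in Ioo 0 θ, ENNReal.ofReal (|Real.cos η - Real.cos θ| ^ (α - 1)) ∂M < ⊤ := by
  have main : ∀ Θ ∈ Ioo 0 Real.pi, ∀ᵐ θ ∂(volume.restrict (Ioo 0 Θ)),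
      ∫⁻ η in Ioo 0 θ, ENNReal.ofReal (|Real.cos η - Real.cos θ| ^ (α - 1)) ∂M < ⊤ := by
    intro Θ hΘ
    -- At some θ₀ beyond Θ the integral of exponent α is finite, and there the kernel is bounded
    -- below on (0, Θ) by the positive number (cos Θ - cos θ₀)^α.
    have hfin : M (Ioo 0 Θ) < ⊤ := by
      have h1 := ae_restrict_of_ae_restrict_of_subset
        (Ioo_subset_Ioo_left hΘ.1.le : Ioo Θ Real.pi ⊆ Ioo 0 Real.pi) h
      have : (ae (volume.restrict (Ioo Θ Real.pi))).NeBot := by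
        rw [ae_neBot, Ne, Measure.restrict_eq_zero, Real.volume_Ioo, ENNReal.ofReal_eq_zero]
        linarith [hΘ.2]
      obtain ⟨θ₀, h2, h3⟩ := (h1.and (ae_restrict_mem measurableSet_Ioo)).exists
      have hd : 0 < Real.cos Θ - Real.cos θ₀ :=
        sub_pos.2 ((cos_lt_cos_iff_of_mem hΘ ⟨hΘ.1.trans h3.1, h3.2⟩).2 h3.1)
      have h4 : ENNReal.ofReal ((Real.cos Θ - Real.cos θ₀) ^ α) * M (Ioo 0 Θ) < ⊤ := by
        refine lt_of_le_of_lt ?_ h2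
        rw [← setLIntegral_const]
        refine (setLIntegral_mono' measurableSet_Ioo fun η hη => ?_).trans
          (lintegral_mono_set (Ioo_subset_Ioo_right h3.1.le))
        have h5 : Real.cos Θ < Real.cos η :=
          (cos_lt_cos_iff_of_mem ⟨hη.1, hη.2.trans hΘ.2⟩ hΘ).2 hη.2
        refine ENNReal.ofReal_le_ofReal (Real.rpow_le_rpow hd.le ?_ hα.le)
        exact (by linarith : _ ≤ Real.cos η - Real.cos θ₀).trans (le_abs_self _)
      refine (ENNReal.mul_lt_top_iff.1 h4).elim (fun h => h.2) fun h => ?_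
      rcases h with h | h
      · rw [ENNReal.ofReal_eq_zero] at h
        exact absurd (Real.rpow_pos_of_pos hd α) (not_lt.2 h)
      · rw [h]; exact ENNReal.zero_lt_top
    -- This also supplies the σ-finiteness for Tonelli; M itself is arbitrary.
    have : IsFiniteMeasure (M.restrict (Ioo 0 Θ)) := ⟨by simpa using hfin⟩
    -- The weight sin θ is the Jacobian of the substitution v = cos η - cos θ; being positive on (0,
    -- π), it is removed at the end.
    set F : ℝ × ℝ → ENNReal := {p : ℝ × ℝ | p.2 < p.1}.indicator fun p =>
      ENNReal.ofReal (Real.sin p.1) * ENNReal.ofReal (|Real.cos p.2 - Real.cos p.1| ^ (α - 1)) with hF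
    have hFm : Measurable F := by
      refine Measurable.indicator ?_ (measurableSet_lt measurable_snd measurable_fst)
      fun_prop
    have hJ : ∫⁻ θ in Ioo 0 Θ, ∫⁻ η in Ioo 0 Θ, F (θ, η) ∂M < ⊤ := by
      rw [lintegral_lintegral_swap (f := fun θ η => F (θ, η)) hFm.aemeasurable]
      calc _ ≤ ∫⁻ η in Ioo 0 Θ, (∫⁻ v in Ioc (0 : ℝ) 2, ENNReal.ofReal (v ^ (α - 1))) ∂M := by
            refine setLIntegral_mono' measurableSet_Ioo fun η hη => ?_
            refine le_trans ?_ (lintegral_abel_kernel_le (α := α) hη.1.le hΘ.2.le)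
            rw [← lintegral_indicator measurableSet_Ioo, ← lintegral_indicator measurableSet_Ioo]
            refine lintegral_mono fun θ => ?_
            by_cases h1 : η < θ <;> by_cases h2 : θ < Θ <;> by_cases h3 : 0 < θ <;>
              simp [hF, indicator, h1, h2, h3]
        _ < ⊤ := by
            rw [setLIntegral_const]
            exact ENNReal.mul_lt_top (lintegral_rpow_sub_one_lt_top hα) hfin
    filter_upwards [ae_lt_top hFm.lintegral_prod_right' hJ.ne, ae_restrict_mem measurableSet_Ioo]
      with θ h1 h2
    have hs : 0 < Real.sin θ := Real.sin_pos_of_mem_Ioo ⟨h2.1, h2.2.trans hΘ.2⟩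
    have h3 : ENNReal.ofReal (Real.sin θ) *
        ∫⁻ η in Ioo 0 θ, ENNReal.ofReal (|Real.cos η - Real.cos θ| ^ (α - 1)) ∂M < ⊤ := by
      refine lt_of_le_of_lt ?_ h1
      rw [← lintegral_const_mul _ (by fun_prop), ← lintegral_indicator measurableSet_Ioo,
        ← lintegral_indicator measurableSet_Ioo]
      refine lintegral_mono fun η => ?_
      by_cases h4 : 0 < η <;> by_cases h5 : η < θ
      · simp [hF, indicator, h4, h5, h5.trans h2.2]
      all_goals simp [indicator, h4, h5]
    refine (ENNReal.mul_lt_top_iff.1 h3).elim (fun h => h.2) fun h => ?_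
    rcases h with h | h
    · rw [ENNReal.ofReal_eq_zero] at h
      exact absurd hs (not_lt.2 h)
    · rw [h]; exact ENNReal.zero_lt_top
  rw [ae_restrict_iff' measurableSet_Ioo]
  -- The exceptional null set depends on Θ, so Θ is restricted to the rationals in (0, π).
  have hq : ∀ᵐ θ : ℝ, ∀ q : ℚ, (q : ℝ) ∈ Ioo 0 Real.pi → θ ∈ Ioo 0 (q : ℝ) →
      ∫⁻ η in Ioo 0 θ, ENNReal.ofReal (|Real.cos η - Real.cos θ| ^ (α - 1)) ∂M < ⊤ := by
    rw [ae_all_iff]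
    intro q
    by_cases hq : (q : ℝ) ∈ Ioo 0 Real.pi
    · filter_upwards [(ae_restrict_iff' measurableSet_Ioo).1 (main q hq)] with θ hθ _ using hθ
    · exact .of_forall fun θ h => absurd h hq
  filter_upwards [hq] with θ hθ hmem
  obtain ⟨q, h1, h2⟩ := exists_rat_btwn hmem.2
  exact hθ q ⟨hmem.1.trans h1, h2⟩ ⟨hmem.1, h1⟩

theorem ae_reflect {P : ℝ → Prop} (h : ∀ᵐ θ ∂(volume.restrict (Ioo 0 Real.pi)), P θ) :
    ∀ᵐ θ ∂(volume.restrict (Ioo 0 Real.pi)), P (Real.pi - θ) := by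
  have hp := (Measure.measurePreserving_sub_left volume Real.pi).restrict_preimage
    (measurableSet_Ioo (a := (0 : ℝ)) (b := Real.pi))
  have he : (fun x => Real.pi - x) ⁻¹' Ioo 0 Real.pi = Ioo 0 Real.pi := by
    ext x; simp [and_comm]
  rw [he] at hp
  exact hp.quasiMeasurePreserving.ae h

theorem setLIntegral_map_reflect (M : Measure ℝ) (θ β : ℝ) :
    ∫⁻ η in Ioo 0 (Real.pi - θ), ENNReal.ofReal (|Real.cos η - Real.cos (Real.pi - θ)| ^ β)
      ∂(M.map fun x => Real.pi - x) =
    ∫⁻ η in Ioo θ Real.pi, ENNReal.ofReal (|Real.cos η - Real.cos θ| ^ β) ∂M := by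
  rw [setLIntegral_map measurableSet_Ioo (by fun_prop) (by fun_prop)]
  have he : (fun x => Real.pi - x) ⁻¹' Ioo 0 (Real.pi - θ) = Ioo θ Real.pi := by
    ext x; simp
  rw [he]
  refine lintegral_congr fun η => ?_
  rw [Real.cos_pi_sub, Real.cos_pi_sub, abs_sub_comm]
  congr 3; ring

/-- The reflection η ↦ π - η changes the sign of the cosine and exchanges the two sides of θ. -/
theorem ae_lintegral_abel_lt_top' {α : ℝ} (hα : 0 < α) (M : Measure ℝ)
    (h : ∀ᵐ θ ∂(volume.restrict (Ioo 0 Real.pi)),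
      ∫⁻ η in Ioo θ Real.pi, ENNReal.ofReal (|Real.cos η - Real.cos θ| ^ α) ∂M < ⊤) :
    ∀ᵐ θ ∂(volume.restrict (Ioo 0 Real.pi)),
      ∫⁻ η in Ioo θ Real.pi, ENNReal.ofReal (|Real.cos η - Real.cos θ| ^ (α - 1)) ∂M < ⊤ := by
  have h1 := ae_lintegral_abel_lt_top hα (M.map fun x => Real.pi - x) (by
    filter_upwards [ae_reflect h] with θ hθ
    have := setLIntegral_map_reflect M (Real.pi - θ) α
    rw [sub_sub_cancel] at this
    rwa [this])
  filter_upwards [ae_reflect h1] with θ hθ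
  rwa [setLIntegral_map_reflect] at hθ

/-! ### Existence almost everywhere implies finite means over almost every parallel. -/

theorem cos_ne_of_ne {θ η : ℝ} (hθ : θ ∈ Ioo 0 Real.pi) (hη : η ∈ Ioo 0 Real.pi) (hne : η ≠ θ) :
    0 < |Real.cos η - Real.cos θ| :=
  abs_pos.2 (sub_ne_zero.2 fun h =>
    hne (Real.injOn_cos (Ioo_subset_Icc_self hη) (Ioo_subset_Icc_self hθ) h))

theorem polarCoef_pos {n j : ℕ} (hn : 1 ≤ n) (α : ℝ) {θ η : ℝ} (hθ : θ ∈ Ioo 0 Real.pi)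
    (hη : η ∈ Ioo 0 Real.pi) (hne : η ≠ θ) : 0 < polarCoef n j α θ η := by
  have ha := tan_half_pos hθ
  have hb := tan_half_pos hη
  have hM : 0 < max (Real.tan (θ / 2)) (Real.tan (η / 2)) := lt_max_of_lt_left ha
  obtain ⟨h0, h1⟩ := min_div_max_mem ha hb (tan_half_ne hθ hη hne)
  have := sphereArea_pos hn
  have hc := cos_ne_of_ne hθ hη hne
  unfold polarCoef chordCoef
  set s := min (Real.tan (θ / 2)) (Real.tan (η / 2)) / max (Real.tan (θ / 2)) (Real.tan (η / 2))
  have h2 : 0 < 1 - s ^ 2 := by nlinarith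
  positivity

theorem abs_cos_sub_cos_tan_half {θ η : ℝ} (hθ : θ ∈ Ioo 0 Real.pi) (hη : η ∈ Ioo 0 Real.pi) :
    |Real.cos η - Real.cos θ| = 2 * |Real.tan (θ / 2) ^ 2 - Real.tan (η / 2) ^ 2| /
      ((1 + Real.tan (θ / 2) ^ 2) * (1 + Real.tan (η / 2) ^ 2)) := by
  rw [cos_sub_cos_tan_half hθ hη, abs_div, abs_mul, abs_of_pos (zero_lt_two),
    abs_of_pos (by positivity : 0 < (1 + Real.tan (θ / 2) ^ 2) * (1 + Real.tan (η / 2) ^ 2))]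

theorem one_sub_min_div_max_sq {a b : ℝ} (ha : 0 < a) (hb : 0 < b) :
    1 - (min a b / max a b) ^ 2 = |a ^ 2 - b ^ 2| / max a b ^ 2 := by
  rcases le_total a b with h | h
  · rw [max_eq_right h, min_eq_left h, abs_of_nonpos (by nlinarith)]; field_simp; ring
  · rw [max_eq_left h, min_eq_right h, abs_of_nonneg (by nlinarith)]; field_simp

/-- With T = (1 + a²)(1 + b²) and M = max(a, b), the degree 0 eigenvalue is a constant times
(T/M²)^(n/2-1) |cos η - cos θ|^(α-1). The ratio T/M² is at most (1 + a²)(1 + 1/a²) whatever b is,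
and the exponent n/2 - 1 is nonnegative since n ≥ 2. -/
theorem exists_polarCoef_le {n : ℕ} (hn : 2 ≤ n) (α : ℝ) {θ : ℝ} (hθ : θ ∈ Ioo 0 Real.pi) :
    ∃ D : ℝ, 0 ≤ D ∧ ∀ η ∈ Ioo 0 Real.pi, η ≠ θ →
      polarCoef n 0 α θ η ≤ D * |Real.cos η - Real.cos θ| ^ (α - 1) := by
  have ha := tan_half_pos hθ
  have hσ := sphereArea_pos (n := n) (by omega)
  refine ⟨2 * sphereArea n / 2 ^ n * ((1 + Real.tan (θ / 2) ^ 2) *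
    (1 + 1 / Real.tan (θ / 2) ^ 2)) ^ ((n : ℝ) / 2 - 1), by positivity, fun η hη hne => ?_⟩
  have hb := tan_half_pos hη
  have hab := tan_half_ne hθ hη hne
  have hc := cos_ne_of_ne hθ hη hne
  have hcos := abs_cos_sub_cos_tan_half hθ hη
  rw [polarCoef, chordCoef, one_sub_min_div_max_sq ha hb, Real.rpow_sub_one hc.ne', pow_zero, mul_one]
  generalize Real.tan (θ / 2) = a at *
  generalize Real.tan (η / 2) = b at *
  have hM : 0 < max a b := lt_max_of_lt_left ha
  set M := max a b with hMdef
  set T := (1 + a ^ 2) * (1 + b ^ 2) with hT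
  have hT0 : 0 < T := by positivity
  have hTM : T / M ^ 2 ≤ (1 + a ^ 2) * (1 + 1 / a ^ 2) := by
    rw [div_le_iff₀ (by positivity)]
    have : (1 + a ^ 2) * (1 + 1 / a ^ 2) * M ^ 2 = (1 + a ^ 2) * ((1 + 1 / a ^ 2) * M ^ 2) := by ring
    rw [this, hT]
    refine mul_le_mul_of_nonneg_left ?_ (by positivity)
    have h1 : b ^ 2 ≤ M ^ 2 := pow_le_pow_left₀ hb.le (le_max_right _ _) 2
    have h2 : a ^ 2 ≤ M ^ 2 := pow_le_pow_left₀ ha.le (le_max_left _ _) 2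
    have h3 : 1 ≤ M ^ 2 / a ^ 2 := (one_le_div (by positivity)).2 h2
    have h4 : (1 + 1 / a ^ 2) * M ^ 2 = M ^ 2 / a ^ 2 + M ^ 2 := by ring
    linarith
  have hn2 : (0 : ℝ) ≤ (n : ℝ) / 2 - 1 := by
    have : (2 : ℝ) ≤ n := by exact_mod_cast hn
    linarith
  have hpow := Real.rpow_le_rpow (by positivity) hTM hn2
  have hsub : |a ^ 2 - b ^ 2| = |Real.cos η - Real.cos θ| * T / 2 := by
    rw [hcos]; field_simp
  have e1 : (T / M ^ 2) ^ ((n : ℝ) / 2 - 1) = T ^ ((n : ℝ) / 2) / T * (M ^ 2 / M ^ n) := by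
    rw [Real.div_rpow hT0.le (by positivity), Real.rpow_sub_one hT0.ne', Real.rpow_sub_one (by positivity),
      ← Real.rpow_natCast_mul hM.le, Nat.cast_ofNat, mul_div_cancel₀ _ two_ne_zero, Real.rpow_natCast]
    field_simp
  rw [e1] at hpow
  set x := |Real.cos η - Real.cos θ|
  have hx := Real.rpow_pos_of_pos hc α
  calc x ^ α * (T ^ ((n : ℝ) / 2) / (2 * M) ^ n / (|a ^ 2 - b ^ 2| / M ^ 2) * sphereArea n)
      = 2 * sphereArea n / 2 ^ n * (T ^ ((n : ℝ) / 2) / T * (M ^ 2 / M ^ n)) * (x ^ α / x) := by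
        rw [hsub, mul_pow]; field_simp
    _ ≤ _ := by gcongr

section Finiteness

variable {n : ℕ} {α θ : ℝ} {A : Set ℝ} {B : Set (USphere (n + 1))}
  {K : USphere n → USphere (n + 1) → ℝ} {ψ : USphere (n + 1) → ℂ}

/-- The integral of `|ψ|` over the parallel at angle `η`. -/
def parallelNorm (ψ : USphere (n + 1) → ℂ) (η : ℝ) : ENNReal :=
  ∫⁻ ζ : USphere n, ‖ψ (polarPt η ζ)‖ₑ ∂(surf n)

theorem measurable_parallelNorm (hψ : Measurable ψ) : Measurable (parallelNorm ψ) :=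
  (hψ.enorm.comp continuous_polarPt.measurable).lintegral_prod_right'

theorem polarKer_nonneg (η : ℝ) (ξ ζ : USphere n) : 0 ≤ polarKer n α θ η ξ ζ := by
  unfold polarKer; positivity

theorem measurable_polarKer : Measurable fun q : (ℝ × USphere n) × USphere n =>
    polarKer n α θ q.1.1 q.2 q.1.2 := by
  have h1 : Continuous fun q : (ℝ × USphere n) × USphere n => polarPt θ q.2 :=
    continuous_polarPt.comp (f := fun q : (ℝ × USphere n) × USphere n => (θ, q.2)) (by fun_prop)
  have h2 : Continuous fun q : (ℝ × USphere n) × USphere n => polarPt q.1.1 q.1.2 :=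
    continuous_polarPt.comp (f := fun q : (ℝ × USphere n) × USphere n => q.1) (by fun_prop)
  have h3 : Measurable fun q : (ℝ × USphere n) × USphere n =>
      |Real.cos q.1.1 - Real.cos θ| ^ α := by fun_prop
  unfold polarKer
  exact h3.mul (((continuous_subtype_val.comp h1).sub (continuous_subtype_val.comp h2)).norm.pow
    n).measurable.inv

theorem setLIntegral_kernel_eq
    (hres : (surf (n + 1)).restrict B =
      (((polarMeas n).restrict A).prod (surf n)).map (fun p => polarPt p.1 p.2))
    (hA : MeasurableSet A)
    (hK : Measurable fun q : USphere n × USphere (n + 1) => K q.1 q.2) (hψ : Measurable ψ)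
    (hKer : ∀ η ∈ A, ∀ ξ ζ, K ξ (polarPt η ζ) = polarKer n α θ η ξ ζ) (ξ : USphere n) :
    ∫⁻ y in B, ‖(K ξ y : ℂ) * ψ y‖ₑ ∂(surf (n + 1)) =
      ∫⁻ η in A, (∫⁻ ζ : USphere n, ENNReal.ofReal (polarKer n α θ η ξ ζ) * ‖ψ (polarPt η ζ)‖ₑ
        ∂(surf n)) ∂(polarMeas n) := by
  have hKψ : Measurable fun y => ‖(K ξ y : ℂ) * ψ y‖ₑ :=
    ((Complex.measurable_ofReal.comp (hK.comp (measurable_const.prodMk measurable_id))).mul hψ).enorm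
  have hKψ' : Measurable fun p : ℝ × USphere n =>
      ‖(K ξ (polarPt p.1 p.2) : ℂ) * ψ (polarPt p.1 p.2)‖ₑ := hKψ.comp continuous_polarPt.measurable
  rw [hres, lintegral_map hKψ continuous_polarPt.measurable, lintegral_prod _ hKψ'.aemeasurable]
  refine setLIntegral_congr_fun hA fun η hη => ?_
  refine lintegral_congr fun ζ => ?_
  rw [hKer η hη, enorm_mul]
  congr 1
  rw [← Real.enorm_of_nonneg (polarKer_nonneg η ξ ζ)]
  simp [enorm_eq_nnnorm]

/-- Chords have length at most 2, so the kernel is at least 2^(-n) |cos η - cos θ|^α for every ζ,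
and a single point ξ of the parallel controls the integral. -/
theorem lintegral_abel_lt_top_of_exists (hθ : θ ∈ Ioo 0 Real.pi)
    (hA : MeasurableSet A) (hsub : A ⊆ Ioo 0 Real.pi) (hθA : θ ∉ A)
    (hres : (surf (n + 1)).restrict B =
      (((polarMeas n).restrict A).prod (surf n)).map (fun p => polarPt p.1 p.2))
    (hK : Measurable fun q : USphere n × USphere (n + 1) => K q.1 q.2) (hψ : Measurable ψ)
    (hKer : ∀ η ∈ A, ∀ ξ ζ, K ξ (polarPt η ζ) = polarKer n α θ η ξ ζ) (ξ : USphere n)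
    (hfin : ∫⁻ y in B, ‖(K ξ y : ℂ) * ψ y‖ₑ ∂(surf (n + 1)) < ⊤) :
    ∫⁻ η in A, ENNReal.ofReal (|Real.cos η - Real.cos θ| ^ α)
      ∂((polarMeas n).withDensity (parallelNorm ψ)) < ⊤ := by
  have hψm : ∀ η, Measurable fun ζ : USphere n => ‖ψ (polarPt η ζ)‖ₑ := fun η =>
    (hψ.comp (continuous_polarPt.comp (f := fun ζ : USphere n => (η, ζ)) (by fun_prop)).measurable).enorm
  rw [setLIntegral_kernel_eq hres hA hK hψ hKer] at hfin
  have h2 : ENNReal.ofReal ((2 ^ n)⁻¹) * ∫⁻ η in A, ENNReal.ofReal (|Real.cos η - Real.cos θ| ^ α)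
      ∂((polarMeas n).withDensity (parallelNorm ψ)) < ⊤ := by
    refine lt_of_le_of_lt ?_ hfin
    rw [setLIntegral_withDensity_eq_setLIntegral_mul _ (measurable_parallelNorm hψ) (by fun_prop) hA,
      ← lintegral_const_mul _ ((measurable_parallelNorm hψ).mul (by fun_prop))]
    refine setLIntegral_mono' hA fun η hη => ?_
    have e : ENNReal.ofReal ((2 ^ n)⁻¹) * (parallelNorm ψ *
        fun η => ENNReal.ofReal (|Real.cos η - Real.cos θ| ^ α)) η =
        ∫⁻ ζ : USphere n, ENNReal.ofReal ((2 ^ n)⁻¹ * |Real.cos η - Real.cos θ| ^ α) *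
          ‖ψ (polarPt η ζ)‖ₑ ∂(surf n) := by
      rw [lintegral_const_mul _ (hψm η), ENNReal.ofReal_mul (by positivity), Pi.mul_apply, parallelNorm]
      ring
    rw [e]
    refine lintegral_mono fun ζ => mul_le_mul_left (ENNReal.ofReal_le_ofReal ?_) _
    rw [polarKer, mul_comm]
    refine mul_le_mul_of_nonneg_left ?_ (by positivity)
    -- The inverse of 0 is 0, so the lower bound for the inverse power requires distinct points.
    have hne : (polarPt θ ξ : EuclideanSpace ℝ (Fin (n + 1))) - (polarPt η ζ : EuclideanSpace ℝ (Fin (n + 1))) ≠ 0 := by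
      intro h0
      have h3 : polarPt θ ξ = polarPt η ζ := Subtype.ext (sub_eq_zero.1 h0)
      have h4 := congrArg lastCoord h3
      rw [lastCoord_polarPt, lastCoord_polarPt, neg_inj] at h4
      have := cos_ne_of_ne hθ (hsub hη) (fun h => hθA (h ▸ hη))
      rw [h4, sub_self, abs_zero] at this
      exact lt_irrefl _ this
    refine inv_anti₀ (pow_pos (norm_pos_iff.2 hne) n) (pow_le_pow_left₀ (norm_nonneg _) ?_ n)
    refine (norm_sub_le _ _).trans ?_
    have h5 : ‖(polarPt θ ξ : EuclideanSpace ℝ (Fin (n + 1)))‖ = 1 := norm_polarVec θ ξ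
    have h6 : ‖(polarPt η ζ : EuclideanSpace ℝ (Fin (n + 1)))‖ = 1 := norm_polarVec η ζ
    rw [h5, h6]; norm_num
  refine (ENNReal.mul_lt_top_iff.1 h2).elim (fun h => h.2) fun h => ?_
  rcases h with h | h
  · rw [ENNReal.ofReal_eq_zero] at h
    exact absurd (by positivity : (0 : ℝ) < (2 ^ n)⁻¹) (not_lt.2 h)
  · rw [h]; exact ENNReal.zero_lt_top

theorem lintegral_polarKer (hn : 2 ≤ n) (hθ : θ ∈ Ioo 0 Real.pi) {η : ℝ}
    (hη : η ∈ Ioo 0 Real.pi) (hne : η ≠ θ) (ζ : USphere n) :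
    ∫⁻ ξ : USphere n, ENNReal.ofReal (polarKer n α θ η ξ ζ) ∂(surf n) =
      ENNReal.ofReal (polarCoef n 0 α θ η) := by
  have h := integral_polarKer hn α (MvPolynomial.isHomogeneous_one (Fin n) ℝ)
    (by simp [polyLaplacian]) hθ hη hne ζ
  have he : ∀ x : EuclideanSpace ℝ (Fin n), evalE (1 : MvPolynomial (Fin n) ℝ) x = 1 := by
    simp [evalE]
  simp only [he, mul_one] at h
  rw [← h, ofReal_integral_eq_lintegral_ofReal _ (.of_forall fun ξ => polarKer_nonneg η ξ ζ)]
  -- The Bochner integral is already known to be a positive number, so the integrand is integrable.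
  refine Integrable.of_integral_ne_zero ?_
  rw [h]
  exact (polarCoef_pos (by omega) α hθ hη hne).ne'

/-- Averaging over ξ first replaces the kernel by its degree 0 eigenvalue, which
`exists_polarCoef_le` bounds by the Abel kernel of exponent α - 1. -/
theorem lintegral_kernel_lt_top (hn : 2 ≤ n) (hθ : θ ∈ Ioo 0 Real.pi)
    (hA : MeasurableSet A) (hsub : A ⊆ Ioo 0 Real.pi) (hθA : θ ∉ A)
    (hres : (surf (n + 1)).restrict B =
      (((polarMeas n).restrict A).prod (surf n)).map (fun p => polarPt p.1 p.2))
    (hK : Measurable fun q : USphere n × USphere (n + 1) => K q.1 q.2) (hψ : Measurable ψ)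
    (hKer : ∀ η ∈ A, ∀ ξ ζ, K ξ (polarPt η ζ) = polarKer n α θ η ξ ζ)
    (hfin : ∫⁻ η in A, ENNReal.ofReal (|Real.cos η - Real.cos θ| ^ (α - 1))
      ∂((polarMeas n).withDensity (parallelNorm ψ)) < ⊤) :
    ∫⁻ ξ : USphere n, (∫⁻ y in B, ‖(K ξ y : ℂ) * ψ y‖ₑ ∂(surf (n + 1))) ∂(surf n) < ⊤ := by
  obtain ⟨D, hD0, hD⟩ := exists_polarCoef_le hn α hθ
  have hψm : Measurable fun p : ℝ × USphere n => ‖ψ (polarPt p.1 p.2)‖ₑ :=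
    (hψ.comp continuous_polarPt.measurable).enorm
  have hm : Measurable fun q : (ℝ × USphere n) × USphere n =>
      ENNReal.ofReal (polarKer n α θ q.1.1 q.2 q.1.2) * ‖ψ (polarPt q.1.1 q.1.2)‖ₑ :=
    measurable_polarKer.ennreal_ofReal.mul (hψm.comp measurable_fst)
  simp_rw [setLIntegral_kernel_eq hres hA hK hψ hKer]
  rw [lintegral_lintegral_swap]
  swap
  · refine Measurable.aemeasurable ?_
    exact (hm.comp (f := fun q : (USphere n × ℝ) × USphere n => ((q.1.2, q.2), q.1.1))
      (by fun_prop)).lintegral_prod_right'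
  calc _ ≤ ∫⁻ η in A, ENNReal.ofReal D * (parallelNorm ψ η *
        ENNReal.ofReal (|Real.cos η - Real.cos θ| ^ (α - 1))) ∂(polarMeas n) := by
        refine setLIntegral_mono' hA fun η hη => ?_
        have hne : η ≠ θ := fun h => hθA (h ▸ hη)
        rw [lintegral_lintegral_swap]
        swap
        · exact (hm.comp (f := fun q : USphere n × USphere n => ((η, q.2), q.1))
            (by fun_prop)).aemeasurable
        have h1 : ∀ ζ : USphere n, ∫⁻ ξ : USphere n, ENNReal.ofReal (polarKer n α θ η ξ ζ) *
            ‖ψ (polarPt η ζ)‖ₑ ∂(surf n) = ENNReal.ofReal (polarCoef n 0 α θ η) * ‖ψ (polarPt η ζ)‖ₑ := by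
          intro ζ
          rw [lintegral_mul_const, lintegral_polarKer hn hθ (hsub hη) hne]
          exact (measurable_polarKer.comp (f := fun ξ : USphere n => ((η, ζ), ξ))
            (by fun_prop)).ennreal_ofReal
        simp_rw [h1]
        have hψη : Measurable fun ζ : USphere n => ‖ψ (polarPt η ζ)‖ₑ :=
          hψm.comp (f := fun ζ : USphere n => (η, ζ)) (by fun_prop)
        rw [lintegral_const_mul _ hψη]
        calc _ ≤ ENNReal.ofReal (D * |Real.cos η - Real.cos θ| ^ (α - 1)) * parallelNorm ψ η :=
              mul_le_mul_left (ENNReal.ofReal_le_ofReal (hD η (hsub hη) hne)) _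
          _ = _ := by rw [ENNReal.ofReal_mul hD0]; ring
    _ = ENNReal.ofReal D * ∫⁻ η in A, ENNReal.ofReal (|Real.cos η - Real.cos θ| ^ (α - 1))
      ∂((polarMeas n).withDensity (parallelNorm ψ)) := by
        rw [setLIntegral_withDensity_eq_setLIntegral_mul _ (measurable_parallelNorm hψ) (by fun_prop) hA,
          ← lintegral_const_mul _ ((measurable_parallelNorm hψ).mul (by fun_prop))]
        rfl
    _ < ⊤ := ENNReal.mul_lt_top ENNReal.ofReal_lt_top hfin

end Finiteness

/-- The density sin^(n-1) η is positive on (0, π), so null sets of angles for the polar measure are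
Lebesgue null. -/
theorem restrict_absolutelyContinuous_polarMeas (n : ℕ) :
    volume.restrict (Ioo 0 Real.pi) ≪ polarMeas n := by
  refine withDensity_absolutelyContinuous' (by fun_prop) ?_
  filter_upwards [ae_restrict_mem measurableSet_Ioo] with η hη
  rw [Ne, ENNReal.ofReal_eq_zero, not_le]
  exact pow_pos (Real.sin_pos_of_mem_Ioo hη) _

theorem ae_ae_polarPt {n : ℕ} (hn : 1 ≤ n) {P : USphere (n + 1) → Prop}
    (h : ∀ᵐ x ∂(surf (n + 1)), P x) :
    ∀ᵐ θ ∂(volume.restrict (Ioo 0 Real.pi)), ∀ᵐ ξ ∂(surf n), P (polarPt θ ξ) := by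
  rw [surf_eq_map_polarPt hn] at h
  exact (restrict_absolutelyContinuous_polarMeas n).ae_le
    (Measure.ae_ae_of_ae_prod (ae_of_ae_map continuous_polarPt.measurable.aemeasurable h))

theorem surf_ne_zero {n : ℕ} (hn : 1 ≤ n) : (ae (surf n)).NeBot := by
  rw [ae_neBot]
  intro h
  have := surf_real_univ hn
  rw [h] at this
  simp at this
  exact (sphereArea_pos hn).ne this

theorem ae_sPlusFiniteAt {n : ℕ} (hn : 2 ≤ n) {α : ℝ} (hα : 0 < α) {ψ : USphere (n + 1) → ℂ}
    (hψ : Measurable ψ) (h : ∀ᵐ x ∂(surf (n + 1)), SPlusExists n α ψ x) :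
    ∀ᵐ θ ∂(volume.restrict (Ioo 0 Real.pi)), SPlusFiniteAt n α ψ θ := by
  have := surf_ne_zero (n := n) (by omega)
  have h1 := ae_lintegral_abel_lt_top hα ((polarMeas n).withDensity (parallelNorm ψ)) (by
    filter_upwards [ae_ae_polarPt (by omega) h, ae_restrict_mem measurableSet_Ioo] with θ h1 hθ
    obtain ⟨ξ, hξ⟩ := h1.exists
    have hfin := hξ.2
    rw [HasFiniteIntegral, lastCoord_polarPt] at hfin
    exact lintegral_abel_lt_top_of_exists hθ measurableSet_Ioo
      (fun η hη => ⟨hη.1, hη.2.trans hθ.2⟩) (fun h => lt_irrefl _ h.2)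
      (surf_restrict_below (by omega) hθ) (measurable_kerLeft α θ) hψ
      (fun η hη => kerLeft_polarPt hθ hη) ξ hfin)
  filter_upwards [h1, ae_restrict_mem measurableSet_Ioo] with θ h1 hθ
  simp only [SPlusFiniteAt, lastCoord_polarPt]
  exact lintegral_kernel_lt_top hn hθ measurableSet_Ioo
    (fun η hη => ⟨hη.1, hη.2.trans hθ.2⟩) (fun h => lt_irrefl _ h.2)
    (surf_restrict_below (by omega) hθ) (measurable_kerLeft α θ) hψ
    (fun η hη => kerLeft_polarPt hθ hη) h1

theorem ae_sMinusFiniteAt {n : ℕ} (hn : 2 ≤ n) {α : ℝ} (hα : 0 < α) {ψ : USphere (n + 1) → ℂ}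
    (hψ : Measurable ψ) (h : ∀ᵐ x ∂(surf (n + 1)), SMinusExists n α ψ x) :
    ∀ᵐ θ ∂(volume.restrict (Ioo 0 Real.pi)), SMinusFiniteAt n α ψ θ := by
  have := surf_ne_zero (n := n) (by omega)
  have h1 := ae_lintegral_abel_lt_top' hα ((polarMeas n).withDensity (parallelNorm ψ)) (by
    filter_upwards [ae_ae_polarPt (by omega) h, ae_restrict_mem measurableSet_Ioo] with θ h1 hθ
    obtain ⟨ξ, hξ⟩ := h1.exists
    have hfin := hξ.2
    rw [HasFiniteIntegral, lastCoord_polarPt] at hfin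
    exact lintegral_abel_lt_top_of_exists hθ measurableSet_Ioo
      (fun η hη => ⟨hθ.1.trans hη.1, hη.2⟩) (fun h => lt_irrefl _ h.1)
      (surf_restrict_above (by omega) hθ) (measurable_kerRight α θ) hψ
      (fun η hη => kerRight_polarPt hθ hη) ξ hfin)
  filter_upwards [h1, ae_restrict_mem measurableSet_Ioo] with θ h1 hθ
  simp only [SMinusFiniteAt, lastCoord_polarPt]
  exact lintegral_kernel_lt_top hn hθ measurableSet_Ioo
    (fun η hη => ⟨hθ.1.trans hη.1, hη.2⟩) (fun h => lt_irrefl _ h.1)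
    (surf_restrict_above (by omega) hθ) (measurable_kerRight α θ) hψ
    (fun η hη => kerRight_polarPt hθ hη) h1

end

/-! ### The theorem, by passage to a Borel representative of φ. -/

theorem mainTheorem9 (n : ℕ) (hn : 2 ≤ n) (α : ℝ) (hα : 0 < α)
    (Y : (j : ℕ) → Fin (sphHarmDim n j) → USphere n → ℝ) (hY : IsSphHarmBasis n Y)
    (φ : USphere (n + 1) → ℂ) (hφ : AEStronglyMeasurable φ (surf (n + 1)))
    (u : (j : ℕ) → Fin (sphHarmDim n j) → ℝ → ℂ)
    (hu : ∀ᵐ θ ∂(volume.restrict (Ioo 0 Real.pi)),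
      IsFourierLaplace n Y (fun ξ => φ (polarPt θ ξ)) (fun j k => u j k (Real.tan (θ / 2)))) :
    ((∀ᵐ x ∂(surf (n + 1)), SPlusExists n α φ x) →
      ∀ᵐ θ ∂(volume.restrict (Ioo 0 Real.pi)), PlusExpansionAt n α Y φ u θ) ∧
    ((∀ᵐ x ∂(surf (n + 1)), SMinusExists n α φ x) →
      ∀ᵐ θ ∂(volume.restrict (Ioo 0 Real.pi)), MinusExpansionAt n α Y φ u θ) ∧
    (∀ θ ∈ Ioo 0 Real.pi, SPlusFiniteAt n α φ θ → PlusExpansionAt n α Y φ u θ) ∧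
    (∀ θ ∈ Ioo 0 Real.pi, SMinusFiniteAt n α φ θ → MinusExpansionAt n α Y φ u θ) := by
  -- The parallels are null sets, so φ itself may fail to be measurable on some of them; ψ is Borel.
  -- Both agree almost everywhere on almost every parallel, which is enough to transfer the
  -- hypothesis on the coefficients.
  set ψ := hφ.mk φ with hψdef
  have hψ : Measurable ψ := hφ.stronglyMeasurable_mk.measurable
  have hae : φ =ᵐ[surf (n + 1)] ψ := hφ.ae_eq_mk
  have hres : ∀ B : Set (USphere (n + 1)), φ =ᵐ[(surf (n + 1)).restrict B] ψ := fun B =>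
    ae_restrict_of_ae hae
  have hu' : ∀ᵐ θ ∂(volume.restrict (Ioo 0 Real.pi)),
      IsFourierLaplace n Y (fun ξ => ψ (polarPt θ ξ)) (fun j k => u j k (Real.tan (θ / 2))) := by
    filter_upwards [hu, ae_ae_polarPt (by omega) hae] with θ h1 h2
    refine ⟨h1.1.congr h2, fun j k => (h1.2 j k).trans (integral_congr_ae ?_)⟩
    filter_upwards [h2] with ξ hξ
    rw [hξ]
  have hP : ∀ x, SPlusExists n α φ x ↔ SPlusExists n α ψ x := fun x =>
    integrable_congr ((hres _).mono fun y hy => by simp only [hy])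
  have hM : ∀ x, SMinusExists n α φ x ↔ SMinusExists n α ψ x := fun x =>
    integrable_congr ((hres _).mono fun y hy => by simp only [hy])
  have hPF : ∀ θ, SPlusFiniteAt n α φ θ ↔ SPlusFiniteAt n α ψ θ := fun θ => by
    refine iff_of_eq (congrArg (· < ⊤) (lintegral_congr fun ξ => lintegral_congr_ae ?_))
    exact (hres _).mono fun y hy => by simp only [hy]
  have hMF : ∀ θ, SMinusFiniteAt n α φ θ ↔ SMinusFiniteAt n α ψ θ := fun θ => by
    refine iff_of_eq (congrArg (· < ⊤) (lintegral_congr fun ξ => lintegral_congr_ae ?_))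
    exact (hres _).mono fun y hy => by simp only [hy]
  -- Changing φ on a null set changes no value of the operator. Equality at every x, not merely
  -- almost every x, is what (ii) needs at an individual angle.
  have hPS : SPlus n α φ = SPlus n α ψ := by
    ext x
    refine congrArg _ (integral_congr_ae ?_)
    exact (hres _).mono fun y hy => by simp only [hy]
  have hMS : SMinus n α φ = SMinus n α ψ := by
    ext x
    refine congrArg _ (integral_congr_ae ?_)
    exact (hres _).mono fun y hy => by simp only [hy]
  have hPE : ∀ θ, PlusExpansionAt n α Y φ u θ ↔ PlusExpansionAt n α Y ψ u θ := fun θ => by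
    unfold PlusExpansionAt; rw [hPS]
  have hME : ∀ θ, MinusExpansionAt n α Y φ u θ ↔ MinusExpansionAt n α Y ψ u θ := fun θ => by
    unfold MinusExpansionAt; rw [hMS]
  simp only [hP, hM, hPF, hMF, hPE, hME]
  refine ⟨fun h => ?_, fun h => ?_, fun θ hθ h => plusExpansionAt_of_finite hn hα hY hψ hu' hθ h,
    fun θ hθ h => minusExpansionAt_of_finite hn hα hY hψ hu' hθ h⟩
  · filter_upwards [ae_sPlusFiniteAt hn hα hψ h, ae_restrict_mem measurableSet_Ioo] with θ h1 hθ
    exact plusExpansionAt_of_finite hn hα hY hψ hu' hθ h1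
  · filter_upwards [ae_sMinusFiniteAt hn hα hψ h, ae_restrict_mem measurableSet_Ioo] with θ h1 hθ
    exact minusExpansionAt_of_finite hn hα hY hψ hu' hθ h1
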